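/- Let $$F_0(x,y)=\bigl(x+y+2x^2-2xy-\tfrac12y^2-8x^3-4x^2y-8x^4,\; y-4xy-y^2-16x^3-8x^2y-16x^4\bigr)$$ on $\mathbb C^2$; this is the second iterate $T\circ H_0^2\circ T^{-1}$ of the area-preserving Hénon map $H_0(x,y)=(y,-x+3-y^2)$ in the coordinates $T(x,y)=(y/2-1/2,\,x+y-2)$. For $A>0$ and $\delta\in(0,\pi/2)$ let $D^-_{A,\delta}=\{z\in\mathbb C: |\arg(z+A)|\ge\delta\}$ (with the apex $-A$ included), let $D^+_{A,\delta}$ be its reflection in the imaginary axis, and let $D_{A,\delta}=D^+_{A,\delta}\cap D^-_{A,\delta}\cap\{\Im z<0\}$. For $\delta'\in(0,\pi/2)$ and $B>4\tan\delta'$ let $D^B_{\delta'}=\{z: -\pi+\delta'\le\arg z\le-\delta',\ \Im z\le -B\}$. For $\mu\ge 0$, $\mathcal X_\mu(D)$ is the space of functions continuous on $D$ and analytic in the interior of $D$ with $\|f\|_\mu=\sup_{z\in D}|z^\mu f(z)|<\infty$ (for functions with values in $\mathbb C^2$ the maximum norm of $\mathbb C^2$ is used). Fix $a_2\in\mathbb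 C$. For $0<\varepsilon<1$ the separatrices $\alpha_0^\pm=(x_0^\pm,y_0^\pm)$ on $D^\pm_{A,\delta}$ are solutions of $F_0(\alpha_0^\pm(\tau))=\alpha_0^\pm(\tau+1)$ (for $\tau,\tau+1\in D^\pm_{A,\delta}$) of the form $$\alpha_0^\pm(\tau)=\Bigl(\frac{i/2}{\tau}+\frac{a_2+\xi^\pm(\tau)}{\tau^2},\ \frac{(1-i)/2}{\tau^2}+\frac{(-2i-2)a_2+\frac12+\eta^\pm(\tau)}{\tau^3}\Bigr),\qquad \xi^\pm,\eta^\pm\in\mathcal X_{1-\varepsilon}(D^\pm_{A,\delta}).$$ The normal component of their splitting is $$\hat\Theta(\tau)=\det\begin{pmatrix}\frac{d x_0^-}{d\tau}(\tau) & x_0^+(\tau)-x_0^-(\tau)\\[2pt] \frac{d y_0^-}{d\tau}(\tau) & y_0^+(\tau)-y_0^-(\tau)\end{pmatrix}.$$ **Proposition.** There is a constant $\Theta_1\in\mathbb C$, depending only on $F_0$ and the normalization $a_2$, such that the following holds. Let $A>0$, $\delta,\delta'\in(0,\pi/2)$ and $B>4\tan\delta'$ with $D^B_{\delta'}\subset D_{A,\delta}$.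 For all $\mu,\rho,\kappa>0$ there are constants $K'=K'(\mu,\rho)$ and $K''=K''(\mu,\rho,\kappa)$, depending otherwise only on $A,B,\delta,\delta'$ (and on $F_0$, $a_2$), such that for every $0<\varepsilon<1$ and all separatrices $\alpha_0^\pm$ on $D^\pm_{A,\delta}$ as above there is a function $\hat\Theta_p$ on $D^B_{\delta'}$, independent of $\mu,\rho,\kappa$, with $$\hat\Theta(\tau)=\Theta_1e^{-2\pi i\tau}+\hat\Theta_p(\tau)+O\bigl(e^{-4\pi|\Im\tau|}\bigr)\quad\text{uniformly on } D^B_{\delta'},$$ and, for all $\mu,\rho>0$, $\hat\Theta_p\in\mathcal X_\mu(D^B_{\delta'})$, $$\|\hat\Theta_p\|_\mu\le K'\,\|\alpha_0^+-\alpha_0^-\|_{2-\varepsilon}^2,$$ and, for all $\kappa>0$ and $\tau\in D^B_{\delta'}$, $$|\hat\Theta_p(\tau)|\le K''\,|\tau|^{\frac12+\rho+\varepsilon}\,\|\alpha_0^+-\alpha_0^-\|_{2-\varepsilon}^2\,e^{4\pi(A-(1-\kappa)|\Im\tau|)}.$$ Here $\|\alpha_0^+-\alpha_0^-\|_{2-\varepsilon}$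 is the norm over $D_{A,\delta}$ and $\|\hat\Theta_p\|_\mu$ the norm over $D^B_{\delta'}$. -/

import Mathlib

noncomputable section

namespace HenonSplitting

open Complex

/-- The area-preserving Henon map `H_e(x,y) = (y, -x + 3 + e - y^2)`, complexified. -/
def henon (e : ℂ) (p : ℂ × ℂ) : ℂ × ℂ := (p.2, -p.1 + 3 + e - p.2 ^ 2)

/-- The coordinate change `T(x,y) = (y/2 - 1/2, x + y - 2)`. -/
def coordT (p : ℂ × ℂ) : ℂ × ℂ := (p.2 / 2 - 1 / 2, p.1 + p.2 - 2)

/-- The inverse of `T`. -/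
def coordTInv (p : ℂ × ℂ) : ℂ × ℂ := (p.2 - 2 * p.1 + 1, 2 * p.1 + 1)

/-- The map `F_0`: the second iterate of the Henon map at the period-doubling parameter, in the
coordinates given by `T`; see `F0_eq` below. -/
def F0 (p : ℂ × ℂ) : ℂ × ℂ :=
  (p.1 + p.2 + 2 * p.1 ^ 2 - 2 * p.1 * p.2 - 1 / 2 * p.2 ^ 2 - 8 * p.1 ^ 3
      - 4 * p.1 ^ 2 * p.2 - 8 * p.1 ^ 4,
    p.2 - 4 * p.1 * p.2 - p.2 ^ 2 - 16 * p.1 ^ 3 - 8 * p.1 ^ 2 * p.2 - 16 * p.1 ^ 4)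

theorem coordT_coordTInv (p : ℂ × ℂ) : coordT (coordTInv p) = p := by
  ext <;> simp only [coordT, coordTInv] <;> ring

theorem coordTInv_coordT (p : ℂ × ℂ) : coordTInv (coordT p) = p := by
  ext <;> simp only [coordT, coordTInv] <;> ring

theorem F0_eq (p : ℂ × ℂ) : F0 p = coordT (henon 0 (henon 0 (coordTInv p))) := by
  ext <;> simp only [F0, coordT, henon, coordTInv] <;> ring

/-- `D^-_{A,δ} = {z : |arg (z + A)| ≥ δ}`, the complement of an open sector with apex `-A` that
opens to the right.  The apex is put into the set, so that the set is closed. -/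
def DMinus (A δ : ℝ) : Set ℂ := {z | z + A = 0 ∨ δ ≤ |arg (z + A)|}

/-- `D^+_{A,δ}`, the mirror image of `D^-_{A,δ}` in the imaginary axis. -/
def DPlus (A δ : ℝ) : Set ℂ := {z | -(starRingEnd ℂ) z ∈ DMinus A δ}

/-- `D_{A,δ}`, the part of the common domain of the two separatrices in the lower half plane. -/
def DLower (A δ : ℝ) : Set ℂ := DPlus A δ ∩ DMinus A δ ∩ {z | z.im < 0}

/-- `D^B_δ`, a truncated sector in the lower half plane. -/
def DTrunc (B δ : ℝ) : Set ℂ :=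
  {z | -Real.pi + δ ≤ arg z ∧ arg z ≤ -δ ∧ z.im ≤ -B}

/-- The norm `‖f‖_μ = sup_{z ∈ D} |z^μ f(z)|`; it is meaningful when `MemX D μ f` holds.
For pairs `E = ℂ × ℂ` the norm of `E` is the maximum norm. -/
def normX {E : Type*} [NormedAddCommGroup E] (D : Set ℂ) (μ : ℝ) (f : ℂ → E) : ℝ :=
  sSup ((fun z => ‖z‖ ^ μ * ‖f z‖) '' D)

/-- `f` belongs to the space `X_μ(D)`: it is continuous on `D`, analytic in the interior of `D`,
and `‖f‖_μ` is finite. -/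
def MemX {E : Type*} [NormedAddCommGroup E] [NormedSpace ℂ E]
    (D : Set ℂ) (μ : ℝ) (f : ℂ → E) : Prop :=
  ContinuousOn f D ∧ DifferentiableOn ℂ f (interior D) ∧
    BddAbove ((fun z => ‖z‖ ^ μ * ‖f z‖) '' D)

/-- The curve `τ ↦ (a₁/τ + (a₂ + ξ(τ))/τ^2, b₂/τ^2 + (b₃ + η(τ))/τ^3)` with
`a₁ = i/2`, `b₂ = (1 - i)/2`, `b₃ = (-2i - 2) a₂ + 1/2`. -/
def sepCurve (a₂ : ℂ) (ξ η : ℂ → ℂ) (τ : ℂ) : ℂ × ℂ :=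
  ((I / 2) / τ + (a₂ + ξ τ) / τ ^ 2,
    ((1 - I) / 2) / τ ^ 2 + (((-2 * I - 2) * a₂ + 1 / 2) + η τ) / τ ^ 3)

/-- `(ξ, η) ∈ X_{1-ε}(D) × X_{1-ε}(D)`, and the curve `α` given by `(ξ, η)` solves
`F_0(α(τ)) = α(τ+1)` in `D`.  With `D = D^-_{A,δ}` the curve is the unstable separatrix
`α_0^-`, with `D = D^+_{A,δ}` it is the stable separatrix `α_0^+`. -/
def IsSeparatrix (D : Set ℂ) (ε : ℝ) (a₂ : ℂ) (ξ η : ℂ → ℂ) : Prop :=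
  MemX D (1 - ε) ξ ∧ MemX D (1 - ε) η ∧
    ∀ τ ∈ D, τ + 1 ∈ D → F0 (sepCurve a₂ ξ η τ) = sepCurve a₂ ξ η (τ + 1)

/-- The normal component of the splitting,
`det [(α^-)', α^+ - α^-]`.  The derivative of `α^-` is taken within its domain `D`. -/
def normalSplitting (D : Set ℂ) (αm αp : ℂ → ℂ × ℂ) (τ : ℂ) : ℂ :=
  Matrix.det !![derivWithin (fun s => (αm s).1) D τ, (αp τ).1 - (αm τ).1;
                derivWithin (fun s => (αm s).2) D τ, (αp τ).2 - (αm τ).2]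

end HenonSplitting

end

/-!
The splitting of the separatrices is exponentially small because two effects fit together: the
difference of two solutions of `α(τ + 1) = F₀(α(τ))` satisfies a nearly constant difference
equation, and an analytic function in a lower half plane that is nearly one-periodic and small at
infinity is exponentially small.

*Modes.* Along a separatrix the linearisation of `F₀` has one component that behaves like `τ³` and
one that behaves like `τ⁻²`. In the coordinates `modeA`, `modeB` one step multiplies them by `1 +
3/τ` and `1 - 2/τ`, up to a relative error `O(τ⁻²)`, also for the difference of two nonlinear
orbits (`exists_mode_step`). The difference of two curves with the same `a₂` is `o(τ⁻²)`, which is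
smaller than both modes. Hence two unstable, or two stable, separatrices coincide
(`sepCurve_eq_of_DMinus`, `sepCurve_eq_of_DPlus`).

*Exponential decay.* The modes divided by `τ³` and by `τ⁻²` change by small amounts under `τ ↦ τ +
1`. Integrating such a function around a rectangle of width one against the one-periodic kernel
`e^{2πi(s-τ)} / (e^{2πi(s-τ)} - 1)` bounds it by these changes and by its values on the horizontal
sides (`norm_sub_mean_le`). Iterating this bound shows that `α⁺ - α⁻` decays with every rate below
`2π` (`exists_exp_bound_of_mode_equations`), first in a central strip and then, by unit shifts, in
the whole domain (`IsSeparatrixPair.exists_modeSize_curveDiff_le`).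

*Leading term.* `F₀` preserves area, and its derivative maps tangent vectors of `α⁻` to each
other. So the normal component `Θ̂`, the area spanned by the tangent vector and `α⁺ - α⁻`, is
one-periodic up to an error quadratic in `α⁺ - α⁻`
(`IsSeparatrixPair.exists_normalSplitting_step`), which decays with every rate below `4π`. The
same kernel applied to `e^{2πiτ} Θ̂(τ)` gives a constant `Θ₁` such that `Θ̂(τ) - Θ₁ e^{-2πiτ}`
decays with every rate below `4π` (`IsSeparatrixPair.exists_hasLeadingTerm`). By uniqueness of the
separatrices `Θ₁` depends on `a₂` only (`exists_common_leadingTerm`).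

*Constants.* The function `Θ̂_p` is taken to be the whole remainder `Θ̂(τ) - Θ₁ e^{-2πiτ}`, so
that the `O(e^{-4π|Im τ|})` term is zero; such a term satisfies all bounds required of `Θ̂_p`. By
uniqueness the splitting on a given domain does not depend on `ε`. Either it vanishes identically,
and with it `Θ̂` and `Θ₁`, or its norms for the weights `2 - ε` are bounded below by a positive
constant, namely by its value at a point. In both cases the bounds of `Θ̂_p` can be written with
the factor `‖α⁺ - α⁻‖²` (`IsSeparatrixPair.exists_norm_remainder_le`).
-/

noncomputable section

namespace HenonSplitting

open Complex

/-! ### The linearised map in sheared coordinates -/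

/-- The point `(x, y)` with `x = (i/2) w + e w²` and `y = ((1-i)/2) w² + f w³`: a point of a curve
of the form `sepCurve` in terms of `w = 1/τ`. -/
def curvePoint (w e f : ℂ) : ℂ × ℂ :=
  (w * (I / 2 + e * w), w ^ 2 * ((1 - I) / 2 + f * w))

theorem sepCurve_eq_curvePoint (a₂ : ℂ) (ξ η : ℂ → ℂ) {τ : ℂ} (hτ : τ ≠ 0) :
    sepCurve a₂ ξ η τ
      = curvePoint τ⁻¹ (a₂ + ξ τ) (((-2 * I - 2) * a₂ + 1 / 2) + η τ) := by
  ext <;> simp only [sepCurve, curvePoint] <;> field_simp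

/-- The coefficient of the component expanding like `τ³` of a displacement `u` of a curve point at
time `t`. -/
def modeA (t : ℂ) (u : ℂ × ℂ) : ℂ := (t * u.2 + (2 + 2 * I) * u.1) / 5

/-- The coefficient of the component behaving like `τ⁻²` of a displacement `u` of a curve point at
time `t`. -/
def modeB (t : ℂ) (u : ℂ × ℂ) : ℂ := ((3 - 2 * I) * u.1 - t * u.2) / 5

/-- The size of a displacement `u` at time `t`, measured in the coordinates `modeA`, `modeB`. -/
def modeSize (t : ℂ) (u : ℂ × ℂ) : ℝ := ‖modeA t u‖ + ‖modeB t u‖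

theorem fst_eq_modes (t : ℂ) (u : ℂ × ℂ) : u.1 = modeA t u + modeB t u := by
  simp only [modeA, modeB]; ring

theorem mul_snd_eq_modes (t : ℂ) (u : ℂ × ℂ) :
    t * u.2 = (3 - 2 * I) * modeA t u + (-2 - 2 * I) * modeB t u := by
  simp only [modeA, modeB]; ring

theorem modeSize_nonneg (t : ℂ) (u : ℂ × ℂ) : 0 ≤ modeSize t u := by
  unfold modeSize; positivity

theorem norm_fst_le_modeSize (t : ℂ) (u : ℂ × ℂ) : ‖u.1‖ ≤ modeSize t u := by
  rw [fst_eq_modes t u]; exact norm_add_le _ _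

theorem norm_three_sub_two_I_le : ‖(3 - 2 * I : ℂ)‖ ≤ 5 := by
  refine (norm_sub_le _ _).trans ?_
  simp; norm_num

theorem norm_two_add_two_I_le : ‖(2 + 2 * I : ℂ)‖ ≤ 5 := by
  refine (norm_add_le _ _).trans ?_
  simp; norm_num

theorem norm_mul_snd_le_modeSize (t : ℂ) (u : ℂ × ℂ) : ‖t * u.2‖ ≤ 5 * modeSize t u := by
  rw [mul_snd_eq_modes t u, modeSize, mul_add]
  refine (norm_add_le _ _).trans ?_
  rw [norm_mul, norm_mul]
  have h : ‖(-2 - 2 * I : ℂ)‖ ≤ 5 := by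
    rw [show (-2 - 2 * I : ℂ) = -(2 + 2 * I) by ring, norm_neg]; exact norm_two_add_two_I_le
  gcongr
  exact norm_three_sub_two_I_le

theorem norm_modeA_le (t : ℂ) (u : ℂ × ℂ) : ‖modeA t u‖ ≤ ‖u.1‖ + ‖t * u.2‖ := by
  have h := norm_add_le (t * u.2) ((2 + 2 * I) * u.1)
  rw [norm_mul (2 + 2 * I)] at h
  have h2 := mul_le_mul_of_nonneg_right norm_two_add_two_I_le (norm_nonneg u.1)
  have h5 : ‖(5 : ℂ)‖ = 5 := by simp
  rw [modeA, norm_div, h5, div_le_iff₀ (by norm_num)]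
  nlinarith [norm_nonneg (t * u.2)]

theorem norm_modeB_le (t : ℂ) (u : ℂ × ℂ) : ‖modeB t u‖ ≤ ‖u.1‖ + ‖t * u.2‖ := by
  have h := norm_sub_le ((3 - 2 * I) * u.1) (t * u.2)
  rw [norm_mul (3 - 2 * I)] at h
  have h2 := mul_le_mul_of_nonneg_right norm_three_sub_two_I_le (norm_nonneg u.1)
  have h5 : ‖(5 : ℂ)‖ = 5 := by simp
  rw [modeB, norm_div, h5, div_le_iff₀ (by norm_num)]
  nlinarith [norm_nonneg (t * u.2)]

theorem modeSize_le (t : ℂ) (u : ℂ × ℂ) : modeSize t u ≤ 2 * (‖u.1‖ + ‖t * u.2‖) := by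
  have := norm_modeA_le t u
  have := norm_modeB_le t u
  unfold modeSize; linarith

/-- For `1 ≤ ‖t‖` the size in mode coordinates dominates the maximum norm. -/
theorem norm_le_modeSize {t : ℂ} (ht : 1 ≤ ‖t‖) (u : ℂ × ℂ) : ‖u‖ ≤ 5 * modeSize t u := by
  have h0 := modeSize_nonneg t u
  refine max_le ?_ ?_
  · linarith [norm_fst_le_modeSize t u]
  · have h := norm_mul_snd_le_modeSize t u
    rw [norm_mul] at h
    nlinarith [norm_nonneg u.2]

theorem eq_zero_of_modeSize_eq_zero {t : ℂ} (ht : t ≠ 0) {u : ℂ × ℂ} (h : modeSize t u = 0) :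
    u = 0 := by
  have h1 := norm_fst_le_modeSize t u
  have h2 := norm_mul_snd_le_modeSize t u
  rw [h] at h1 h2
  have h3 : u.1 = 0 := norm_le_zero_iff.1 h1
  have h4 : t * u.2 = 0 := norm_le_zero_iff.1 (by simpa using h2)
  exact Prod.ext h3 ((mul_eq_zero.1 h4).resolve_left ht)

/-- The terms of relative order `w²` of the first component of the difference map. -/
def remFst (w e f e' f' u r : ℂ) : ℂ :=
  let X := I / 2 + e * w
  let X' := I / 2 + e' * w
  let Y := (1 - I) / 2 + f * w
  let Y' := (1 - I) / 2 + f' * w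
  (2 * (e + e') - 2 * Y - 8 * (X ^ 2 + X * X' + X' ^ 2) - 4 * w * Y * (X + X')
      - 8 * w * (X + X') * (X ^ 2 + X' ^ 2)) * u
    + (-2 * X' - 1 / 2 * (Y + Y') * w - 4 * X' ^ 2 * w) * r

/-- The terms of relative order `w²` of the (rescaled) second component of the difference map. -/
def remSnd (w e f e' f' u r : ℂ) : ℂ :=
  let X := I / 2 + e * w
  let X' := I / 2 + e' * w
  let Y := (1 - I) / 2 + f * w
  let Y' := (1 - I) / 2 + f' * w
  (-4 * Y - 16 * (X ^ 2 + X * X' + X' ^ 2) - 8 * w * Y * (X + X')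
      - 16 * w * (X + X') * (X ^ 2 + X' ^ 2)
      - 4 * f - 16 * (I * e + e ^ 2 * w + I / 2 * (e + e') + e * e' * w + I * e' + e' ^ 2 * w)
      - 8 * Y * (X + X') - 16 * (X + X') * (X ^ 2 + X' ^ 2)) * u
    + (-4 * e' - 4 * X' - (Y + Y') - 8 * X' ^ 2 - w * (Y + Y') - 8 * w * X' ^ 2) * r

theorem F0_sub_fst (w e f e' f' : ℂ) :
    (F0 (curvePoint w e' f')).1 - (F0 (curvePoint w e f)).1
      = (w * (e' - e) * w)
        + w * (2 * I * (w * (e' - e) * w) + w * (f' - f) * w)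
        + w ^ 2 * remFst w e f e' f' (w * (e' - e) * w) (w * (f' - f) * w) := by
  simp only [F0, curvePoint, remFst]
  ring

theorem F0_sub_snd (w e f e' f' : ℂ) :
    (1 + w) * ((F0 (curvePoint w e' f')).2 - (F0 (curvePoint w e f)).2)
      = w * (w * (f' - f) * w
        + w * ((10 + 2 * I) * (w * (e' - e) * w) + (1 - 2 * I) * (w * (f' - f) * w))
        + w ^ 2 * remSnd w e f e' f' (w * (e' - e) * w) (w * (f' - f) * w)) := by
  simp only [F0, curvePoint, remSnd]
  ring_nf
  simp only [I_sq]
  ring_nf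

theorem exists_bound_on_closedBall {F : ℂ × ℂ × ℂ × ℂ × ℂ → ℂ} (hF : Continuous F) (K : ℝ) :
    ∃ C : ℝ, 0 ≤ C ∧ ∀ a b c d e : ℂ, ‖a‖ ≤ K → ‖b‖ ≤ K → ‖c‖ ≤ K → ‖d‖ ≤ K → ‖e‖ ≤ K →
      ‖F (a, b, c, d, e)‖ ≤ C := by
  obtain ⟨C, hC⟩ := (isCompact_closedBall (0 : ℂ × ℂ × ℂ × ℂ × ℂ) K).exists_bound_of_continuousOn
    hF.continuousOn
  refine ⟨max C 0, le_max_right _ _, fun a b c d e ha hb hc hd he => ?_⟩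
  refine (hC _ ?_).trans (le_max_left _ _)
  simp only [Metric.mem_closedBall, dist_zero_right, Prod.norm_def]
  simp [ha, hb, hc, hd, he]

/-- `remFst` and `remSnd` are linear in `(u, r)` with locally bounded coefficients. -/
theorem exists_rem_bound (K : ℝ) : ∃ C : ℝ, 0 ≤ C ∧ ∀ w e f e' f' : ℂ, ‖w‖ ≤ 1 → ‖e‖ ≤ K →
    ‖f‖ ≤ K → ‖e'‖ ≤ K → ‖f'‖ ≤ K → ∀ u r : ℂ,
      ‖remFst w e f e' f' u r‖ ≤ C * (‖u‖ + ‖r‖) ∧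
      ‖remSnd w e f e' f' u r‖ ≤ C * (‖u‖ + ‖r‖) := by
  have key : ∀ G : ℂ → ℂ → ℂ → ℂ → ℂ → ℂ → ℂ → ℂ,
      (∀ w e f e' f' u r, G w e f e' f' u r = G w e f e' f' 1 0 * u + G w e f e' f' 0 1 * r) →
      (∀ u r, Continuous fun p : ℂ × ℂ × ℂ × ℂ × ℂ =>
        G p.1 p.2.1 p.2.2.1 p.2.2.2.1 p.2.2.2.2 u r) →
      ∃ C : ℝ, 0 ≤ C ∧ ∀ w e f e' f' : ℂ, ‖w‖ ≤ 1 → ‖e‖ ≤ K →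
        ‖f‖ ≤ K → ‖e'‖ ≤ K → ‖f'‖ ≤ K → ∀ u r : ℂ,
        ‖G w e f e' f' u r‖ ≤ C * (‖u‖ + ‖r‖) := by
    intro G hG hc
    obtain ⟨C₁, h₁, H₁⟩ := exists_bound_on_closedBall (hc 1 0) (max 1 K)
    obtain ⟨C₂, h₂, H₂⟩ := exists_bound_on_closedBall (hc 0 1) (max 1 K)
    refine ⟨C₁ + C₂, by positivity, fun w e f e' f' hw he hf he' hf' u r => ?_⟩
    have hK : K ≤ max 1 K := le_max_right _ _
    have h1 := H₁ w e f e' f' (hw.trans (le_max_left _ _)) (he.trans hK) (hf.trans hK)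
      (he'.trans hK) (hf'.trans hK)
    have h2 := H₂ w e f e' f' (hw.trans (le_max_left _ _)) (he.trans hK) (hf.trans hK)
      (he'.trans hK) (hf'.trans hK)
    rw [hG]
    refine (norm_add_le _ _).trans ?_
    rw [norm_mul, norm_mul]
    nlinarith [mul_le_mul_of_nonneg_right h1 (norm_nonneg u),
      mul_le_mul_of_nonneg_right h2 (norm_nonneg r), mul_nonneg h₁ (norm_nonneg r),
      mul_nonneg h₂ (norm_nonneg u)]
  obtain ⟨C₁, h₁, H₁⟩ := key remFst (fun w e f e' f' u r => by simp only [remFst]; ring)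
    (fun u r => by unfold remFst; fun_prop)
  obtain ⟨C₂, h₂, H₂⟩ := key remSnd (fun w e f e' f' u r => by simp only [remSnd]; ring)
    (fun u r => by unfold remSnd; fun_prop)
  refine ⟨C₁ + C₂, by positivity, fun w e f e' f' hw he hf he' hf' u r => ⟨?_, ?_⟩⟩
  · refine (H₁ w e f e' f' hw he hf he' hf' u r).trans ?_
    gcongr; linarith
  · refine (H₂ w e f e' f' hw he hf he' hf' u r).trans ?_
    gcongr; linarith

/-- The difference of two orbits of `F₀` near the separatrices, in mode coordinates: up to a
relative error `O(τ⁻²)`, one step multiplies the modes by `1 + 3/τ` and `1 - 2/τ`. -/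
theorem exists_mode_step (K : ℝ) : ∃ C : ℝ, 0 ≤ C ∧ ∀ t e f e' f' : ℂ, 1 ≤ ‖t‖ → ‖e‖ ≤ K →
    ‖f‖ ≤ K → ‖e'‖ ≤ K → ‖f'‖ ≤ K →
      ‖modeA (t + 1) (F0 (curvePoint t⁻¹ e' f') - F0 (curvePoint t⁻¹ e f))
        - (1 + 3 * t⁻¹) * modeA t (curvePoint t⁻¹ e' f' - curvePoint t⁻¹ e f)‖
          ≤ C / ‖t‖ ^ 2 * modeSize t (curvePoint t⁻¹ e' f' - curvePoint t⁻¹ e f) ∧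
      ‖modeB (t + 1) (F0 (curvePoint t⁻¹ e' f') - F0 (curvePoint t⁻¹ e f))
        - (1 - 2 * t⁻¹) * modeB t (curvePoint t⁻¹ e' f' - curvePoint t⁻¹ e f)‖
          ≤ C / ‖t‖ ^ 2 * modeSize t (curvePoint t⁻¹ e' f' - curvePoint t⁻¹ e f) := by
  obtain ⟨C, hC0, hC⟩ := exists_rem_bound K
  refine ⟨12 * C, by positivity, fun t e f e' f' ht he hf he' hf' => ?_⟩
  have ht0 : t ≠ 0 := norm_pos_iff.1 (by linarith)
  set w := t⁻¹ with hw
  have hw0 : w ≠ 0 := inv_ne_zero ht0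
  have htw : t = w⁻¹ := by rw [hw, inv_inv]
  have hw1 : ‖w‖ ≤ 1 := by rw [hw, norm_inv]; exact inv_le_one_of_one_le₀ ht
  set u := w * (e' - e) * w with hu
  set r := w * (f' - f) * w with hr
  set Δ := curvePoint w e' f' - curvePoint w e f with hΔ
  have hΔ1 : Δ.1 = u := by simp only [hΔ, Prod.fst_sub, curvePoint, hu]; ring
  have hΔ2 : t * Δ.2 = r := by
    simp only [hΔ, Prod.snd_sub, curvePoint, hr, htw]; field_simp; ring
  obtain ⟨hb1, hb2⟩ := hC w e f e' f' hw1 he hf he' hf' u r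
  set R₁ := remFst w e f e' f' u r with hR₁
  set R₂ := remSnd w e f e' f' u r with hR₂
  have h1 : (F0 (curvePoint w e' f') - F0 (curvePoint w e f)).1
      = u + w * (2 * I * u + r) + w ^ 2 * R₁ := F0_sub_fst w e f e' f'
  have h2 : (t + 1) * (F0 (curvePoint w e' f') - F0 (curvePoint w e f)).2
      = r + w * ((10 + 2 * I) * u + (1 - 2 * I) * r) + w ^ 2 * R₂ := by
    have := F0_sub_snd w e f e' f'
    rw [Prod.snd_sub]
    have h3 : t + 1 = (1 + w) / w := by rw [htw]; field_simp
    rw [h3, div_mul_eq_mul_div, this, mul_div_cancel_left₀ _ hw0]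
  have hs : ‖u‖ + ‖r‖ ≤ 6 * modeSize t Δ := by
    have h3 := norm_fst_le_modeSize t Δ
    have h4 := norm_mul_snd_le_modeSize t Δ
    rw [hΔ1] at h3; rw [hΔ2] at h4; linarith
  have hCs := mul_le_mul_of_nonneg_left hs hC0
  have hCs0 := mul_nonneg hC0 (modeSize_nonneg t Δ)
  have hwt : ‖w‖ ^ 2 = 1 / ‖t‖ ^ 2 := by rw [hw, norm_inv]; simp
  have h5 : ‖(5 : ℂ)‖ = 5 := by simp
  have ht2 : 0 < ‖t‖ ^ 2 := by positivity
  constructor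
  · have : modeA (t + 1) (F0 (curvePoint w e' f') - F0 (curvePoint w e f))
        - (1 + 3 * w) * modeA t Δ = w ^ 2 * ((R₂ + (2 + 2 * I) * R₁) / 5) := by
      simp only [modeA]
      rw [h1, h2, hΔ1, hΔ2]
      linear_combination (4 / 5 * w * u) * I_sq
    rw [this, norm_mul, norm_pow, hwt, norm_div, h5]
    have h6 := norm_add_le R₂ ((2 + 2 * I) * R₁)
    rw [norm_mul] at h6
    have h7 := mul_le_mul_of_nonneg_right norm_two_add_two_I_le (norm_nonneg R₁)
    rw [div_mul_eq_mul_div, div_mul_eq_mul_div, one_mul]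
    gcongr
    rw [div_le_iff₀ (by norm_num)]
    linarith
  · have : modeB (t + 1) (F0 (curvePoint w e' f') - F0 (curvePoint w e f))
        - (1 - 2 * w) * modeB t Δ = w ^ 2 * (((3 - 2 * I) * R₁ - R₂) / 5) := by
      simp only [modeB]
      rw [h1, h2, hΔ1, hΔ2]
      linear_combination (-4 / 5 * w * u) * I_sq
    rw [this, norm_mul, norm_pow, hwt, norm_div, h5]
    have h6 := norm_sub_le ((3 - 2 * I) * R₁) R₂
    rw [norm_mul] at h6
    have h7 := mul_le_mul_of_nonneg_right norm_three_sub_two_I_le (norm_nonneg R₁)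
    rw [div_mul_eq_mul_div, div_mul_eq_mul_div, one_mul]
    gcongr
    rw [div_le_iff₀ (by norm_num)]
    linarith

/-! ### Area preservation -/

/-- The derivative of `F0` at `p` applied to the vector `v`. -/
def F0deriv (p v : ℂ × ℂ) : ℂ × ℂ :=
  ((1 + 4 * p.1 - 2 * p.2 - 24 * p.1 ^ 2 - 8 * p.1 * p.2 - 32 * p.1 ^ 3) * v.1
      + (1 - 2 * p.1 - p.2 - 4 * p.1 ^ 2) * v.2,
    (-4 * p.2 - 48 * p.1 ^ 2 - 16 * p.1 * p.2 - 64 * p.1 ^ 3) * v.1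
      + (1 - 4 * p.1 - 2 * p.2 - 8 * p.1 ^ 2) * v.2)

/-- The area form of `ℂ²`. -/
def area (v w : ℂ × ℂ) : ℂ := v.1 * w.2 - w.1 * v.2

theorem area_F0deriv (p v w : ℂ × ℂ) : area (F0deriv p v) (F0deriv p w) = area v w := by
  simp only [area, F0deriv]; ring

theorem area_sub_right (v w₁ w₂ : ℂ × ℂ) : area v (w₁ - w₂) = area v w₁ - area v w₂ := by
  simp only [area, Prod.fst_sub, Prod.snd_sub]; ring

theorem norm_area_le (v w : ℂ × ℂ) : ‖area v w‖ ≤ 2 * ‖v‖ * ‖w‖ := by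
  refine (norm_sub_le _ _).trans ?_
  rw [norm_mul, norm_mul]
  have h1 := mul_le_mul (norm_fst_le v) (norm_snd_le w) (norm_nonneg _) (norm_nonneg _)
  have h2 := mul_le_mul (norm_fst_le w) (norm_snd_le v) (norm_nonneg _) (norm_nonneg _)
  linarith

/-- The remainder of the first order Taylor expansion of `F0` is quadratic, locally uniformly. -/
theorem exists_F0_taylor_bound (K : ℝ) : ∃ C : ℝ, 0 ≤ C ∧ ∀ p q : ℂ × ℂ, ‖p‖ ≤ K → ‖q‖ ≤ K →
    ‖F0 q - F0 p - F0deriv p (q - p)‖ ≤ C * ‖q - p‖ ^ 2 := by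
  -- The two components are quadratic forms in `q - p` whose coefficients are polynomials.
  let k₁ : ℂ × ℂ × ℂ × ℂ × ℂ → ℂ := fun z =>
    2 - 24 * z.1 - 4 * z.2.1 - 48 * z.1 ^ 2 - 8 * (z.2.2.1 - z.1)
      - 32 * z.1 * (z.2.2.1 - z.1) - 8 * (z.2.2.1 - z.1) ^ 2
  let k₂ : ℂ × ℂ × ℂ × ℂ × ℂ → ℂ := fun z => -2 - 8 * z.1 - 4 * (z.2.2.1 - z.1)
  let k₃ : ℂ × ℂ × ℂ × ℂ × ℂ → ℂ := fun z =>
    -48 * z.1 - 8 * z.2.1 - 96 * z.1 ^ 2 - 16 * (z.2.2.1 - z.1)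
      - 64 * z.1 * (z.2.2.1 - z.1) - 16 * (z.2.2.1 - z.1) ^ 2
  let k₄ : ℂ × ℂ × ℂ × ℂ × ℂ → ℂ := fun z => -4 - 16 * z.1 - 8 * (z.2.2.1 - z.1)
  obtain ⟨C₁, h₁, H₁⟩ := exists_bound_on_closedBall (F := k₁) (by fun_prop) (max K 0)
  obtain ⟨C₂, h₂, H₂⟩ := exists_bound_on_closedBall (F := k₂) (by fun_prop) (max K 0)
  obtain ⟨C₃, h₃, H₃⟩ := exists_bound_on_closedBall (F := k₃) (by fun_prop) (max K 0)
  obtain ⟨C₄, h₄, H₄⟩ := exists_bound_on_closedBall (F := k₄) (by fun_prop) (max K 0)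
  have key : ∀ (a b c u v : ℂ) (A B C N : ℝ), ‖a‖ ≤ A → ‖b‖ ≤ B → ‖c‖ ≤ C → ‖u‖ ≤ N →
      ‖v‖ ≤ N → ‖a * u ^ 2 + b * (u * v) + c * v ^ 2‖ ≤ (A + B + C) * N ^ 2 := by
    intro a b c u v A B C N ha hb hc hu hv
    have hN : 0 ≤ N := (norm_nonneg u).trans hu
    have hA := (norm_nonneg a).trans ha
    have hB := (norm_nonneg b).trans hb
    have hC := (norm_nonneg c).trans hc
    calc ‖a * u ^ 2 + b * (u * v) + c * v ^ 2‖
        ≤ ‖a‖ * ‖u‖ ^ 2 + ‖b‖ * (‖u‖ * ‖v‖) + ‖c‖ * ‖v‖ ^ 2 := by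
          refine (norm_add₃_le).trans ?_
          simp only [norm_mul, norm_pow, le_refl]
      _ ≤ A * N ^ 2 + B * (N * N) + C * N ^ 2 := by gcongr
      _ = (A + B + C) * N ^ 2 := by ring
  refine ⟨(C₁ + C₂ + 1 / 2) + (C₃ + C₄ + 1), by positivity, fun p q hp hq => ?_⟩
  have hb : ∀ z : ℂ, ‖z‖ ≤ K → ‖z‖ ≤ max K 0 := fun z hz => hz.trans (le_max_left _ _)
  have hp1 := hb _ ((norm_fst_le p).trans hp)
  have hp2 := hb _ ((norm_snd_le p).trans hp)
  have hq1 := hb _ ((norm_fst_le q).trans hq)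
  have h0 : ‖(0 : ℂ)‖ ≤ max K 0 := by simp
  have hu := norm_fst_le (q - p)
  have hv := norm_snd_le (q - p)
  have e1 : (F0 q - F0 p - F0deriv p (q - p)).1
      = k₁ (p.1, p.2, q.1, 0, 0) * (q - p).1 ^ 2
        + k₂ (p.1, p.2, q.1, 0, 0) * ((q - p).1 * (q - p).2)
        + (-1 / 2) * (q - p).2 ^ 2 := by
    simp only [F0, F0deriv, Prod.fst_sub, Prod.snd_sub, k₁, k₂]; ring
  have e2 : (F0 q - F0 p - F0deriv p (q - p)).2
      = k₃ (p.1, p.2, q.1, 0, 0) * (q - p).1 ^ 2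
        + k₄ (p.1, p.2, q.1, 0, 0) * ((q - p).1 * (q - p).2)
        + (-1) * (q - p).2 ^ 2 := by
    simp only [F0, F0deriv, Prod.fst_sub, Prod.snd_sub, k₃, k₄]; ring
  have hsq : 0 ≤ ‖q - p‖ ^ 2 := by positivity
  refine max_le ?_ ?_
  · rw [e1]
    refine (key _ _ _ _ _ C₁ C₂ (1 / 2) _ (H₁ _ _ _ _ _ hp1 hp2 hq1 h0 h0)
      (H₂ _ _ _ _ _ hp1 hp2 hq1 h0 h0) (by norm_num) hu hv).trans ?_
    exact mul_le_mul_of_nonneg_right (by linarith) hsq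
  · rw [e2]
    refine (key _ _ _ _ _ C₃ C₄ 1 _ (H₃ _ _ _ _ _ hp1 hp2 hq1 h0 h0)
      (H₄ _ _ _ _ _ hp1 hp2 hq1 h0 h0) (by norm_num) hu hv).trans ?_
    exact mul_le_mul_of_nonneg_right (by linarith) hsq

theorem F0_injective : Function.Injective F0 := by
  have hT : Function.Injective coordT :=
    Function.LeftInverse.injective (g := coordTInv) coordTInv_coordT
  have hTi : Function.Injective coordTInv :=
    Function.LeftInverse.injective (g := coordT) coordT_coordTInv
  have hH : Function.Injective (henon 0) := by
    intro p q h
    simp only [henon, Prod.mk.injEq] at h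
    obtain ⟨h1, h2⟩ := h
    rw [h1] at h2
    exact Prod.ext (by linear_combination -h2) h1
  intro p q h
  rw [F0_eq, F0_eq] at h
  exact hTi (hH (hH (hT h)))

/-! ### A Cauchy formula with a periodic kernel -/

/-- The function `s ↦ e^{2πi(s-τ)}`. -/
def expKernel (τ s : ℂ) : ℂ := exp (2 * Real.pi * I * (s - τ))

/-- The function `(f(s) - f(τ)) e^{2πi(s-τ)} / (e^{2πi(s-τ)} - 1)` with its singularity at `s = τ`
removed. -/
def kernelQuot (f : ℂ → ℂ) (τ s : ℂ) : ℂ :=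
  dslope f τ s * expKernel τ s / dslope (expKernel τ) τ s

theorem expKernel_self (τ : ℂ) : expKernel τ τ = 1 := by simp [expKernel]

theorem expKernel_add_one (τ s : ℂ) : expKernel τ (s + 1) = expKernel τ s := by
  rw [expKernel, expKernel, show 2 * (Real.pi : ℂ) * I * (s + 1 - τ)
    = 2 * Real.pi * I * (s - τ) + 2 * Real.pi * I by ring, exp_periodic]

theorem differentiable_expKernel (τ : ℂ) : Differentiable ℂ (expKernel τ) := by
  unfold expKernel; fun_prop

theorem norm_expKernel (τ s : ℂ) :
    ‖expKernel τ s‖ = Real.exp (2 * Real.pi * (τ.im - s.im)) := by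
  rw [expKernel, norm_exp]
  congr 1
  simp [mul_re, mul_im]
  ring

theorem kernelQuot_of_ne (f : ℂ → ℂ) {τ s : ℂ} (h : s ≠ τ) :
    kernelQuot f τ s = (f s - f τ) * expKernel τ s / (expKernel τ s - 1) := by
  have h0 : s - τ ≠ 0 := sub_ne_zero.2 h
  rw [kernelQuot, dslope_of_ne _ h, dslope_of_ne _ h, slope_def_field, slope_def_field,
    expKernel_self]
  by_cases h1 : expKernel τ s - 1 = 0
  · simp [h1]
  · field_simp

theorem dslope_expKernel_ne_zero {τ s : ℂ} (h : |s.re - τ.re| < 1) :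
    dslope (expKernel τ) τ s ≠ 0 := by
  have hpi : (2 * Real.pi * I : ℂ) ≠ 0 := two_pi_I_ne_zero
  by_cases hs : s = τ
  · rw [hs, dslope_same]
    have : HasDerivAt (expKernel τ)
        (exp (2 * Real.pi * I * (τ - τ)) * (2 * Real.pi * I * 1)) τ := by
      unfold expKernel
      exact (((hasDerivAt_id τ).sub_const τ).const_mul _).cexp
    rw [this.deriv]
    simp
  · rw [dslope_of_ne _ hs, slope_def_field, expKernel_self]
    refine div_ne_zero (fun h0 => hs ?_) (sub_ne_zero.2 hs)
    obtain ⟨n, hn⟩ := exp_eq_one_iff.1 (sub_eq_zero.1 h0)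
    have h1 : s - τ = n := by
      apply mul_left_cancel₀ hpi
      rw [hn]; ring
    have h2 : s.re - τ.re = n := by
      have := congrArg re h1
      simpa using this
    rw [h2] at h
    have h3 : |n| < 1 := by exact_mod_cast h
    rw [Int.abs_lt_one_iff.1 h3] at h1
    exact sub_eq_zero.1 (by simpa using h1)

/-- The kernel `e^{2πi(s-τ)} / (e^{2πi(s-τ)} - 1)` on the vertical line half a period from
its pole. -/
theorem norm_expKernel_div_le {τ s : ℂ} (h : s.re = τ.re - 1 / 2) :
    ‖expKernel τ s / (expKernel τ s - 1)‖ ≤ min 1 (Real.exp (2 * Real.pi * (τ.im - s.im))) := by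
  -- On this line the exponential is real and negative.
  have h1 : expKernel τ s = -(Real.exp (2 * Real.pi * (τ.im - s.im)) : ℝ) := by
    have : 2 * (Real.pi : ℂ) * I * (s - τ)
        = ((2 * Real.pi * (τ.im - s.im) : ℝ) : ℂ) + -(Real.pi * I) := by
      apply Complex.ext
      · simp [mul_re, mul_im]; ring
      · simp [mul_re, mul_im, h]; ring
    rw [expKernel, this, exp_add, exp_neg, exp_pi_mul_I, ofReal_exp]
    norm_num
  set Q := Real.exp (2 * Real.pi * (τ.im - s.im)) with hQ
  have hQ0 : 0 < Q := Real.exp_pos _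
  have h2 : expKernel τ s / (expKernel τ s - 1) = ((Q / (Q + 1) : ℝ) : ℂ) := by
    rw [h1]; push_cast
    rw [show (-(Q : ℂ) - 1) = -(Q + 1) by ring, neg_div_neg_eq]
  rw [h2, norm_real, Real.norm_of_nonneg (by positivity), le_min_iff]
  constructor
  · rw [div_le_one (by positivity)]; linarith
  · rw [div_le_iff₀ (by positivity)]; nlinarith

/-- If `f` is analytic in a vertical strip of width one centred at `τ` and `f(s+1) - f(s)` is small
on its left side, then `f(τ)` is close to the mean of `f` over the lower end of the strip. The error
is `O(e^{-2πd})` with `d` the distance from `τ` to the upper or to the lower end. -/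
theorem norm_sub_mean_le {f : ℂ → ℂ} {U : Set ℂ} (hU : IsOpen U) (hf : DifferentiableOn ℂ f U)
    {τ : ℂ} {y₁ Y T G W : ℝ} (h1 : 0 < y₁) (hy : y₁ + 1 ≤ -τ.im) (hY : -τ.im + 1 ≤ Y)
    (hsub : ∀ s : ℂ, |s.re - τ.re| ≤ 1 / 2 → -Y ≤ s.im → s.im ≤ -y₁ → s ∈ U)
    (hT : ∀ s : ℂ, |s.re - τ.re| ≤ 1 / 2 → s.im = -y₁ → ‖f s‖ ≤ T)
    (hG : ∀ s : ℂ, |s.re - τ.re| ≤ 1 / 2 → s.im = -Y → ‖f s‖ ≤ G)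
    (hW : ∀ s : ℂ, s.re = τ.re - 1 / 2 → -Y ≤ s.im → s.im ≤ -y₁ →
      ‖f (s + 1) - f s‖ * min 1 (Real.exp (2 * Real.pi * (τ.im - s.im))) ≤ W / s.im ^ 2) :
    ‖f τ - ∫ x in (τ.re - 1 / 2)..(τ.re + 1 / 2), f (x + (-Y : ℝ) * I)‖
      ≤ 2 * (T + ‖f τ‖) * Real.exp (-(2 * Real.pi * (-τ.im - y₁)))
        + 2 * (G + ‖f τ‖) * Real.exp (-(2 * Real.pi * (Y + τ.im))) + W / y₁ := by
  set x₀ := τ.re - 1 / 2 with hx₀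
  set x₁ := τ.re + 1 / 2 with hx₁
  have hx01 : x₀ ≤ x₁ := by linarith
  have hτU : τ ∈ U := hsub τ (by simp) (by linarith) (by linarith)
  have hpi := Real.pi_gt_three
  set H := kernelQuot f τ with hH
  have hrect : ∀ s : ℂ, s.re ∈ Set.Icc x₀ x₁ → s.im ∈ Set.Icc (-Y) (-y₁) →
      |s.re - τ.re| ≤ 1 / 2 ∧ s ∈ U := by
    intro s hs hs'
    have : |s.re - τ.re| ≤ 1 / 2 := by rw [abs_le]; constructor <;> linarith [hs.1, hs.2]
    exact ⟨this, hsub s this hs'.1 hs'.2⟩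
  have hHd : ∀ s ∈ U, |s.re - τ.re| ≤ 1 / 2 → DifferentiableAt ℂ H s := by
    intro s hs hs'
    have d1 : DifferentiableAt ℂ (dslope f τ) s :=
      ((differentiableOn_dslope (hU.mem_nhds hτU)).2 hf).differentiableAt (hU.mem_nhds hs)
    have d2 : DifferentiableAt ℂ (dslope (expKernel τ) τ) s :=
      ((differentiableOn_dslope Filter.univ_mem).2
        (differentiable_expKernel τ).differentiableOn).differentiableAt Filter.univ_mem
    exact (d1.mul (differentiable_expKernel τ s)).div d2
      (dslope_expKernel_ne_zero (by linarith))
  -- Cauchy's theorem on the rectangle.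
  have hC := integral_boundary_rect_eq_zero_of_differentiableOn H ⟨x₀, -Y⟩ ⟨x₁, -y₁⟩ (by
    intro s hs
    rw [Set.uIcc_of_le hx01, Set.uIcc_of_le (by simp only; linarith)] at hs
    obtain ⟨hs1, hs2⟩ := mem_reProdIm.1 hs
    obtain ⟨h3, h4⟩ := hrect s hs1 hs2
    exact (hHd s h4 h3).differentiableWithinAt)
  simp only [smul_eq_mul] at hC
  have re_im : ∀ x y : ℝ, ((x : ℂ) + y * I).re = x ∧ ((x : ℂ) + y * I).im = y := by
    intro x y; simp
  -- Continuity of the integrands on the four sides.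
  have cH : ∀ x y : ℝ, x ∈ Set.Icc x₀ x₁ → y ∈ Set.Icc (-Y) (-y₁) →
      ContinuousAt H (x + y * I) ∧ ContinuousAt f (x + y * I) := by
    intro x y hx hy'
    obtain ⟨h3, h4⟩ := hrect (x + y * I) (by simpa using hx) (by simpa using hy')
    exact ⟨(hHd _ h4 h3).continuousAt, (hf.differentiableAt (hU.mem_nhds h4)).continuousAt⟩
  have cX : ∀ y : ℝ, y ∈ Set.Icc (-Y) (-y₁) →
      IntervalIntegrable (fun x : ℝ => H (x + y * I)) MeasureTheory.volume x₀ x₁ ∧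
      IntervalIntegrable (fun x : ℝ => f (x + y * I)) MeasureTheory.volume x₀ x₁ := by
    intro y hy'
    constructor
    all_goals
      refine ContinuousOn.intervalIntegrable fun x hx => ?_
      rw [Set.uIcc_of_le hx01] at hx
      refine ContinuousAt.continuousWithinAt ?_
    · exact ContinuousAt.comp (f := fun x : ℝ => (x : ℂ) + y * I) (cH x y hx hy').1 (by fun_prop)
    · exact ContinuousAt.comp (f := fun x : ℝ => (x : ℂ) + y * I) (cH x y hx hy').2 (by fun_prop)
  have hYy : -Y ≤ -y₁ := by linarith
  have cY : ∀ x : ℝ, x ∈ Set.Icc x₀ x₁ →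
      IntervalIntegrable (fun y : ℝ => H (x + y * I)) MeasureTheory.volume (-Y) (-y₁) := by
    intro x hx
    refine ContinuousOn.intervalIntegrable fun y hy' => ?_
    rw [Set.uIcc_of_le hYy] at hy'
    refine ContinuousAt.continuousWithinAt ?_
    exact ContinuousAt.comp (f := fun y : ℝ => (x : ℂ) + y * I) (cH x y hx hy').1 (by fun_prop)
  -- The lower side.
  have hbot : ‖(∫ x in x₀..x₁, H (x + (-Y : ℝ) * I))
      - ((∫ x in x₀..x₁, f (x + (-Y : ℝ) * I)) - f τ)‖
      ≤ 2 * (G + ‖f τ‖) * Real.exp (-(2 * Real.pi * (Y + τ.im))) := by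
    have e1 : (∫ x in x₀..x₁, f (x + (-Y : ℝ) * I)) - f τ
        = ∫ x in x₀..x₁, (f (x + (-Y : ℝ) * I) - f τ) := by
      rw [intervalIntegral.integral_sub (cX (-Y) ⟨le_rfl, hYy⟩).2 intervalIntegrable_const,
        intervalIntegral.integral_const, hx₀, hx₁]
      norm_num
    rw [e1, ← intervalIntegral.integral_sub (cX (-Y) ⟨le_rfl, hYy⟩).1
      ((cX (-Y) ⟨le_rfl, hYy⟩).2.sub intervalIntegrable_const)]
    refine (intervalIntegral.norm_integral_le_of_norm_le_const
      (C := 2 * (G + ‖f τ‖) * Real.exp (-(2 * Real.pi * (Y + τ.im)))) fun x hx => ?_).trans ?_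
    · rw [Set.uIoc_of_le hx01] at hx
      set s : ℂ := x + (-Y : ℝ) * I with hs
      obtain ⟨hre, him⟩ := re_im x (-Y)
      rw [← hs] at hre him
      obtain ⟨h3, h4⟩ := hrect s (by rw [hre]; exact ⟨hx.1.le, hx.2⟩)
        (by rw [him]; exact ⟨le_rfl, hYy⟩)
      have hsτ : s ≠ τ := fun h => by rw [h] at him; linarith
      have hE : ‖expKernel τ s‖ = Real.exp (2 * Real.pi * (Y + τ.im)) := by
        rw [norm_expKernel, him]; ring_nf
      set Q := Real.exp (2 * Real.pi * (Y + τ.im)) with hQ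
      have hQ2 : 2 ≤ Q := by
        have := Real.add_one_le_exp (2 * Real.pi * (Y + τ.im))
        nlinarith
      have hE1 : Q / 2 ≤ ‖expKernel τ s - 1‖ := by
        have := norm_sub_norm_le (expKernel τ s) 1
        rw [hE, norm_one] at this
        linarith
      have hE0 : expKernel τ s - 1 ≠ 0 := norm_pos_iff.1 (by linarith)
      have : H s - (f s - f τ) = (f s - f τ) / (expKernel τ s - 1) := by
        rw [hH, kernelQuot_of_ne f hsτ]; field_simp; ring
      rw [this, norm_div, div_le_iff₀ (by linarith)]
      have h5 : ‖f s - f τ‖ ≤ G + ‖f τ‖ := (norm_sub_le _ _).trans (by linarith [hG s h3 him])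
      rw [Real.exp_neg, ← hQ]
      calc ‖f s - f τ‖ ≤ 2 * (G + ‖f τ‖) * Q⁻¹ * (Q / 2) := by
            rw [show 2 * (G + ‖f τ‖) * Q⁻¹ * (Q / 2) = (G + ‖f τ‖) * (Q⁻¹ * Q) by ring,
              inv_mul_cancel₀ (by linarith), mul_one]
            exact h5
        _ ≤ _ := by
            refine mul_le_mul_of_nonneg_left hE1 ?_
            have := norm_nonneg (f s - f τ)
            have : 0 ≤ G + ‖f τ‖ := by linarith
            positivity
    · rw [hx₀, hx₁]
      refine le_of_eq ?_
      rw [show τ.re + 1 / 2 - (τ.re - 1 / 2) = 1 by ring]; simp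
  -- The upper side.
  have htop : ‖∫ x in x₀..x₁, H (x + (-y₁ : ℝ) * I)‖
      ≤ 2 * (T + ‖f τ‖) * Real.exp (-(2 * Real.pi * (-τ.im - y₁))) := by
    refine (intervalIntegral.norm_integral_le_of_norm_le_const
      (C := 2 * (T + ‖f τ‖) * Real.exp (-(2 * Real.pi * (-τ.im - y₁)))) fun x hx => ?_).trans ?_
    · rw [Set.uIoc_of_le hx01] at hx
      set s : ℂ := x + (-y₁ : ℝ) * I with hs
      obtain ⟨hre, him⟩ := re_im x (-y₁)
      rw [← hs] at hre him
      obtain ⟨h3, h4⟩ := hrect s (by rw [hre]; exact ⟨hx.1.le, hx.2⟩)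
        (by rw [him]; exact ⟨hYy, le_rfl⟩)
      have hsτ : s ≠ τ := fun h => by rw [h] at him; linarith
      have hE : ‖expKernel τ s‖ = Real.exp (-(2 * Real.pi * (-τ.im - y₁))) := by
        rw [norm_expKernel, him]; ring_nf
      set q := Real.exp (-(2 * Real.pi * (-τ.im - y₁))) with hq
      have hq0 : 0 < q := Real.exp_pos _
      have hq2 : q ≤ 1 / 2 := by
        rw [hq, Real.exp_neg, one_div]
        refine inv_anti₀ (by norm_num) ?_
        have := Real.add_one_le_exp (2 * Real.pi * (-τ.im - y₁))
        nlinarith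
      have hE1 : 1 / 2 ≤ ‖expKernel τ s - 1‖ := by
        have := norm_sub_norm_le 1 (expKernel τ s)
        rw [hE, norm_one, norm_sub_rev] at this
        linarith
      rw [hH, kernelQuot_of_ne f hsτ, norm_div, norm_mul, hE, div_le_iff₀ (by linarith)]
      have h5 : ‖f s - f τ‖ ≤ T + ‖f τ‖ := (norm_sub_le _ _).trans (by linarith [hT s h3 him])
      have h6 : 0 ≤ T + ‖f τ‖ := (norm_nonneg _).trans h5
      calc ‖f s - f τ‖ * q ≤ (T + ‖f τ‖) * q := by gcongr
        _ = 2 * (T + ‖f τ‖) * q * (1 / 2) := by ring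
        _ ≤ _ := by gcongr
    · rw [hx₀, hx₁]
      refine le_of_eq ?_
      rw [show τ.re + 1 / 2 - (τ.re - 1 / 2) = 1 by ring]; simp
  -- The vertical sides: by periodicity of the kernel only `f (s + 1) - f s` enters.
  have hver : ‖(∫ y in (-Y)..(-y₁), H (x₁ + y * I)) - ∫ y in (-Y)..(-y₁), H (x₀ + y * I)‖
      ≤ W / y₁ := by
    rw [← intervalIntegral.integral_sub (cY x₁ ⟨hx01, le_rfl⟩) (cY x₀ ⟨le_rfl, hx01⟩)]
    have hne : ∀ y ∈ Set.uIcc (-Y) (-y₁), y ≠ 0 := by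
      intro y hy'
      rw [Set.uIcc_of_le hYy] at hy'
      have := hy'.2
      exact ne_of_lt (by linarith)
    refine (intervalIntegral.norm_integral_le_of_norm_le (g := fun y => W * y ^ (-2 : ℤ)) hYy
      (Filter.Eventually.of_forall fun y hy' => ?_) ?_).trans ?_
    · set s : ℂ := x₀ + y * I with hs
      obtain ⟨hre, him⟩ := re_im x₀ y
      rw [← hs] at hre him
      have hs1 : (x₁ : ℂ) + y * I = s + 1 := by
        rw [hs, hx₀, hx₁]; push_cast; ring
      have hsτ : s ≠ τ := fun h => by rw [h] at hre; linarith
      have hsτ' : s + 1 ≠ τ := fun h => by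
        have := congrArg re h
        rw [add_re, hre, one_re] at this; linarith
      rw [hs1, hH, kernelQuot_of_ne f hsτ, kernelQuot_of_ne f hsτ', expKernel_add_one]
      have e2 : (f (s + 1) - f τ) * expKernel τ s / (expKernel τ s - 1)
          - (f s - f τ) * expKernel τ s / (expKernel τ s - 1)
          = (f (s + 1) - f s) * (expKernel τ s / (expKernel τ s - 1)) := by ring
      rw [e2, norm_mul]
      refine (mul_le_mul_of_nonneg_left (norm_expKernel_div_le hre) (norm_nonneg _)).trans ?_
      refine (hW s hre (by rw [him]; exact hy'.1.le) (by rw [him]; exact hy'.2)).trans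
        (le_of_eq ?_)
      rw [him, zpow_neg, div_eq_mul_inv]; norm_cast
    · refine ContinuousOn.intervalIntegrable fun y hy' => ?_
      exact (continuousAt_const.mul
        (continuousAt_zpow₀ _ _ (Or.inl (hne y hy')))).continuousWithinAt
    · rw [intervalIntegral.integral_const_mul, integral_zpow
        (Or.inr ⟨by norm_num, fun h => hne 0 h rfl⟩)]
      have hW0 : 0 ≤ W := by
        have h3 := hW ⟨x₀, -y₁⟩ rfl hYy le_rfl
        have h4 : 0 ≤ W / (-y₁) ^ 2 := le_trans (by positivity) h3
        by_contra h5
        exact absurd h4 (not_le.2 (div_neg_of_neg_of_pos (not_le.1 h5)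
          (by rw [neg_sq]; positivity)))
      have hYp : 0 < Y := by linarith
      have e3 : ((-y₁) ^ (-2 + 1 : ℤ) - (-Y) ^ (-2 + 1 : ℤ)) / ((-2 : ℤ) + 1 : ℝ)
          = 1 / y₁ - 1 / Y := by
        norm_num
        ring
      rw [e3, div_eq_mul_one_div W]
      have : 0 < 1 / Y := by positivity
      exact mul_le_mul_of_nonneg_left (by linarith) hW0
  have key : f τ - ∫ x in x₀..x₁, f (x + (-Y : ℝ) * I)
      = ((∫ x in x₀..x₁, H (x + (-Y : ℝ) * I))
        - ((∫ x in x₀..x₁, f (x + (-Y : ℝ) * I)) - f τ))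
        - (∫ x in x₀..x₁, H (x + (-y₁ : ℝ) * I))
        + I * ((∫ y in (-Y)..(-y₁), H (x₁ + y * I)) - ∫ y in (-Y)..(-y₁), H (x₀ + y * I)) := by
    linear_combination -hC
  rw [key]
  refine (norm_add_le _ _).trans ?_
  rw [norm_mul, norm_I, one_mul]
  have := norm_sub_le ((∫ x in x₀..x₁, H (x + (-Y : ℝ) * I))
        - ((∫ x in x₀..x₁, f (x + (-Y : ℝ) * I)) - f τ)) (∫ x in x₀..x₁, H (x + (-y₁ : ℝ) * I))
  linarith

/-- The limit of `norm_sub_mean_le` for a function that tends to zero at the lower end of an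
infinite strip. -/
theorem norm_le_of_tendsto_zero {f : ℂ → ℂ} {U : Set ℂ} (hU : IsOpen U)
    (hf : DifferentiableOn ℂ f U) {τ : ℂ} {y₁ T W : ℝ} (h1 : 0 < y₁) (hy : y₁ + 1 ≤ -τ.im)
    (hsub : ∀ s : ℂ, |s.re - τ.re| ≤ 1 / 2 → s.im ≤ -y₁ → s ∈ U)
    (hT : ∀ s : ℂ, |s.re - τ.re| ≤ 1 / 2 → s.im = -y₁ → ‖f s‖ ≤ T)
    (hG : ∀ ε : ℝ, 0 < ε → ∃ Y₀ : ℝ, ∀ s : ℂ, |s.re - τ.re| ≤ 1 / 2 → s.im ≤ -Y₀ → ‖f s‖ ≤ ε)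
    (hW : ∀ s : ℂ, s.re = τ.re - 1 / 2 → s.im ≤ -y₁ →
      ‖f (s + 1) - f s‖ * min 1 (Real.exp (2 * Real.pi * (τ.im - s.im))) ≤ W / s.im ^ 2) :
    ‖f τ‖ ≤ 4 * T * Real.exp (-(2 * Real.pi * (-τ.im - y₁))) + 2 * (W / y₁) := by
  have hpi := Real.pi_gt_three
  set q := Real.exp (-(2 * Real.pi * (-τ.im - y₁))) with hq
  have hq4 : q ≤ 1 / 4 := by
    rw [hq, Real.exp_neg, one_div]
    refine inv_anti₀ (by norm_num) ?_
    have := Real.add_one_le_exp (2 * Real.pi * (-τ.im - y₁))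
    nlinarith
  refine le_of_forall_pos_le_add fun ε hε => ?_
  set ε' := ε / (6 * (1 + ‖f τ‖) + 6) with hε'
  have hd : 0 < 6 * (1 + ‖f τ‖) + 6 := by positivity
  have hε'0 : 0 < ε' := by positivity
  obtain ⟨Y₀, hY₀⟩ := hG ε' hε'0
  set Y := max (max Y₀ (-τ.im + 1)) (-τ.im + 1 / ε') with hYdef
  have hY1 : Y₀ ≤ Y := (le_max_left _ _).trans (le_max_left _ _)
  have hY2 : -τ.im + 1 ≤ Y := (le_max_right _ _).trans (le_max_left _ _)
  have hY3 : -τ.im + 1 / ε' ≤ Y := le_max_right _ _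
  have hmain := norm_sub_mean_le (G := ε') hU hf h1 hy hY2 (fun s h2 _ h4 => hsub s h2 h4) hT
    (fun s h2 h3 => hY₀ s h2 (by rw [h3]; linarith)) (fun s h2 _ h4 => hW s h2 h4)
  have hm : ‖∫ x in (τ.re - 1 / 2)..(τ.re + 1 / 2), f (x + (-Y : ℝ) * I)‖ ≤ ε' := by
    refine (intervalIntegral.norm_integral_le_of_norm_le_const (C := ε') fun x hx => ?_).trans ?_
    · rw [Set.uIoc_of_le (by linarith)] at hx
      refine hY₀ _ ?_ ?_
      · rw [abs_le]
        have : ((x : ℂ) + (-Y : ℝ) * I).re = x := by simp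
        rw [this]; constructor <;> linarith [hx.1, hx.2]
      · have : ((x : ℂ) + (-Y : ℝ) * I).im = -Y := by simp
        rw [this]; linarith
    · rw [show τ.re + 1 / 2 - (τ.re - 1 / 2) = 1 by ring]; simp
  have he : Real.exp (-(2 * Real.pi * (Y + τ.im))) ≤ ε' := by
    rw [Real.exp_neg]
    have h3 : 1 / ε' ≤ Y + τ.im := by linarith
    have h4 : 0 < 1 / ε' := by positivity
    have h5 := Real.add_one_le_exp (2 * Real.pi * (Y + τ.im))
    have h6 : 1 / ε' ≤ Real.exp (2 * Real.pi * (Y + τ.im)) := by nlinarith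
    calc (Real.exp (2 * Real.pi * (Y + τ.im)))⁻¹ ≤ (1 / ε')⁻¹ := inv_anti₀ h4 h6
      _ = ε' := by simp
  have he1 : Real.exp (-(2 * Real.pi * (Y + τ.im))) ≤ 1 := by
    rw [Real.exp_le_one_iff]
    have : 0 ≤ 2 * Real.pi * (Y + τ.im) := by
      have : 0 ≤ Y + τ.im := by linarith
      positivity
    linarith
  have h7 : ‖f τ‖ ≤ ε' + ‖f τ - ∫ x in (τ.re - 1 / 2)..(τ.re + 1 / 2), f (x + (-Y : ℝ) * I)‖ := by
    have := norm_add_le (∫ x in (τ.re - 1 / 2)..(τ.re + 1 / 2), f (x + (-Y : ℝ) * I))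
      (f τ - ∫ x in (τ.re - 1 / 2)..(τ.re + 1 / 2), f (x + (-Y : ℝ) * I))
    rw [add_sub_cancel] at this
    linarith
  have h8 : 2 * (ε' + ‖f τ‖) * Real.exp (-(2 * Real.pi * (Y + τ.im)))
      ≤ 2 * ε' + 2 * ‖f τ‖ * ε' := by
    have := mul_le_mul_of_nonneg_left he1 hε'0.le
    have := mul_le_mul_of_nonneg_left he (norm_nonneg (f τ))
    nlinarith
  have h9 : ε' * (6 * (1 + ‖f τ‖) + 6) = ε := by
    rw [hε']; field_simp
  have h10 := mul_le_mul_of_nonneg_left hq4 (norm_nonneg (f τ))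
  have h11 := mul_nonneg hε'0.le (norm_nonneg (f τ))
  nlinarith

/-! ### Exponential decay of the modes in a central strip -/

/-- For depths beyond `y₁` the gap between the rates `2π` and `μ` absorbs the powers of the
depth. -/
theorem pow_mul_damping_le {μ y₁ y σ : ℝ} {k : ℕ} (hk : k ≤ 5) (hμ : 0 ≤ μ) (h1 : 0 < y₁)
    (hy₁ : 5 / y₁ ≤ 2 * Real.pi - μ) (hy : y₁ ≤ y) (hσ : y₁ ≤ σ) :
    (y / σ) ^ k * min 1 (Real.exp (-(2 * Real.pi * (y - σ)))) ≤
      min 1 (Real.exp (-(μ * (y - σ)))) := by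
  have hσ0 : 0 < σ := by linarith
  have hy0 : 0 < y := by linarith
  rcases le_total y σ with h | h
  · have h2 : (y / σ) ^ k ≤ 1 := pow_le_one₀ (by positivity) ((div_le_one hσ0).2 h)
    have h3 : min 1 (Real.exp (-(μ * (y - σ)))) = 1 :=
      min_eq_left (Real.one_le_exp (by nlinarith))
    rw [h3]
    exact mul_le_one₀ h2 (by positivity) (min_le_left _ _)
  · have h2 : y / σ ≤ Real.exp ((y - σ) / σ) := by
      have := Real.add_one_le_exp ((y - σ) / σ)
      have h3 : (y - σ) / σ + 1 = y / σ := by field_simp; ring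
      rwa [h3] at this
    have hk' : (k : ℝ) ≤ 5 := by exact_mod_cast hk
    have h3 : (y / σ) ^ k ≤ Real.exp ((2 * Real.pi - μ) * (y - σ)) := by
      refine (pow_le_pow_left₀ (by positivity) h2 k).trans ?_
      rw [← Real.exp_nat_mul, Real.exp_le_exp]
      have h4 : (y - σ) / σ ≤ (y - σ) / y₁ := by gcongr
      have h5 : 0 ≤ (y - σ) / y₁ := div_nonneg (by linarith) h1.le
      calc (k : ℝ) * ((y - σ) / σ) ≤ 5 * ((y - σ) / y₁) := by
            refine mul_le_mul hk' h4 (div_nonneg (by linarith) hσ0.le) (by norm_num)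
        _ = 5 / y₁ * (y - σ) := by ring
        _ ≤ _ := mul_le_mul_of_nonneg_right hy₁ (by linarith)
    have h6 : (y / σ) ^ k * min 1 (Real.exp (-(2 * Real.pi * (y - σ))))
        ≤ Real.exp (-(μ * (y - σ))) := by
      calc _ ≤ Real.exp ((2 * Real.pi - μ) * (y - σ)) * Real.exp (-(2 * Real.pi * (y - σ))) :=
            mul_le_mul h3 (min_le_right _ _) (by positivity) (Real.exp_pos _).le
        _ = _ := by rw [← Real.exp_add]; congr 1; ring
    refine le_min (h6.trans ?_) h6
    rw [Real.exp_le_one_iff]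
    nlinarith [mul_nonneg hμ (sub_nonneg.2 h)]

/-- The bound `D e^{-μ(y-y₁)} + η` at depth `y = -Im s`. -/
def expProfile (D μ y₁ η : ℝ) (s : ℂ) : ℝ := D * Real.exp (-(μ * (-s.im - y₁))) + η

/-- If the difference `g(s+1) - g(s)` of an analytic function tending to zero is bounded by
`s^{-k-2}` times an exponential profile, then `s^k g(s)` is bounded by the same profile with a
gain of a factor `1/y₁`, up to the contribution of the upper end of the strip. -/
theorem norm_mode_le {g : ℂ → ℂ} {U : Set ℂ} (hU : IsOpen U) (hg : DifferentiableOn ℂ g U)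
    {k : ℕ} (hk : k ≤ 5) {μ y₁ D η V M : ℝ} (hμ : 0 ≤ μ) (h1 : 1 ≤ y₁)
    (hy₁ : 5 / y₁ ≤ 2 * Real.pi - μ) (hD : 0 ≤ D) (hη : 0 ≤ η) (hM : 0 ≤ M)
    (hsub : ∀ s : ℂ, |s.re| ≤ 1 → s.im ≤ -y₁ → s ∈ U)
    (hV : ∀ s : ℂ, |s.re| ≤ 1 → s.im ≤ -y₁ → ‖s‖ ^ k * ‖g s‖ ≤ V)
    (h0 : ∀ ε : ℝ, 0 < ε → ∃ Y₀ : ℝ, ∀ s : ℂ, |s.re| ≤ 1 → s.im ≤ -Y₀ → ‖g s‖ ≤ ε)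
    (hR : ∀ s : ℂ, -1 ≤ s.re → s.re ≤ 0 → s.im ≤ -y₁ →
      ‖s‖ ^ (k + 2) * ‖g (s + 1) - g s‖ ≤ M * expProfile D μ y₁ η s)
    {τ : ℂ} (hτ : |τ.re| ≤ 1 / 2) (hτ' : τ.im ≤ -(y₁ + 1)) :
    ‖τ‖ ^ k * ‖g τ‖ ≤ 2 ^ k * (4 * V * Real.exp (-(μ * (-τ.im - y₁)))
      + 2 * (M * expProfile D μ y₁ η τ / y₁)) := by
  have hy0 : 0 < y₁ := by linarith
  set y := -τ.im with hy
  have hyy : y₁ + 1 ≤ y := by linarith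
  have hyp : 0 < y := by linarith
  have hτr := abs_le.1 hτ
  have hstrip : ∀ s : ℂ, |s.re - τ.re| ≤ 1 / 2 → |s.re| ≤ 1 := by
    intro s hs
    rw [abs_le] at hs ⊢
    constructor <;> linarith [hs.1, hs.2, hτr.1, hτr.2]
  have him : ∀ s : ℂ, s.im ≤ 0 → -s.im ≤ ‖s‖ := by
    intro s hs
    have := abs_im_le_norm s
    rwa [abs_of_nonpos hs] at this
  have hP : 0 ≤ expProfile D μ y₁ η τ := by unfold expProfile; positivity
  have hV0 : 0 ≤ V := le_trans (by positivity) (hV τ (hstrip τ (by simp)) (by linarith))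
  have hmain := norm_le_of_tendsto_zero (T := V / y₁ ^ k)
    (W := M * expProfile D μ y₁ η τ / y ^ k) hU hg hy0 hyy
    (fun s h2 h3 => hsub s (hstrip s h2) h3) ?_ ?_ ?_
  · have hnorm : ‖τ‖ ≤ 2 * y := by
      have h2 := norm_le_abs_re_add_abs_im τ
      rw [abs_of_nonpos (by linarith : τ.im ≤ 0)] at h2
      linarith
    have hdamp := pow_mul_damping_le (y := y) (σ := y₁) hk hμ hy0 hy₁ (by linarith) le_rfl
    have hmin : min 1 (Real.exp (-(2 * Real.pi * (y - y₁))))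
        = Real.exp (-(2 * Real.pi * (y - y₁))) := by
      refine min_eq_right ?_
      rw [Real.exp_le_one_iff]
      have : 0 ≤ 2 * Real.pi * (y - y₁) :=
        mul_nonneg (by have := Real.pi_pos; positivity) (by linarith)
      linarith
    rw [hmin] at hdamp
    have hdamp' := hdamp.trans (min_le_right _ _)
    calc ‖τ‖ ^ k * ‖g τ‖
        ≤ (2 * y) ^ k * (4 * (V / y₁ ^ k) * Real.exp (-(2 * Real.pi * (y - y₁)))
          + 2 * (M * expProfile D μ y₁ η τ / y ^ k / y₁)) := by gcongr
      _ = 2 ^ k * (4 * V * ((y / y₁) ^ k * Real.exp (-(2 * Real.pi * (y - y₁))))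
          + 2 * (M * expProfile D μ y₁ η τ / y₁)) := by
          rw [mul_pow, div_pow]; field_simp
      _ ≤ _ := by gcongr
  · intro s hs hs'
    rw [le_div_iff₀ (by positivity), mul_comm]
    refine le_trans ?_ (hV s (hstrip s hs) hs'.le)
    have : y₁ ≤ ‖s‖ := by have := him s (by linarith); linarith
    gcongr
  · intro ε hε
    obtain ⟨Y₀, hY₀⟩ := h0 ε hε
    exact ⟨Y₀, fun s hs hs' => hY₀ s (hstrip s hs) hs'⟩
  · intro s hs hs'
    set σ := -s.im with hσ
    have hσ1 : y₁ ≤ σ := by linarith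
    have hσ0 : 0 < σ := by linarith
    have h2 := hR s (by linarith [hτr.1]) (by linarith [hτr.2]) hs'
    have h3 : σ ^ (k + 2) * ‖g (s + 1) - g s‖ ≤ M * expProfile D μ y₁ η s := by
      refine le_trans ?_ h2
      have := him s (by linarith)
      gcongr
    have hdamp := pow_mul_damping_le (y := y) (σ := σ) hk hμ hy0 hy₁ (by linarith) hσ1
    have e1 : τ.im - s.im = -(y - σ) := by rw [hy, hσ]; ring
    rw [e1, mul_neg, show s.im ^ 2 = σ ^ 2 by rw [hσ]; ring]
    set m := min 1 (Real.exp (-(2 * Real.pi * (y - σ)))) with hm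
    have hm0 : 0 ≤ m := le_min zero_le_one (Real.exp_pos _).le
    have h4 : (y / σ) ^ k * m * expProfile D μ y₁ η s ≤ expProfile D μ y₁ η τ := by
      have hA : (y / σ) ^ k * m ≤ 1 := hdamp.trans (min_le_left _ _)
      have hB : (y / σ) ^ k * m ≤ Real.exp (-(μ * (y - σ))) := hdamp.trans (min_le_right _ _)
      unfold expProfile
      rw [mul_add]
      refine add_le_add ?_ (mul_le_of_le_one_left hη hA)
      rw [← hσ, ← hy]
      calc (y / σ) ^ k * m * (D * Real.exp (-(μ * (σ - y₁))))
          ≤ Real.exp (-(μ * (y - σ))) * (D * Real.exp (-(μ * (σ - y₁)))) := by gcongr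
        _ = D * (Real.exp (-(μ * (y - σ))) * Real.exp (-(μ * (σ - y₁)))) := by ring
        _ = D * Real.exp (-(μ * (y - y₁))) := by rw [← Real.exp_add]; ring_nf
    rw [le_div_iff₀ (by positivity), le_div_iff₀ (by positivity)]
    calc ‖g (s + 1) - g s‖ * m * σ ^ 2 * y ^ k
        = (σ ^ (k + 2) * ‖g (s + 1) - g s‖) * ((y / σ) ^ k * m) := by
          rw [div_pow]; field_simp; ring
      _ ≤ (M * expProfile D μ y₁ η s) * ((y / σ) ^ k * m) := by gcongr
      _ = M * ((y / σ) ^ k * m * expProfile D μ y₁ η s) := by ring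
      _ ≤ _ := by gcongr

/-- One step changes the size `‖a‖ + ‖b‖` of the modes by at most a factor `1 + O(1/s)`, in either
direction. -/
theorem modes_shift_le {a b a' b' s : ℂ} {C : ℝ} (hC : 0 ≤ C) (hs : 12 + 8 * C ≤ ‖s‖)
    (hA : ‖a' - (1 + 3 * s⁻¹) * a‖ ≤ C / ‖s‖ ^ 2 * (‖a‖ + ‖b‖))
    (hB : ‖b' - (1 - 2 * s⁻¹) * b‖ ≤ C / ‖s‖ ^ 2 * (‖a‖ + ‖b‖)) :
    ‖a‖ + ‖b‖ ≤ 2 * (‖a'‖ + ‖b'‖) ∧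
      ‖a'‖ + ‖b'‖ ≤ (1 + (3 + 2 * C) / ‖s‖) * (‖a‖ + ‖b‖) ∧
      ‖a‖ + ‖b‖ ≤ (1 + 2 * (3 + 2 * C) / ‖s‖) * (‖a'‖ + ‖b'‖) := by
  have hs0 : 0 < ‖s‖ := by linarith
  have hs1 : 1 ≤ ‖s‖ := by linarith
  set σ := ‖a‖ + ‖b‖ with hσ
  have hσ0 : 0 ≤ σ := by positivity
  have h2 : C / ‖s‖ ^ 2 ≤ C / ‖s‖ := by
    gcongr
    exact le_self_pow₀ hs1 (by norm_num)
  have h2' := mul_le_mul_of_nonneg_right h2 hσ0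
  have e1 : a' - a = (a' - (1 + 3 * s⁻¹) * a) + 3 * s⁻¹ * a := by ring
  have e2 : b' - b = (b' - (1 - 2 * s⁻¹) * b) + (-2) * s⁻¹ * b := by ring
  have h3 : ‖a' - a‖ ≤ C / ‖s‖ * σ + 3 / ‖s‖ * ‖a‖ := by
    rw [e1]
    refine (norm_add_le _ _).trans (add_le_add (hA.trans h2') (le_of_eq ?_))
    simp [div_eq_mul_inv]
  have h4 : ‖b' - b‖ ≤ C / ‖s‖ * σ + 3 / ‖s‖ * ‖b‖ := by
    rw [e2]
    refine (norm_add_le _ _).trans (add_le_add (hB.trans h2') ?_)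
    simp only [norm_mul, norm_neg, norm_inv, div_eq_mul_inv]
    gcongr
    simp; norm_num
  set κ := (3 + 2 * C) / ‖s‖ with hκ
  have hκ0 : 0 ≤ κ := by positivity
  have hκ2 : κ ≤ 1 / 2 := by
    rw [hκ, div_le_iff₀ hs0]; linarith
  have h5 : ‖a' - a‖ + ‖b' - b‖ ≤ κ * σ := by
    calc _ ≤ (C / ‖s‖ * σ + 3 / ‖s‖ * ‖a‖) + (C / ‖s‖ * σ + 3 / ‖s‖ * ‖b‖) := add_le_add h3 h4
      _ = κ * σ := by rw [hκ, hσ]; ring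
  have h6 := norm_sub_norm_le a' a
  have h7 := norm_sub_norm_le b' b
  have h8 := norm_sub_norm_le a a'
  have h9 := norm_sub_norm_le b b'
  rw [norm_sub_rev] at h8 h9
  have h10 : σ - κ * σ ≤ ‖a'‖ + ‖b'‖ := by rw [hσ] at h5 ⊢; linarith
  have h11 : κ * σ ≤ 1 / 2 * σ := mul_le_mul_of_nonneg_right hκ2 hσ0
  refine ⟨by linarith, by rw [hσ] at h5 ⊢; linarith, ?_⟩
  have h12 : σ ≤ 2 * (‖a'‖ + ‖b'‖) := by linarith
  have h13 := mul_le_mul_of_nonneg_left h12 hκ0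
  have h14 : 2 * (3 + 2 * C) / ‖s‖ = 2 * κ := by rw [hκ]; ring
  rw [h14]; linarith

theorem norm_shift_bounds {s : ℂ} (hs : 2 ≤ ‖s‖) : ‖s‖ ≤ 2 * ‖s + 1‖ ∧ ‖s + 1‖ ≤ 2 * ‖s‖ := by
  have h1 := norm_add_le s 1
  have h2 := norm_sub_norm_le s (-1)
  rw [norm_neg, sub_neg_eq_add] at h2
  rw [norm_one] at h1 h2
  constructor <;> linarith

/-- The growing mode divided by `s³` varies slowly. -/
theorem norm_growing_mode_sub_le {a b a' s : ℂ} {C : ℝ} (hC : 0 ≤ C) (hs : 2 ≤ ‖s‖)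
    (hA : ‖a' - (1 + 3 * s⁻¹) * a‖ ≤ C / ‖s‖ ^ 2 * (‖a‖ + ‖b‖)) :
    ‖s‖ ^ 7 * ‖a' / (s + 1) ^ 3 - a / s ^ 3‖
      ≤ (8 * C + 32) * (‖s‖ ^ 2 * (‖a‖ + ‖b‖)) := by
  have hs0 : 0 < ‖s‖ := by linarith
  have hsn : s ≠ 0 := norm_pos_iff.1 hs0
  obtain ⟨h1, -⟩ := norm_shift_bounds hs
  have hs1 : 0 < ‖s + 1‖ := by linarith
  have hs1n : s + 1 ≠ 0 := norm_pos_iff.1 hs1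
  have e1 : a' / (s + 1) ^ 3 - a / s ^ 3
      = ((a' - (1 + 3 * s⁻¹) * a) - (3 + s⁻¹) / s ^ 2 * a) / (s + 1) ^ 3 := by
    field_simp
    ring
  have h2 : ‖(3 + s⁻¹ : ℂ)‖ ≤ 4 := by
    refine (norm_add_le _ _).trans ?_
    rw [norm_inv]
    have : ‖s‖⁻¹ ≤ 1 := inv_le_one_of_one_le₀ (by linarith)
    have h3 : ‖(3 : ℂ)‖ = 3 := by simp
    linarith
  have h3 : ‖(a' - (1 + 3 * s⁻¹) * a) - (3 + s⁻¹) / s ^ 2 * a‖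
      ≤ (C + 4) / ‖s‖ ^ 2 * (‖a‖ + ‖b‖) := by
    refine (norm_sub_le _ _).trans ?_
    rw [norm_mul, norm_div, norm_pow]
    calc _ ≤ C / ‖s‖ ^ 2 * (‖a‖ + ‖b‖) + 4 / ‖s‖ ^ 2 * (‖a‖ + ‖b‖) := by
          refine add_le_add hA ?_
          have := norm_nonneg b
          gcongr
          linarith
      _ = _ := by ring
  rw [e1, norm_div, norm_pow, ← mul_div_assoc, div_le_iff₀ (by positivity)]
  have h4 : ‖s‖ ^ 3 ≤ 8 * ‖s + 1‖ ^ 3 := by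
    calc ‖s‖ ^ 3 ≤ (2 * ‖s + 1‖) ^ 3 := by gcongr
      _ = _ := by ring
  calc ‖s‖ ^ 7 * ‖(a' - (1 + 3 * s⁻¹) * a) - (3 + s⁻¹) / s ^ 2 * a‖
      ≤ ‖s‖ ^ 7 * ((C + 4) / ‖s‖ ^ 2 * (‖a‖ + ‖b‖)) := by gcongr
    _ = (C + 4) * (‖s‖ ^ 2 * (‖a‖ + ‖b‖)) * ‖s‖ ^ 3 := by field_simp
    _ ≤ (C + 4) * (‖s‖ ^ 2 * (‖a‖ + ‖b‖)) * (8 * ‖s + 1‖ ^ 3) := by gcongr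
    _ = _ := by ring

/-- The decaying mode multiplied by `s²` varies slowly. -/
theorem norm_decaying_mode_sub_le {a b b' s : ℂ} {C : ℝ} (hC : 0 ≤ C) (hs : 2 ≤ ‖s‖)
    (hB : ‖b' - (1 - 2 * s⁻¹) * b‖ ≤ C / ‖s‖ ^ 2 * (‖a‖ + ‖b‖)) :
    ‖s‖ ^ 2 * ‖(s + 1) ^ 2 * b' - s ^ 2 * b‖
      ≤ (8 * C + 32) * (‖s‖ ^ 2 * (‖a‖ + ‖b‖)) := by
  have hs0 : 0 < ‖s‖ := by linarith
  have hsn : s ≠ 0 := norm_pos_iff.1 hs0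
  obtain ⟨-, h1⟩ := norm_shift_bounds hs
  have e1 : (s + 1) ^ 2 * b' - s ^ 2 * b
      = (s + 1) ^ 2 * (b' - (1 - 2 * s⁻¹) * b) - (3 + 2 * s⁻¹) * b := by
    field_simp
    ring
  have h2 : ‖(3 + 2 * s⁻¹ : ℂ)‖ ≤ 5 := by
    refine (norm_add_le _ _).trans ?_
    rw [norm_mul, norm_inv]
    have : ‖s‖⁻¹ ≤ 1 := inv_le_one_of_one_le₀ (by linarith)
    have h3 : ‖(3 : ℂ)‖ = 3 := by simp
    have h4 : ‖(2 : ℂ)‖ = 2 := by simp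
    rw [h3, h4]; linarith
  have h3 : ‖(s + 1) ^ 2 * b' - s ^ 2 * b‖ ≤ (8 * C + 32) * (‖a‖ + ‖b‖) := by
    rw [e1]
    refine (norm_sub_le _ _).trans ?_
    rw [norm_mul, norm_mul, norm_pow]
    calc _ ≤ (2 * ‖s‖) ^ 2 * (C / ‖s‖ ^ 2 * (‖a‖ + ‖b‖)) + 5 * (‖a‖ + ‖b‖) := by
          have := norm_nonneg a
          gcongr
          linarith
      _ = (4 * C + 5) * (‖a‖ + ‖b‖) := by field_simp; ring
      _ ≤ _ := by gcongr <;> linarith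
  calc _ ≤ ‖s‖ ^ 2 * ((8 * C + 32) * (‖a‖ + ‖b‖)) := by gcongr
    _ = _ := by ring

/-- Let `a`, `b` be analytic in a vertical strip, satisfy the difference equations
`a(s+1) = (1 + 3/s) a(s)`, `b(s+1) = (1 - 2/s) b(s)` up to a relative error `O(s⁻²)`, and let
`s² (a, b)` tend to zero downwards. Then `(a, b)` decays exponentially, with any rate below `2π`. -/
theorem exists_exp_bound_of_mode_equations {a b : ℂ → ℂ} {U : Set ℂ} (hU : IsOpen U)
    (ha : DifferentiableOn ℂ a U) (hb : DifferentiableOn ℂ b U) {y₀ C : ℝ} (hC : 0 ≤ C)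
    (hsub : ∀ s : ℂ, |s.re| ≤ 1 → s.im ≤ -y₀ → s ∈ U)
    (hA : ∀ s : ℂ, -1 ≤ s.re → s.re ≤ 0 → s.im ≤ -y₀ →
      ‖a (s + 1) - (1 + 3 * s⁻¹) * a s‖ ≤ C / ‖s‖ ^ 2 * (‖a s‖ + ‖b s‖))
    (hB : ∀ s : ℂ, -1 ≤ s.re → s.re ≤ 0 → s.im ≤ -y₀ →
      ‖b (s + 1) - (1 - 2 * s⁻¹) * b s‖ ≤ C / ‖s‖ ^ 2 * (‖a s‖ + ‖b s‖))
    (h0 : ∀ ε : ℝ, 0 < ε → ∃ Y : ℝ, ∀ s : ℂ, |s.re| ≤ 1 → s.im ≤ -Y →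
      ‖s‖ ^ 2 * (‖a s‖ + ‖b s‖) ≤ ε)
    {μ : ℝ} (hμ : 0 ≤ μ) (hμ2 : μ < 2 * Real.pi) :
    ∃ K Y : ℝ, ∀ s : ℂ, |s.re| ≤ 1 / 2 → s.im ≤ -Y →
      ‖a s‖ + ‖b s‖ ≤ K * Real.exp (μ * s.im) := by
  obtain ⟨Y₁, hY₁⟩ := h0 1 one_pos
  set M := 8 * (8 * C + 32) with hM
  have hM0 : 0 < M := by positivity
  have hgap : 0 < 2 * Real.pi - μ := by linarith
  set y₁ := max (max y₀ Y₁) (max (132 * M) (max (12 + 8 * C) (5 / (2 * Real.pi - μ)))) with hy₁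
  have b1 : y₀ ≤ y₁ := (le_max_left _ _).trans (le_max_left _ _)
  have b2 : Y₁ ≤ y₁ := (le_max_right _ _).trans (le_max_left _ _)
  have b3 : 132 * M ≤ y₁ := (le_max_left _ _).trans (le_max_right _ _)
  have b4 : 12 + 8 * C ≤ y₁ :=
    (le_max_left _ _).trans ((le_max_right _ _).trans (le_max_right _ _))
  have b5 : 5 / (2 * Real.pi - μ) ≤ y₁ :=
    (le_max_right _ _).trans ((le_max_right _ _).trans (le_max_right _ _))
  have h1 : 1 ≤ y₁ := by linarith
  have hy0 : 0 < y₁ := by linarith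
  have hy₁5 : 5 / y₁ ≤ 2 * Real.pi - μ := by
    rw [div_le_iff₀ hgap] at b5
    rw [div_le_iff₀ hy0]; linarith
  have hnorm : ∀ s : ℂ, s.im ≤ -y₁ → y₁ ≤ ‖s‖ := by
    intro s hs
    have := abs_im_le_norm s
    rw [abs_of_nonpos (by linarith)] at this
    linarith
  have hVb : ∀ s : ℂ, |s.re| ≤ 1 → s.im ≤ -y₁ → ‖s‖ ^ 2 * (‖a s‖ + ‖b s‖) ≤ 1 :=
    fun s h2 h3 => hY₁ s h2 (by linarith)
  set D := 264 + Real.exp (2 * Real.pi) with hD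
  have hD0 : 0 ≤ D := by positivity
  -- One improvement step for the bound by an exponential profile plus a constant `η`.
  have improve : ∀ η : ℝ, 0 ≤ η →
      (∀ s : ℂ, |s.re| ≤ 1 / 2 → s.im ≤ -y₁ →
        ‖s‖ ^ 2 * (‖a s‖ + ‖b s‖) ≤ expProfile D μ y₁ η s) →
      ∀ s : ℂ, |s.re| ≤ 1 / 2 → s.im ≤ -y₁ →
        ‖s‖ ^ 2 * (‖a s‖ + ‖b s‖) ≤ expProfile D μ y₁ (η / 2) s := by
    intro η hη hη' τ hτ hτ'
    by_cases hτy : τ.im ≤ -(y₁ + 1)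
    swap
    · -- Near the upper end the trivial bound suffices.
      refine (hVb τ (by linarith) hτ').trans ?_
      have h2 : 1 ≤ D * Real.exp (-(μ * (-τ.im - y₁))) := by
        have h3 : μ * (-τ.im - y₁) ≤ 2 * Real.pi := by
          have h4 : -τ.im - y₁ ≤ 1 := by linarith
          have h5 := mul_le_mul_of_nonneg_left h4 hμ
          linarith
        calc (1 : ℝ) = Real.exp (2 * Real.pi) * Real.exp (-(2 * Real.pi)) := by
              rw [← Real.exp_add]; simp
          _ ≤ D * Real.exp (-(μ * (-τ.im - y₁))) := by
              gcongr
              rw [hD]; linarith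
      unfold expProfile; linarith
    have hwide : ∀ s : ℂ, -1 ≤ s.re → s.re ≤ 0 → s.im ≤ -y₁ →
        ‖s‖ ^ 2 * (‖a s‖ + ‖b s‖) ≤ 8 * expProfile D μ y₁ η s := by
      intro s hs hs' hs''
      have hP : 0 ≤ expProfile D μ y₁ η s := by unfold expProfile; positivity
      by_cases h2 : -(1 / 2) ≤ s.re
      · have := hη' s (by rw [abs_le]; constructor <;> linarith) hs''
        linarith
      · have him : (s + 1).im = s.im := by simp
        have h3 := hη' (s + 1) (by rw [add_re, one_re, abs_le]; constructor <;> linarith)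
          (by rw [him]; exact hs'')
        have e1 : expProfile D μ y₁ η (s + 1) = expProfile D μ y₁ η s := by
          simp [expProfile]
        rw [e1] at h3
        have hsn := hnorm s hs''
        obtain ⟨h4, -, -⟩ := modes_shift_le hC (b4.trans hsn) (hA s hs hs' (by linarith))
          (hB s hs hs' (by linarith))
        obtain ⟨h5, -⟩ := norm_shift_bounds (s := s) (by linarith)
        calc ‖s‖ ^ 2 * (‖a s‖ + ‖b s‖)
            ≤ (2 * ‖s + 1‖) ^ 2 * (2 * (‖a (s + 1)‖ + ‖b (s + 1)‖)) := by gcongr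
          _ = 8 * (‖s + 1‖ ^ 2 * (‖a (s + 1)‖ + ‖b (s + 1)‖)) := by ring
          _ ≤ _ := by gcongr
    have hsub' : ∀ s : ℂ, |s.re| ≤ 1 → s.im ≤ -y₁ → s ∈ U ∩ {s | s ≠ 0} := by
      intro s h2 h3
      refine ⟨hsub s h2 (by linarith), fun h4 => ?_⟩
      rw [h4] at h3
      simp at h3
      linarith
    have hU' : IsOpen (U ∩ {s : ℂ | s ≠ 0}) := hU.inter isOpen_ne
    have dg₁ : DifferentiableOn ℂ (fun s => a s / s ^ 3) (U ∩ {s | s ≠ 0}) := fun s hs =>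
      ((ha s hs.1).mono Set.inter_subset_left).div (by fun_prop) (pow_ne_zero 3 hs.2)
    have dg₂ : DifferentiableOn ℂ (fun s => s ^ 2 * b s) (U ∩ {s | s ≠ 0}) := fun s hs =>
      DifferentiableWithinAt.mul (by fun_prop) ((hb s hs.1).mono Set.inter_subset_left)
    have en₁ : ∀ s : ℂ, s.im ≤ -y₁ → ‖s‖ ^ 5 * ‖a s / s ^ 3‖ = ‖s‖ ^ 2 * ‖a s‖ := by
      intro s hs
      have : 0 < ‖s‖ := lt_of_lt_of_le hy0 (hnorm s hs)
      rw [norm_div, norm_pow]; field_simp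
    have hle : ∀ s : ℂ, ‖s‖ ^ 2 * ‖a s‖ ≤ ‖s‖ ^ 2 * (‖a s‖ + ‖b s‖) ∧
        ‖s‖ ^ 2 * ‖b s‖ ≤ ‖s‖ ^ 2 * (‖a s‖ + ‖b s‖) := by
      intro s
      have := norm_nonneg (a s)
      have := norm_nonneg (b s)
      constructor <;> gcongr <;> linarith
    have m₁ := norm_mode_le (k := 5) (g := fun s => a s / s ^ 3) (V := 1) (M := M)
      hU' dg₁ le_rfl hμ h1 hy₁5
      hD0 hη hM0.le hsub' (fun s h2 h3 => by
        rw [en₁ s h3]; exact (hle s).1.trans (hVb s h2 h3)) (fun ε hε => by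
          obtain ⟨Y, hY⟩ := h0 ε hε
          refine ⟨max Y y₁, fun s h2 h3 => ?_⟩
          have h4 : Y ≤ max Y y₁ := le_max_left _ _
          have h5 : y₁ ≤ max Y y₁ := le_max_right _ _
          have h6 := (hle s).1.trans (hY s h2 (by linarith))
          rw [← en₁ s (by linarith)] at h6
          have h7 : 1 ≤ ‖s‖ ^ 5 := one_le_pow₀ (h1.trans (hnorm s (by linarith)))
          exact (le_mul_of_one_le_left (norm_nonneg _) h7).trans h6) (fun s h2 h3 h4 => by
            refine (norm_growing_mode_sub_le hC (by linarith [hnorm s h4])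
              (hA s h2 h3 (by linarith))).trans ?_
            calc _ ≤ (8 * C + 32) * (8 * expProfile D μ y₁ η s) :=
                  mul_le_mul_of_nonneg_left (hwide s h2 h3 h4) (by positivity)
              _ = _ := by rw [hM]; ring) hτ hτy
    have m₂ := norm_mode_le (k := 0) (g := fun s => s ^ 2 * b s) (V := 1) (M := M)
      hU' dg₂ (by norm_num) hμ h1
      hy₁5 hD0 hη hM0.le hsub' (fun s h2 h3 => by
        rw [pow_zero, one_mul, norm_mul, norm_pow]; exact (hle s).2.trans (hVb s h2 h3))
        (fun ε hε => by
          obtain ⟨Y, hY⟩ := h0 ε hε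
          refine ⟨Y, fun s h2 h3 => ?_⟩
          rw [norm_mul, norm_pow]
          exact (hle s).2.trans (hY s h2 h3)) (fun s h2 h3 h4 => by
            refine (norm_decaying_mode_sub_le hC (by linarith [hnorm s h4])
              (hB s h2 h3 (by linarith))).trans ?_
            calc _ ≤ (8 * C + 32) * (8 * expProfile D μ y₁ η s) :=
                  mul_le_mul_of_nonneg_left (hwide s h2 h3 h4) (by positivity)
              _ = _ := by rw [hM]; ring) hτ hτy
    simp only [en₁ τ hτ'] at m₁
    simp only [pow_zero, one_mul, norm_mul, norm_pow] at m₂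
    -- The two modes contribute `2⁵ + 2⁰ = 33` times `4 E + 2 M (D E + η) / y₁`; the choices
    -- `132 M ≤ y₁` and `264 ≤ D` make this at most `D E + η / 2`.
    set E := Real.exp (-(μ * (-τ.im - y₁))) with hE
    have hE0 : 0 < E := Real.exp_pos _
    have hPτ : expProfile D μ y₁ η τ = D * E + η := rfl
    have h3 : M * expProfile D μ y₁ η τ / y₁ ≤ expProfile D μ y₁ η τ / 132 := by
      have hP : 0 ≤ expProfile D μ y₁ η τ := by rw [hPτ]; positivity
      rw [div_le_div_iff₀ hy0 (by norm_num)]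
      nlinarith
    have h4 : expProfile D μ y₁ (η / 2) τ = D * E + η / 2 := rfl
    have h5 : 264 * E ≤ D * E := by
      gcongr
      rw [hD]
      linarith [Real.exp_pos (2 * Real.pi)]
    rw [h4, mul_add]
    rw [hPτ] at h3 m₁ m₂
    norm_num at m₁
    linarith
  have claim : ∀ n : ℕ, ∀ s : ℂ, |s.re| ≤ 1 / 2 → s.im ≤ -y₁ →
      ‖s‖ ^ 2 * (‖a s‖ + ‖b s‖) ≤ expProfile D μ y₁ ((1 / 2) ^ n) s := by
    intro n
    induction n with
    | zero =>
      intro s h2 h3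
      refine (hVb s (by linarith) h3).trans ?_
      have : 0 ≤ D * Real.exp (-(μ * (-s.im - y₁))) := by positivity
      simp only [expProfile, pow_zero]; linarith
    | succ n ih =>
      have := improve _ (by positivity) ih
      intro s h2 h3
      have h4 := this s h2 h3
      rwa [show ((1 : ℝ) / 2) ^ n / 2 = (1 / 2) ^ (n + 1) by rw [pow_succ]; ring] at h4
  refine ⟨D * Real.exp (μ * y₁), y₁, fun s h2 h3 => ?_⟩
  have hlim : ‖s‖ ^ 2 * (‖a s‖ + ‖b s‖) ≤ D * Real.exp (-(μ * (-s.im - y₁))) := by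
    have hl : Filter.Tendsto (fun n : ℕ => expProfile D μ y₁ ((1 / 2) ^ n) s) Filter.atTop
        (nhds (D * Real.exp (-(μ * (-s.im - y₁))) + 0)) :=
      tendsto_const_nhds.add
        (tendsto_pow_atTop_nhds_zero_of_lt_one (by norm_num) (by norm_num))
    rw [add_zero] at hl
    exact ge_of_tendsto' hl fun n => claim n s h2 h3
  have h4 : 1 ≤ ‖s‖ ^ 2 := one_le_pow₀ (h1.trans (hnorm s h3))
  refine (le_mul_of_one_le_left (by positivity) h4).trans (hlim.trans (le_of_eq ?_))
  rw [mul_assoc, ← Real.exp_add]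
  congr 2
  ring

/-! ### Convergence of nearly periodic functions -/

/-- Means over horizontal segments of length one, taken at the same depth, differ by a small amount
if `g(s+1) - g(s)` is small. -/
theorem norm_mean_sub_mean_le {g : ℂ → ℂ} {Y R x₀ x₁ : ℝ}
    (hg : ∀ x : ℝ, |x| ≤ 1 → ContinuousAt g (x + (-Y : ℝ) * I))
    (hR : ∀ x : ℝ, -1 ≤ x → x ≤ 0 →
      ‖g (x + (-Y : ℝ) * I + 1) - g (x + (-Y : ℝ) * I)‖ ≤ R)
    (h0 : -1 ≤ x₀) (h0' : x₀ ≤ 0) (h1 : -1 ≤ x₁) (h1' : x₁ ≤ 0) :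
    ‖(∫ x in x₀..(x₀ + 1), g (x + (-Y : ℝ) * I)) - ∫ x in x₁..(x₁ + 1), g (x + (-Y : ℝ) * I)‖
      ≤ R := by
  set φ : ℝ → ℂ := fun x => g (x + (-Y : ℝ) * I) with hφ
  have hφc : ContinuousOn φ (Set.Icc (-1) 1) := fun x hx =>
    (ContinuousAt.comp (f := fun x : ℝ => (x : ℂ) + (-Y : ℝ) * I) (hg x (abs_le.2 hx))
      (by fun_prop)).continuousWithinAt
  have hint : ∀ p q : ℝ, p ∈ Set.Icc (-1 : ℝ) 1 → q ∈ Set.Icc (-1 : ℝ) 1 →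
      IntervalIntegrable φ MeasureTheory.volume p q := fun p q hp hq =>
    (hφc.mono (Set.uIcc_subset_Icc hp hq)).intervalIntegrable
  have m0 : x₀ ∈ Set.Icc (-1 : ℝ) 1 := ⟨h0, by linarith⟩
  have m1 : x₁ ∈ Set.Icc (-1 : ℝ) 1 := ⟨h1, by linarith⟩
  have m0' : x₀ + 1 ∈ Set.Icc (-1 : ℝ) 1 := ⟨by linarith, by linarith⟩
  have m1' : x₁ + 1 ∈ Set.Icc (-1 : ℝ) 1 := ⟨by linarith, by linarith⟩
  rw [intervalIntegral.integral_interval_sub_interval_comm (hint _ _ m0 m0') (hint _ _ m1 m1')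
    (hint _ _ m0 m1), ← intervalIntegral.integral_comp_add_right (a := x₀) (b := x₁) φ 1,
    ← intervalIntegral.integral_sub (hint _ _ m0 m1) (by
      rw [IntervalIntegrable.comp_add_right_iff]; exact hint _ _ m0' m1')]
  have hR0 : 0 ≤ R := (norm_nonneg _).trans (hR 0 (by norm_num) le_rfl)
  refine (intervalIntegral.norm_integral_le_of_norm_le_const (C := R) fun x hx => ?_).trans ?_
  · have hx' := Set.uIoc_subset_uIcc hx
    have hx2 := Set.uIcc_subset_Icc (a₂ := -1) (b₂ := 0) ⟨h0, h0'⟩ ⟨h1, h1'⟩ hx'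
    rw [norm_sub_rev]
    have := hR x hx2.1 hx2.2
    rwa [show (x : ℂ) + (-Y : ℝ) * I + 1 = ((x + 1 : ℝ) : ℂ) + (-Y : ℝ) * I by push_cast; ring]
      at this
  · refine mul_le_of_le_one_right hR0 ?_
    rw [abs_le]; constructor <;> linarith

theorem exp_neg_mul_min_le {ν y σ : ℝ} (hν : 0 ≤ ν) (hν2 : ν ≤ 2 * Real.pi) :
    Real.exp (-(ν * σ)) * min 1 (Real.exp (-(2 * Real.pi * (y - σ)))) ≤ Real.exp (-(ν * y)) := by
  rcases le_total y σ with h | h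
  · refine (mul_le_of_le_one_right (Real.exp_pos _).le (min_le_left _ _)).trans ?_
    rw [Real.exp_le_exp]; nlinarith
  · refine (mul_le_mul_of_nonneg_left (min_le_right _ _) (Real.exp_pos _).le).trans ?_
    rw [← Real.exp_add, Real.exp_le_exp]; nlinarith

theorem exp_neg_le_div_sq {d σ : ℝ} (hd : 0 < d) (hσ : 0 < σ) :
    Real.exp (-(d * σ)) ≤ 2 / d ^ 2 / σ ^ 2 := by
  have h := Real.quadratic_le_exp_of_nonneg (mul_pos hd hσ).le
  have h2 : (d * σ) ^ 2 / 2 ≤ Real.exp (d * σ) := by nlinarith [mul_pos hd hσ]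
  rw [Real.exp_neg]
  calc (Real.exp (d * σ))⁻¹ ≤ ((d * σ) ^ 2 / 2)⁻¹ := inv_anti₀ (by positivity) h2
    _ = _ := by field_simp

/-- An analytic function in a vertical strip with `g(s+1) - g(s) = O(e^{-ν'y})` that grows more
slowly than `e^{2πy}` converges exponentially fast to a constant as the depth `y = -Im s` grows. -/
theorem exists_limit_of_nearly_periodic {g : ℂ → ℂ} {U : Set ℂ} (hU : IsOpen U)
    (hg : DifferentiableOn ℂ g U) {y₁ K γ ν ν' : ℝ} (hy₁ : 0 < y₁) (hγ : 0 ≤ γ) (hν : 0 < ν)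
    (hνν : ν < ν') (hγν : ν + γ ≤ 2 * Real.pi)
    (hsub : ∀ s : ℂ, |s.re| ≤ 1 → s.im ≤ -y₁ → s ∈ U)
    (hK : ∀ s : ℂ, |s.re| ≤ 1 → s.im ≤ -y₁ → ‖g s‖ ≤ K * Real.exp (γ * -s.im))
    (hR : ∀ s : ℂ, -1 ≤ s.re → s.re ≤ 0 → s.im ≤ -y₁ →
      ‖g (s + 1) - g s‖ ≤ K * Real.exp (-(ν' * -s.im))) :
    ∃ (c : ℂ) (K' : ℝ), ∀ s : ℂ, |s.re| ≤ 1 / 2 → s.im ≤ -(y₁ + 1) →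
      ‖g s - c‖ ≤ K' * Real.exp (-(ν * -s.im)) := by
  have hK0 : 0 ≤ K := by
    have h := (norm_nonneg _).trans (hK ⟨0, -y₁⟩ (by simp) le_rfl)
    exact nonneg_of_mul_nonneg_left h (Real.exp_pos _)
  have hd : 0 < ν' - ν := by linarith
  set L := 4 * K * Real.exp (2 * Real.pi * y₁) + K * (2 / (ν' - ν) ^ 2) / y₁ with hL
  have hL0 : 0 ≤ L := by positivity
  -- Comparison with the mean at depth `Y`.
  have hmean : ∀ τ : ℂ, |τ.re| ≤ 1 / 2 → τ.im ≤ -(y₁ + 1) → ∀ Y : ℝ, -τ.im + 1 ≤ Y →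
      ‖g τ - ∫ x in (τ.re - 1 / 2)..(τ.re - 1 / 2 + 1), g (x + (-Y : ℝ) * I)‖
        ≤ L * Real.exp (-(ν * -τ.im))
          + 4 * K * Real.exp (2 * Real.pi * -τ.im) * Real.exp (-((2 * Real.pi - γ) * Y)) := by
    intro τ hτ hτ' Y hY
    set y := -τ.im with hy
    have hyy : y₁ + 1 ≤ y := by linarith
    have hτr := abs_le.1 hτ
    have hstrip : ∀ s : ℂ, |s.re - τ.re| ≤ 1 / 2 → |s.re| ≤ 1 := by
      intro s hs
      rw [abs_le] at hs ⊢
      constructor <;> linarith [hs.1, hs.2, hτr.1, hτr.2]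
    have h := norm_sub_mean_le (T := K * Real.exp (γ * y)) (G := K * Real.exp (γ * Y))
      (W := K * (2 / (ν' - ν) ^ 2) * Real.exp (-(ν * y))) hU hg hy₁ hyy hY
      (fun s h2 _ h4 => hsub s (hstrip s h2) h4) (fun s h2 h3 => by
        refine (hK s (hstrip s h2) h3.le).trans ?_
        rw [h3]; gcongr; linarith) (fun s h2 h3 => by
        refine (hK s (hstrip s h2) (by rw [h3]; linarith)).trans ?_
        rw [h3, neg_neg]) (fun s h2 _ h4 => by
        set σ := -s.im with hσ
        have hσ0 : 0 < σ := by linarith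
        have h5 := hR s (by linarith [hτr.1]) (by linarith [hτr.2]) h4
        have e1 : τ.im - s.im = -(y - σ) := by rw [hy, hσ]; ring
        have e2 : s.im ^ 2 = σ ^ 2 := by rw [hσ]; ring
        rw [e1, mul_neg, e2]
        have h6 : Real.exp (-(ν' * σ))
            = Real.exp (-((ν' - ν) * σ)) * Real.exp (-(ν * σ)) := by
          rw [← Real.exp_add]; congr 1; ring
        have h7 := exp_neg_mul_min_le (y := y) (σ := σ) hν.le (by linarith : ν ≤ 2 * Real.pi)
        have h8 := exp_neg_le_div_sq hd hσ0
        set m := min 1 (Real.exp (-(2 * Real.pi * (y - σ)))) with hm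
        have hm0 : 0 ≤ m := le_min zero_le_one (Real.exp_pos _).le
        calc ‖g (s + 1) - g s‖ * m ≤ (K * Real.exp (-(ν' * σ))) * m := by gcongr
          _ = K * Real.exp (-((ν' - ν) * σ)) * (Real.exp (-(ν * σ)) * m) := by rw [h6]; ring
          _ ≤ K * (2 / (ν' - ν) ^ 2 / σ ^ 2) * Real.exp (-(ν * y)) := by gcongr
          _ = _ := by ring)
    rw [show τ.re - 1 / 2 + 1 = τ.re + 1 / 2 by ring]
    refine h.trans ?_
    have hgτ : ‖g τ‖ ≤ K * Real.exp (γ * y) := hK τ (by linarith) (by linarith)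
    have hyY : y ≤ Y := by linarith
    have hgY : ‖g τ‖ ≤ K * Real.exp (γ * Y) := hgτ.trans (by gcongr)
    have t1 : 2 * (K * Real.exp (γ * y) + ‖g τ‖) * Real.exp (-(2 * Real.pi * (y - y₁)))
        ≤ 4 * K * Real.exp (2 * Real.pi * y₁) * Real.exp (-(ν * y)) := by
      calc _ ≤ 2 * (K * Real.exp (γ * y) + K * Real.exp (γ * y))
              * Real.exp (-(2 * Real.pi * (y - y₁))) := by gcongr
        _ = 4 * K * (Real.exp (γ * y) * Real.exp (-(2 * Real.pi * (y - y₁)))) := by ring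
        _ ≤ 4 * K * (Real.exp (2 * Real.pi * y₁) * Real.exp (-(ν * y))) := by
            rw [← Real.exp_add, ← Real.exp_add]
            refine mul_le_mul_of_nonneg_left (Real.exp_le_exp.2 ?_) (by positivity)
            nlinarith
        _ = _ := by ring
    have t2 : 2 * (K * Real.exp (γ * Y) + ‖g τ‖) * Real.exp (-(2 * Real.pi * (Y + τ.im)))
        ≤ 4 * K * Real.exp (2 * Real.pi * y) * Real.exp (-((2 * Real.pi - γ) * Y)) := by
      calc _ ≤ 2 * (K * Real.exp (γ * Y) + K * Real.exp (γ * Y))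
              * Real.exp (-(2 * Real.pi * (Y + τ.im))) := by gcongr
        _ = 4 * K * (Real.exp (γ * Y) * Real.exp (-(2 * Real.pi * (Y + τ.im)))) := by ring
        _ = 4 * K * (Real.exp (2 * Real.pi * y) * Real.exp (-((2 * Real.pi - γ) * Y))) := by
            rw [← Real.exp_add, ← Real.exp_add]
            congr 2
            rw [hy]; ring
        _ = _ := by ring
    calc _ ≤ 4 * K * Real.exp (2 * Real.pi * y₁) * Real.exp (-(ν * y))
          + 4 * K * Real.exp (2 * Real.pi * y) * Real.exp (-((2 * Real.pi - γ) * Y))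
          + K * (2 / (ν' - ν) ^ 2) * Real.exp (-(ν * y)) / y₁ := by gcongr
      _ = _ := by rw [hL]; ring
  -- Two values of `g` differ little, since the means at large depth agree in the limit.
  have hdiff : ∀ τ τ' : ℂ, |τ.re| ≤ 1 / 2 → τ.im ≤ -(y₁ + 1) → |τ'.re| ≤ 1 / 2 →
      τ'.im ≤ -(y₁ + 1) →
      ‖g τ - g τ'‖ ≤ L * Real.exp (-(ν * -τ.im)) + L * Real.exp (-(ν * -τ'.im)) := by
    intro τ τ' h1 h2 h1' h2'
    have hlim : Filter.Tendsto (fun Y : ℝ =>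
        L * Real.exp (-(ν * -τ.im)) + L * Real.exp (-(ν * -τ'.im))
          + (4 * K * Real.exp (2 * Real.pi * -τ.im) * Real.exp (-((2 * Real.pi - γ) * Y))
          + 4 * K * Real.exp (2 * Real.pi * -τ'.im) * Real.exp (-((2 * Real.pi - γ) * Y))
          + K * Real.exp (-(ν' * Y)))) Filter.atTop
        (nhds (L * Real.exp (-(ν * -τ.im)) + L * Real.exp (-(ν * -τ'.im))
          + (4 * K * Real.exp (2 * Real.pi * -τ.im) * 0
            + 4 * K * Real.exp (2 * Real.pi * -τ'.im) * 0 + K * 0))) := by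
      have he : ∀ p : ℝ, 0 < p →
          Filter.Tendsto (fun Y : ℝ => Real.exp (-(p * Y))) Filter.atTop (nhds 0) := fun p hp =>
        Real.tendsto_exp_neg_atTop_nhds_zero.comp
          (Filter.tendsto_id.const_mul_atTop hp)
      have e1 := he (2 * Real.pi - γ) (by linarith)
      have e2 := he ν' (by linarith)
      exact tendsto_const_nhds.add (((e1.const_mul _).add (e1.const_mul _)).add (e2.const_mul _))
    have h3 : ∀ᶠ Y : ℝ in Filter.atTop, ‖g τ - g τ'‖ ≤
        L * Real.exp (-(ν * -τ.im)) + L * Real.exp (-(ν * -τ'.im))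
          + (4 * K * Real.exp (2 * Real.pi * -τ.im) * Real.exp (-((2 * Real.pi - γ) * Y))
          + 4 * K * Real.exp (2 * Real.pi * -τ'.im) * Real.exp (-((2 * Real.pi - γ) * Y))
          + K * Real.exp (-(ν' * Y))) := by
      filter_upwards [Filter.eventually_ge_atTop (-τ.im + 1),
        Filter.eventually_ge_atTop (-τ'.im + 1)] with Y hY hY'
      have m1 := hmean τ h1 h2 Y hY
      have m2 := hmean τ' h1' h2' Y hY'
      have i1 := abs_le.1 h1
      have i2 := abs_le.1 h1'
      have hre : ∀ x : ℝ, ((x : ℂ) + (-Y : ℝ) * I).re = x ∧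
          ((x : ℂ) + (-Y : ℝ) * I).im = -Y := by intro x; simp
      have m3 := norm_mean_sub_mean_le (g := g) (Y := Y) (R := K * Real.exp (-(ν' * Y)))
        (x₀ := τ.re - 1 / 2) (x₁ := τ'.re - 1 / 2) (fun x hx =>
          (hg.differentiableAt (hU.mem_nhds (hsub _ (by rwa [(hre x).1])
            (by rw [(hre x).2]; linarith)))).continuousAt) (fun x hx hx' => by
          have := hR (x + (-Y : ℝ) * I) (by rwa [(hre x).1]) (by rwa [(hre x).1])
            (by rw [(hre x).2]; linarith)
          rwa [(hre x).2, neg_neg] at this) (by linarith) (by linarith) (by linarith) (by linarith)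
      set A := ∫ x in (τ.re - 1 / 2)..(τ.re - 1 / 2 + 1), g (x + (-Y : ℝ) * I) with hA
      set B := ∫ x in (τ'.re - 1 / 2)..(τ'.re - 1 / 2 + 1), g (x + (-Y : ℝ) * I) with hB
      have e1 : g τ - g τ' = (g τ - A) - (g τ' - B) + (A - B) := by ring
      rw [e1]
      have n1 := norm_add_le ((g τ - A) - (g τ' - B)) (A - B)
      have n2 := norm_sub_le (g τ - A) (g τ' - B)
      linarith
    have := ge_of_tendsto hlim h3
    simpa using this
  -- The limit along the imaginary axis.
  set z : ℕ → ℂ := fun n => ⟨0, -(y₁ + 1 + n)⟩ with hz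
  have hz1 : ∀ n, |(z n).re| ≤ 1 / 2 := fun n => by simp [hz]
  have hz2 : ∀ n, (z n).im ≤ -(y₁ + 1) := fun n => by
    simp only [hz]; linarith [(Nat.cast_nonneg n : (0 : ℝ) ≤ n)]
  have hdec : Filter.Tendsto (fun n : ℕ => Real.exp (-(ν * (y₁ + 1 + (n : ℝ))))) Filter.atTop
      (nhds 0) :=
    Real.tendsto_exp_neg_atTop_nhds_zero.comp (Filter.Tendsto.const_mul_atTop hν
      (Filter.tendsto_atTop_add_const_left _ _ tendsto_natCast_atTop_atTop))
  have hcauchy : CauchySeq fun n => g (z n) := by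
    refine cauchySeq_of_le_tendsto_0
      (fun n : ℕ => 2 * L * Real.exp (-(ν * (y₁ + 1 + (n : ℝ))))) (fun n m N hn hm => ?_) ?_
    · rw [dist_eq_norm]
      refine (hdiff _ _ (hz1 n) (hz2 n) (hz1 m) (hz2 m)).trans ?_
      have hn' : (N : ℝ) ≤ n := by exact_mod_cast hn
      have hm' : (N : ℝ) ≤ m := by exact_mod_cast hm
      simp only [hz, neg_neg]
      have a1 : Real.exp (-(ν * (y₁ + 1 + (n : ℝ)))) ≤ Real.exp (-(ν * (y₁ + 1 + (N : ℝ)))) := by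
        gcongr
      have a2 : Real.exp (-(ν * (y₁ + 1 + (m : ℝ)))) ≤ Real.exp (-(ν * (y₁ + 1 + (N : ℝ)))) := by
        gcongr
      nlinarith
    · simpa using hdec.const_mul (2 * L)
  obtain ⟨c, hc⟩ := cauchySeq_tendsto_of_complete hcauchy
  refine ⟨c, L, fun τ h1 h2 => ?_⟩
  have hl1 : Filter.Tendsto (fun n => ‖g τ - g (z n)‖) Filter.atTop (nhds ‖g τ - c‖) :=
    (tendsto_const_nhds.sub hc).norm
  have hl2 : Filter.Tendsto (fun n : ℕ => L * Real.exp (-(ν * -τ.im))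
      + L * Real.exp (-(ν * (y₁ + 1 + (n : ℝ))))) Filter.atTop
      (nhds (L * Real.exp (-(ν * -τ.im)) + L * 0)) :=
    tendsto_const_nhds.add (hdec.const_mul L)
  rw [mul_zero, add_zero] at hl2
  refine le_of_tendsto_of_tendsto' hl1 hl2 fun n => ?_
  have := hdiff τ (z n) h1 h2 (hz1 n) (hz2 n)
  simpa [hz] using this

/-! ### The domains -/

theorem mem_DMinus_iff {A δ : ℝ} (hδ : 0 < δ) (hδ' : δ < Real.pi / 2) {z : ℂ} :
    z ∈ DMinus A δ ↔ (z.re + A) * Real.sin δ ≤ |z.im| * Real.cos δ := by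
  set w := z + A with hw
  have hre : z.re + A = w.re := by simp [hw]
  have him : z.im = w.im := by simp [hw]
  have hpi := Real.pi_pos
  rw [DMinus, Set.mem_ofPred_eq, hre, him, ← hw]
  by_cases h0 : w = 0
  · simp [h0]
  have hn : 0 < ‖w‖ := norm_pos_iff.2 h0
  have e1 : |w.im| = ‖w‖ * Real.sin |arg w| := by
    rw [← norm_mul_sin_arg w, abs_mul, abs_norm]
    congr 1
    rcases le_total 0 (arg w) with h | h
    · rw [abs_of_nonneg h, abs_of_nonneg (Real.sin_nonneg_of_nonneg_of_le_pi h (arg_le_pi w))]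
    · rw [abs_of_nonpos h, Real.sin_neg, abs_of_nonpos]
      exact Real.sin_nonpos_of_nonpos_of_neg_pi_le h (neg_pi_lt_arg w).le
  have e2 : w.re = ‖w‖ * Real.cos |arg w| := by rw [Real.cos_abs, norm_mul_cos_arg]
  have e3 : w.re * Real.sin δ ≤ |w.im| * Real.cos δ ↔ Real.sin (δ - |arg w|) ≤ 0 := by
    rw [e1, e2, Real.sin_sub]
    constructor
    · intro h
      by_contra h2
      nlinarith
    · intro h
      nlinarith
  rw [e3]
  have h1 := abs_arg_le_pi w
  have h2 := abs_nonneg (arg w)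
  constructor
  · rintro (h | h)
    · exact absurd h h0
    · exact Real.sin_nonpos_of_nonpos_of_neg_pi_le (by linarith) (by linarith)
  · intro h
    right
    by_contra h3
    exact absurd (Real.sin_pos_of_pos_of_lt_pi (by linarith) (by linarith)) (not_lt.2 h)

theorem mem_DPlus_iff {A δ : ℝ} (hδ : 0 < δ) (hδ' : δ < Real.pi / 2) {z : ℂ} :
    z ∈ DPlus A δ ↔ (A - z.re) * Real.sin δ ≤ |z.im| * Real.cos δ := by
  rw [DPlus, Set.mem_ofPred_eq, mem_DMinus_iff hδ hδ']
  simp only [neg_re, neg_im, conj_re, conj_im, neg_neg]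
  rw [show -z.re + A = A - z.re by ring]

theorem mem_DLower_iff {A δ : ℝ} (hδ : 0 < δ) (hδ' : δ < Real.pi / 2) {z : ℂ} :
    z ∈ DLower A δ ↔ (|z.re| + A) * Real.sin δ ≤ -z.im * Real.cos δ ∧ z.im < 0 := by
  have hs : 0 < Real.sin δ := Real.sin_pos_of_pos_of_lt_pi hδ (by linarith [Real.pi_pos])
  rw [DLower, Set.mem_inter_iff, Set.mem_inter_iff, mem_DPlus_iff hδ hδ', mem_DMinus_iff hδ hδ',
    Set.mem_ofPred_eq]
  constructor
  · rintro ⟨⟨h1, h2⟩, h3⟩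
    rw [abs_of_neg h3] at h1 h2
    refine ⟨?_, h3⟩
    rcases abs_cases z.re with ⟨h, -⟩ | ⟨h, -⟩ <;> rw [h]
    · exact h2
    · linarith
  · rintro ⟨h1, h3⟩
    rw [abs_of_neg h3]
    have h4 := mul_le_mul_of_nonneg_right (le_abs_self z.re) hs.le
    have h5 := mul_le_mul_of_nonneg_right (neg_le_abs z.re) hs.le
    exact ⟨⟨by linarith, by linarith⟩, h3⟩

theorem DLower_subset_DMinus (A δ : ℝ) : DLower A δ ⊆ DMinus A δ := fun _ h => h.1.2

theorem DLower_subset_DPlus (A δ : ℝ) : DLower A δ ⊆ DPlus A δ := fun _ h => h.1.1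

theorem abs_mul_sin_add_abs_mul_cos_le (δ : ℝ) (w : ℂ) :
    |w.re| * Real.sin δ + |w.im| * Real.cos δ ≤ ‖w‖ := by
  have h1 : ‖w‖ ^ 2 = |w.re| ^ 2 + |w.im| ^ 2 := by
    rw [← normSq_eq_norm_sq, normSq_apply, sq_abs, sq_abs]; ring
  refine le_of_sq_le_sq ?_ (norm_nonneg w)
  rw [h1]
  nlinarith [Real.sin_sq_add_cos_sq δ, sq_nonneg (|w.re| * Real.cos δ - |w.im| * Real.sin δ)]

section Domain

variable {A δ : ℝ}

theorem norm_ge_of_mem_DMinus (hδ : 0 < δ) (hδ' : δ < Real.pi / 2) {z : ℂ} (hz : z ∈ DMinus A δ) :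
    A * Real.sin δ ≤ ‖z‖ := by
  have hs : 0 < Real.sin δ := Real.sin_pos_of_pos_of_lt_pi hδ (by linarith [Real.pi_pos])
  have h1 := (mem_DMinus_iff hδ hδ').1 hz
  have h2 := abs_mul_sin_add_abs_mul_cos_le δ z
  have h3 := mul_le_mul_of_nonneg_right (neg_le_abs z.re) hs.le
  linarith

theorem norm_ge_of_mem_DPlus (hδ : 0 < δ) (hδ' : δ < Real.pi / 2) {z : ℂ} (hz : z ∈ DPlus A δ) :
    A * Real.sin δ ≤ ‖z‖ := by
  have h := norm_ge_of_mem_DMinus hδ hδ' (z := -(starRingEnd ℂ) z) hz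
  rwa [norm_neg, RCLike.norm_conj] at h

theorem sub_mem_DMinus (hδ : 0 < δ) (hδ' : δ < Real.pi / 2) {z : ℂ} (hz : z ∈ DMinus A δ) {x : ℝ}
    (hx : 0 ≤ x) : z - x ∈ DMinus A δ := by
  have hs : 0 < Real.sin δ := Real.sin_pos_of_pos_of_lt_pi hδ (by linarith [Real.pi_pos])
  rw [mem_DMinus_iff hδ hδ'] at hz ⊢
  simp only [sub_re, ofReal_re, sub_im, ofReal_im, sub_zero]
  nlinarith

theorem add_mem_DPlus (hδ : 0 < δ) (hδ' : δ < Real.pi / 2) {z : ℂ} (hz : z ∈ DPlus A δ) {x : ℝ}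
    (hx : 0 ≤ x) : z + x ∈ DPlus A δ := by
  have hs : 0 < Real.sin δ := Real.sin_pos_of_pos_of_lt_pi hδ (by linarith [Real.pi_pos])
  rw [mem_DPlus_iff hδ hδ'] at hz ⊢
  simp only [add_re, ofReal_re, add_im, ofReal_im, add_zero]
  nlinarith

theorem DMinus_subset {A' δ' : ℝ} (hA : A ≤ A') (hδ : 0 < δ) (hδδ : δ ≤ δ')
    (hδ' : δ' < Real.pi / 2) : DMinus A' δ' ⊆ DMinus A δ := by
  intro z hz
  rw [mem_DMinus_iff (by linarith) hδ'] at hz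
  rw [mem_DMinus_iff hδ (by linarith)]
  have hpi := Real.pi_pos
  have hs : 0 < Real.sin δ := Real.sin_pos_of_pos_of_lt_pi hδ (by linarith)
  have hs' : 0 < Real.sin δ' := Real.sin_pos_of_pos_of_lt_pi (by linarith) (by linarith)
  have h1 : 0 ≤ Real.sin (δ' - δ) :=
    Real.sin_nonneg_of_nonneg_of_le_pi (by linarith) (by linarith)
  rw [Real.sin_sub] at h1
  have h2 := mul_nonneg (abs_nonneg z.im) h1
  have h3 := mul_le_mul_of_nonneg_right hz hs.le
  have h4 : (z.re + A) * Real.sin δ * Real.sin δ' ≤ |z.im| * Real.cos δ * Real.sin δ' := by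
    nlinarith [mul_nonneg (sub_nonneg.2 hA) (mul_pos hs hs').le]
  exact le_of_mul_le_mul_right h4 hs'

theorem DPlus_subset {A' δ' : ℝ} (hA : A ≤ A') (hδ : 0 < δ) (hδδ : δ ≤ δ')
    (hδ' : δ' < Real.pi / 2) : DPlus A' δ' ⊆ DPlus A δ := fun _ hz =>
  DMinus_subset hA hδ hδδ hδ' hz

theorem DLower_subset {A' δ' : ℝ} (hA : A ≤ A') (hδ : 0 < δ) (hδδ : δ ≤ δ')
    (hδ' : δ' < Real.pi / 2) : DLower A' δ' ⊆ DLower A δ := fun _ hz =>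
  ⟨⟨DPlus_subset hA hδ hδδ hδ' hz.1.1, DMinus_subset hA hδ hδδ hδ' hz.1.2⟩, hz.2⟩

/-- Shifting by `-1` moves `D^-` into its interior, at a distance at least `sin δ` from the
boundary. -/
theorem ball_sub_one_subset (hδ : 0 < δ) (hδ' : δ < Real.pi / 2) {z : ℂ} (hz : z ∈ DMinus A δ) :
    Metric.ball (z - 1) (Real.sin δ) ⊆ interior (DMinus A δ) := by
  have hs : 0 < Real.sin δ := Real.sin_pos_of_pos_of_lt_pi hδ (by linarith [Real.pi_pos])
  have hc : 0 < Real.cos δ := Real.cos_pos_of_mem_Ioo ⟨by linarith, hδ'⟩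
  refine interior_maximal (fun w hw => ?_) Metric.isOpen_ball
  rw [mem_DMinus_iff hδ hδ'] at hz ⊢
  rw [Metric.mem_ball, dist_eq] at hw
  have h1 := abs_mul_sin_add_abs_mul_cos_le δ (w - (z - 1))
  have h2 := mul_le_mul_of_nonneg_right (le_abs_self (w - (z - 1)).re) hs.le
  have h3 : |z.im| ≤ |w.im| + |(w - (z - 1)).im| := by
    have h4 : z.im = w.im - (w - (z - 1)).im := by simp
    rw [h4]; exact abs_sub _ _
  have h5 := mul_le_mul_of_nonneg_right h3 hc.le
  simp only [sub_re, one_re] at h2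
  simp only [sub_re, one_re] at h1
  nlinarith

theorem sub_one_mem_interior (hδ : 0 < δ) (hδ' : δ < Real.pi / 2) {z : ℂ} (hz : z ∈ DMinus A δ) :
    z - 1 ∈ interior (DMinus A δ) :=
  ball_sub_one_subset hδ hδ' hz (Metric.mem_ball_self
    (Real.sin_pos_of_pos_of_lt_pi hδ (by linarith [Real.pi_pos])))

theorem sub_one_mem_DMinus (hδ : 0 < δ) (hδ' : δ < Real.pi / 2) {z : ℂ} (hz : z ∈ DMinus A δ) :
    z - 1 ∈ DMinus A δ := interior_subset (sub_one_mem_interior hδ hδ' hz)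

theorem uniqueDiffWithinAt_DMinus (hδ : 0 < δ) (hδ' : δ < Real.pi / 2) {z : ℂ}
    (hz : z ∈ DMinus A δ) : UniqueDiffWithinAt ℂ (DMinus A δ) z := by
  rw [uniqueDiffWithinAt_iff_accPt, accPt_iff_nhds]
  intro U hU
  obtain ⟨r, hr, hrU⟩ := Metric.mem_nhds_iff.1 hU
  refine ⟨z - (r / 2 : ℝ), ⟨hrU ?_, sub_mem_DMinus hδ hδ' hz (by positivity)⟩, ?_⟩
  · rw [Metric.mem_ball, dist_eq, sub_sub_cancel_left, norm_neg, norm_real,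
      Real.norm_of_nonneg (by positivity)]
    linarith
  · intro h
    have h2 : ((r / 2 : ℝ) : ℂ) = 0 := by simpa using h
    rw [ofReal_eq_zero] at h2
    linarith

end Domain

/-! ### Uniqueness of the separatrices -/

/-- A weak form of `IsSeparatrix` without the exponent `ε`: the corrections `ξ`, `η` are bounded and
tend to zero at infinity. -/
structure IsDecayingSolution (D : Set ℂ) (a₂ : ℂ) (ξ η : ℂ → ℂ) : Prop where
  bounded : ∃ K : ℝ, ∀ z ∈ D, ‖ξ z‖ ≤ K ∧ ‖η z‖ ≤ K
  decay : ∀ ε : ℝ, 0 < ε → ∃ R : ℝ, ∀ z ∈ D, R ≤ ‖z‖ → ‖ξ z‖ ≤ ε ∧ ‖η z‖ ≤ ε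
  invariant : ∀ τ ∈ D, τ + 1 ∈ D → F0 (sepCurve a₂ ξ η τ) = sepCurve a₂ ξ η (τ + 1)

theorem IsDecayingSolution.mono {D D' : Set ℂ} {a₂ : ℂ} {ξ η : ℂ → ℂ}
    (h : IsDecayingSolution D a₂ ξ η) (hD : D' ⊆ D) : IsDecayingSolution D' a₂ ξ η where
  bounded := h.bounded.imp fun _ hK z hz => hK z (hD hz)
  decay := fun ε hε => (h.decay ε hε).imp fun _ hR z hz => hR z (hD hz)
  invariant := fun τ h1 h2 => h.invariant τ (hD h1) (hD h2)

theorem MemX.exists_bound {D : Set ℂ} {μ : ℝ} {f : ℂ → ℂ} (h : MemX D μ f) :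
    ∃ K : ℝ, 0 ≤ K ∧ ∀ z ∈ D, z ≠ 0 → ‖f z‖ ≤ K / ‖z‖ ^ μ := by
  obtain ⟨K, hK⟩ := h.2.2
  refine ⟨max K 0, le_max_right _ _, fun z hz hz0 => ?_⟩
  have hp : 0 < ‖z‖ ^ μ := Real.rpow_pos_of_pos (norm_pos_iff.2 hz0) _
  rw [le_div_iff₀ hp, mul_comm]
  exact (hK ⟨z, hz, rfl⟩).trans (le_max_left _ _)

theorem IsSeparatrix.isDecayingSolution {D : Set ℂ} {ε : ℝ} {a₂ : ℂ} {ξ η : ℂ → ℂ}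
    (h : IsSeparatrix D ε a₂ ξ η) (hε : ε < 1) {r : ℝ} (hr : 0 < r) (hD : ∀ z ∈ D, r ≤ ‖z‖) :
    IsDecayingSolution D a₂ ξ η := by
  obtain ⟨K₁, h10, h1⟩ := h.1.exists_bound
  obtain ⟨K₂, h20, h2⟩ := h.2.1.exists_bound
  have hne : ∀ z ∈ D, z ≠ 0 := fun z hz => norm_pos_iff.1 (hr.trans_le (hD z hz))
  set K := max K₁ K₂ with hK
  have hK0 : 0 ≤ K := h10.trans (le_max_left _ _)
  have hb : ∀ z ∈ D, ‖ξ z‖ ≤ K / ‖z‖ ^ (1 - ε) ∧ ‖η z‖ ≤ K / ‖z‖ ^ (1 - ε) := fun z hz =>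
    ⟨(h1 z hz (hne z hz)).trans (by gcongr; exact le_max_left _ _),
      (h2 z hz (hne z hz)).trans (by gcongr; exact le_max_right _ _)⟩
  refine ⟨⟨K / r ^ (1 - ε), fun z hz => ?_⟩, fun ε' hε' => ?_, h.2.2⟩
  · have h3 : K / ‖z‖ ^ (1 - ε) ≤ K / r ^ (1 - ε) := by
      have := hD z hz
      gcongr
    exact ⟨(hb z hz).1.trans h3, (hb z hz).2.trans h3⟩
  · obtain ⟨R, hR⟩ := Filter.eventually_atTop.1
      ((tendsto_rpow_atTop (by linarith : 0 < 1 - ε)).eventually_ge_atTop (K / ε'))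
    refine ⟨R, fun z hz hz' => ?_⟩
    have hp : 0 < ‖z‖ ^ (1 - ε) := Real.rpow_pos_of_pos (norm_pos_iff.2 (hne z hz)) _
    have h3 : K / ‖z‖ ^ (1 - ε) ≤ ε' := by
      rw [div_le_iff₀ hp]
      have := hR ‖z‖ hz'
      rw [div_le_iff₀ hε'] at this
      linarith
    exact ⟨(hb z hz).1.trans h3, (hb z hz).2.trans h3⟩

/-- The difference of two curves of the form `sepCurve`. -/
def curveDiff (a₂ : ℂ) (ξ₁ η₁ ξ₂ η₂ : ℂ → ℂ) (τ : ℂ) : ℂ × ℂ :=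
  sepCurve a₂ ξ₂ η₂ τ - sepCurve a₂ ξ₁ η₁ τ

theorem curveDiff_fst (a₂ : ℂ) (ξ₁ η₁ ξ₂ η₂ : ℂ → ℂ) (τ : ℂ) :
    (curveDiff a₂ ξ₁ η₁ ξ₂ η₂ τ).1 = (ξ₂ τ - ξ₁ τ) / τ ^ 2 := by
  simp only [curveDiff, sepCurve, Prod.fst_sub]; ring

theorem curveDiff_snd (a₂ : ℂ) (ξ₁ η₁ ξ₂ η₂ : ℂ → ℂ) (τ : ℂ) :
    (curveDiff a₂ ξ₁ η₁ ξ₂ η₂ τ).2 = (η₂ τ - η₁ τ) / τ ^ 3 := by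
  simp only [curveDiff, sepCurve, Prod.snd_sub]; ring

theorem sq_mul_modeSize_curveDiff_le (a₂ : ℂ) (ξ₁ η₁ ξ₂ η₂ : ℂ → ℂ) {τ : ℂ} (hτ : τ ≠ 0) :
    ‖τ‖ ^ 2 * modeSize τ (curveDiff a₂ ξ₁ η₁ ξ₂ η₂ τ)
      ≤ 2 * (‖ξ₂ τ - ξ₁ τ‖ + ‖η₂ τ - η₁ τ‖) := by
  have hp : 0 < ‖τ‖ := norm_pos_iff.2 hτ
  have h := modeSize_le τ (curveDiff a₂ ξ₁ η₁ ξ₂ η₂ τ)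
  rw [curveDiff_fst, curveDiff_snd] at h
  calc _ ≤ ‖τ‖ ^ 2 * (2 * (‖(ξ₂ τ - ξ₁ τ) / τ ^ 2‖ + ‖τ * ((η₂ τ - η₁ τ) / τ ^ 3)‖)) := by
        gcongr
    _ = _ := by
        simp only [norm_mul, norm_div, norm_pow]
        field_simp

section TwoSolutions

variable {D : Set ℂ} {a₂ : ℂ} {ξ₁ η₁ ξ₂ η₂ : ℂ → ℂ}

theorem IsDecayingSolution.exists_curveDiff_step (h₁ : IsDecayingSolution D a₂ ξ₁ η₁)
    (h₂ : IsDecayingSolution D a₂ ξ₂ η₂) :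
    ∃ C : ℝ, 0 ≤ C ∧ ∀ τ ∈ D, τ + 1 ∈ D → 1 ≤ ‖τ‖ →
      ‖modeA (τ + 1) (curveDiff a₂ ξ₁ η₁ ξ₂ η₂ (τ + 1))
        - (1 + 3 * τ⁻¹) * modeA τ (curveDiff a₂ ξ₁ η₁ ξ₂ η₂ τ)‖
          ≤ C / ‖τ‖ ^ 2 * modeSize τ (curveDiff a₂ ξ₁ η₁ ξ₂ η₂ τ) ∧
      ‖modeB (τ + 1) (curveDiff a₂ ξ₁ η₁ ξ₂ η₂ (τ + 1))
        - (1 - 2 * τ⁻¹) * modeB τ (curveDiff a₂ ξ₁ η₁ ξ₂ η₂ τ)‖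
          ≤ C / ‖τ‖ ^ 2 * modeSize τ (curveDiff a₂ ξ₁ η₁ ξ₂ η₂ τ) := by
  obtain ⟨K₁, hK₁⟩ := h₁.bounded
  obtain ⟨K₂, hK₂⟩ := h₂.bounded
  set N := max K₁ K₂ + ‖a₂‖ + ‖(-2 * I - 2) * a₂ + 1 / 2‖ with hN
  obtain ⟨C, hC, H⟩ := exists_mode_step N
  refine ⟨C, hC, fun τ hτ hτ1 h1 => ?_⟩
  have hτ0 : τ ≠ 0 := norm_pos_iff.1 (by linarith)
  have hx : ∀ z : ℂ, ‖z‖ ≤ max K₁ K₂ → ‖a₂ + z‖ ≤ N ∧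
      ‖((-2 * I - 2) * a₂ + 1 / 2) + z‖ ≤ N := by
    intro z hz
    have n1 := norm_nonneg a₂
    have n2 := norm_nonneg ((-2 * I - 2) * a₂ + 1 / 2)
    exact ⟨(norm_add_le _ _).trans (by linarith), (norm_add_le _ _).trans (by linarith)⟩
  have := H τ (a₂ + ξ₁ τ) (((-2 * I - 2) * a₂ + 1 / 2) + η₁ τ) (a₂ + ξ₂ τ)
    (((-2 * I - 2) * a₂ + 1 / 2) + η₂ τ) h1
    (hx _ ((hK₁ τ hτ).1.trans (le_max_left _ _))).1
    (hx _ ((hK₁ τ hτ).2.trans (le_max_left _ _))).2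
    (hx _ ((hK₂ τ hτ).1.trans (le_max_right _ _))).1
    (hx _ ((hK₂ τ hτ).2.trans (le_max_right _ _))).2
  rw [← sepCurve_eq_curvePoint a₂ ξ₁ η₁ hτ0, ← sepCurve_eq_curvePoint a₂ ξ₂ η₂ hτ0,
    h₁.invariant τ hτ hτ1, h₂.invariant τ hτ hτ1] at this
  exact this

theorem IsDecayingSolution.decay_curveDiff (h₁ : IsDecayingSolution D a₂ ξ₁ η₁)
    (h₂ : IsDecayingSolution D a₂ ξ₂ η₂) {ε : ℝ} (hε : 0 < ε) :
    ∃ R : ℝ, 1 ≤ R ∧ ∀ τ ∈ D, R ≤ ‖τ‖ →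
      ‖τ‖ ^ 2 * modeSize τ (curveDiff a₂ ξ₁ η₁ ξ₂ η₂ τ) ≤ ε := by
  obtain ⟨R₁, hR₁⟩ := h₁.decay (ε / 8) (by positivity)
  obtain ⟨R₂, hR₂⟩ := h₂.decay (ε / 8) (by positivity)
  refine ⟨max 1 (max R₁ R₂), le_max_left _ _, fun τ hτ h => ?_⟩
  have h1 : 1 ≤ ‖τ‖ := (le_max_left _ _).trans h
  have h2 := hR₁ τ hτ (((le_max_left _ _).trans (le_max_right _ _)).trans h)
  have h3 := hR₂ τ hτ (((le_max_right _ _).trans (le_max_right _ _)).trans h)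
  refine (sq_mul_modeSize_curveDiff_le a₂ ξ₁ η₁ ξ₂ η₂ (norm_pos_iff.1 (by linarith))).trans ?_
  have h4 := norm_sub_le (ξ₂ τ) (ξ₁ τ)
  have h5 := norm_sub_le (η₂ τ) (η₁ τ)
  linarith

end TwoSolutions

theorem weighted_sum_le {C p t α β x y : ℝ} (ht : t = α + β) (hα : 0 ≤ α * p) (hβ : 0 ≤ β * p)
    (h : 0 ≤ C * p * t) (hx : x ≤ 4 * C * p * t + (1 + 23 * p) * α)
    (hy : y ≤ 4 * C * p * t + (1 + 5 * p) * β) : x + y ≤ (1 + (46 + 16 * C) * p) * t := by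
  subst ht
  linarith

theorem le_weighted_sum {C p t α β x y : ℝ} (ht : t = α + β) (hp : 0 ≤ p) (hC : 0 ≤ C) (ht0 : 0 ≤ t)
    (hβ : 0 ≤ β * p) (hCp : (10 + 8 * C) * p ≤ 1 / 2)
    (hx : (1 - 10 * p) * α - 4 * C * p * t ≤ x) (hy : (1 - 5 * p) * β - 4 * C * p * t ≤ y) :
    t ≤ (1 + (46 + 16 * C) * p) * (x + y) := by
  have h7 : t - (10 + 8 * C) * p * t ≤ x + y := by subst ht; linarith
  have h9 := mul_le_mul_of_nonneg_right hCp ht0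
  have h10 : t ≤ 2 * (x + y) := by linarith
  have h11 := mul_le_mul_of_nonneg_left h10 (by positivity : 0 ≤ (10 + 8 * C) * p)
  have h12 : 0 ≤ p * (x + y) := mul_nonneg hp (by linarith)
  linarith

/-- Weighted with `|s|²`, the modes expand under a step away from infinity by at most a factor
`1 + O(s⁻²)`: in the left half plane for a step to the right, in the right half plane for a step to
the left. -/
theorem weighted_modes_step {a b a' b' s : ℂ} {C : ℝ} (hC : 0 ≤ C) (hs : 46 + 16 * C ≤ ‖s‖)
    (hA : ‖a' - (1 + 3 * s⁻¹) * a‖ ≤ C / ‖s‖ ^ 2 * (‖a‖ + ‖b‖))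
    (hB : ‖b' - (1 - 2 * s⁻¹) * b‖ ≤ C / ‖s‖ ^ 2 * (‖a‖ + ‖b‖)) :
    (s.re ≤ 0 → ‖s + 1‖ ^ 2 * (‖a'‖ + ‖b'‖)
      ≤ (1 + (46 + 16 * C) / ‖s‖ ^ 2) * (‖s‖ ^ 2 * (‖a‖ + ‖b‖))) ∧
    (0 ≤ s.re → ‖s‖ ^ 2 * (‖a‖ + ‖b‖)
      ≤ (1 + (46 + 16 * C) / ‖s‖ ^ 2) * (‖s + 1‖ ^ 2 * (‖a'‖ + ‖b'‖))) := by
  have hs0 : 0 < ‖s‖ := by linarith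
  have hsn : s ≠ 0 := norm_pos_iff.1 hs0
  obtain ⟨-, h1⟩ := norm_shift_bounds (s := s) (by linarith)
  set w := s⁻¹ with hw
  have hsw : s * w = 1 := mul_inv_cancel₀ hsn
  have hwn : ‖w‖ = 1 / ‖s‖ := by rw [hw, norm_inv, one_div]
  have hw1 : ‖w‖ ≤ 1 := by rw [hwn, div_le_one hs0]; linarith
  set p := ‖w‖ ^ 2 with hp
  have hp' : p = 1 / ‖s‖ ^ 2 := by rw [hp, hwn, div_pow, one_pow]
  have hps : p * ‖s‖ ^ 2 = 1 := by rw [hp']; field_simp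
  have hp0 : 0 ≤ p := by positivity
  set t := ‖s‖ ^ 2 * (‖a‖ + ‖b‖) with ht
  have ht0 : 0 ≤ t := by positivity
  -- The exact parts of the two equations, multiplied by `(s + 1)²`.
  have eA : (s + 1) ^ 2 * ((1 + 3 * w) * a)
      = (1 + 5 * w + (7 + 3 * w) * w ^ 2) * (s ^ 2 * a) := by
    rw [hw]; field_simp; ring
  have eB : (s + 1) ^ 2 * ((1 - 2 * w) * b) = (1 - (3 + 2 * w) * w ^ 2) * (s ^ 2 * b) := by
    rw [hw]; field_simp; ring
  have small : ∀ c d : ℂ, ‖(c + d * w) * w ^ 2‖ ≤ (‖c‖ + ‖d‖) * p := by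
    intro c d
    rw [norm_mul, norm_pow]
    have h2 := norm_add_le c (d * w)
    rw [norm_mul] at h2
    have h3 := mul_le_of_le_one_right (norm_nonneg d) hw1
    gcongr
    linarith
  have s7 := small 7 3
  have s3 := small 3 2
  norm_num at s7 s3
  have err : ∀ x : ℂ, ‖x‖ ≤ C / ‖s‖ ^ 2 * (‖a‖ + ‖b‖) → ‖(s + 1) ^ 2 * x‖ ≤ 4 * C * p * t := by
    intro x hx
    rw [norm_mul, norm_pow]
    calc _ ≤ (2 * ‖s‖) ^ 2 * (C / ‖s‖ ^ 2 * (‖a‖ + ‖b‖)) := by gcongr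
      _ = 4 * C * (p * ‖s‖ ^ 2) * (‖a‖ + ‖b‖) := by rw [hp']; field_simp; ring
      _ = _ := by rw [ht]; ring
  have errA := err _ hA
  have errB := err _ hB
  have dA : (s + 1) ^ 2 * a' = (s + 1) ^ 2 * (a' - (1 + 3 * w) * a)
      + (1 + 5 * w + (7 + 3 * w) * w ^ 2) * (s ^ 2 * a) := by rw [← eA]; ring
  have dB : (s + 1) ^ 2 * b' = (s + 1) ^ 2 * (b' - (1 - 2 * w) * b)
      + (1 - (3 + 2 * w) * w ^ 2) * (s ^ 2 * b) := by rw [← eB]; ring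
  have nA : ‖s + 1‖ ^ 2 * ‖a'‖ = ‖(s + 1) ^ 2 * a'‖ := by rw [norm_mul, norm_pow]
  have nB : ‖s + 1‖ ^ 2 * ‖b'‖ = ‖(s + 1) ^ 2 * b'‖ := by rw [norm_mul, norm_pow]
  have mA : ‖s ^ 2 * a‖ = ‖s‖ ^ 2 * ‖a‖ := by rw [norm_mul, norm_pow]
  have mB : ‖s ^ 2 * b‖ = ‖s‖ ^ 2 * ‖b‖ := by rw [norm_mul, norm_pow]
  set α := ‖s‖ ^ 2 * ‖a‖ with hα
  set β := ‖s‖ ^ 2 * ‖b‖ with hβ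
  have hα0 : 0 ≤ α := by positivity
  have hβ0 : 0 ≤ β := by positivity
  have htαβ : t = α + β := by rw [ht, hα, hβ]; ring
  have hκ : (46 + 16 * C) / ‖s‖ ^ 2 = (46 + 16 * C) * p := by rw [hp']; ring
  have hre : w.re = s.re * p := by
    rw [hw, inv_re, hp', normSq_eq_norm_sq]; ring
  have hsq : ‖1 + 5 * w‖ ^ 2 = 1 + 10 * w.re + 25 * p := by
    rw [hp, ← normSq_eq_norm_sq, ← normSq_eq_norm_sq, normSq_apply, normSq_apply]
    simp
    ring
  have hαp := mul_nonneg hα0 hp0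
  have hβp := mul_nonneg hβ0 hp0
  have hCtp : 0 ≤ C * p * t := by positivity
  have nAB : ‖s + 1‖ ^ 2 * (‖a'‖ + ‖b'‖) = ‖(s + 1) ^ 2 * a'‖ + ‖(s + 1) ^ 2 * b'‖ := by
    rw [mul_add, nA, nB]
  rw [hκ, nAB]
  constructor
  · intro hs'
    have h2 : ‖1 + 5 * w‖ ≤ 1 + 13 * p := by
      refine le_of_sq_le_sq ?_ (by positivity)
      have : w.re ≤ 0 := by rw [hre]; exact mul_nonpos_of_nonpos_of_nonneg hs' hp0
      rw [hsq]; nlinarith only [this, hp0, sq_nonneg p]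
    have h3 : ‖1 + 5 * w + (7 + 3 * w) * w ^ 2‖ ≤ 1 + 23 * p := by
      refine (norm_add_le _ _).trans ?_
      rw [norm_mul, norm_pow]; linarith only [h2, s7]
    have h4 : ‖1 - (3 + 2 * w) * w ^ 2‖ ≤ 1 + 5 * p := by
      refine (norm_sub_le _ _).trans ?_
      rw [norm_one, norm_mul, norm_pow]; linarith only [s3]
    have h5 : ‖(s + 1) ^ 2 * a'‖ ≤ 4 * C * p * t + (1 + 23 * p) * α := by
      rw [dA]
      refine (norm_add_le _ _).trans (add_le_add errA ?_)
      rw [norm_mul, mA]; gcongr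
    have h6 : ‖(s + 1) ^ 2 * b'‖ ≤ 4 * C * p * t + (1 + 5 * p) * β := by
      rw [dB]
      refine (norm_add_le _ _).trans (add_le_add errB ?_)
      rw [norm_mul, mB]; gcongr
    exact weighted_sum_le htαβ hαp hβp hCtp h5 h6
  · intro hs'
    have h2 : 1 ≤ ‖1 + 5 * w‖ := by
      refine le_of_sq_le_sq ?_ (norm_nonneg _)
      have : 0 ≤ w.re := by rw [hre]; exact mul_nonneg hs' hp0
      rw [hsq]; linarith only [this, hp0]
    have h3 : 1 - 10 * p ≤ ‖1 + 5 * w + (7 + 3 * w) * w ^ 2‖ := by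
      have := norm_sub_norm_le (1 + 5 * w) (-((7 + 3 * w) * w ^ 2))
      rw [norm_neg, sub_neg_eq_add, norm_mul, norm_pow] at this
      linarith only [this, h2, s7]
    have h4 : 1 - 5 * p ≤ ‖1 - (3 + 2 * w) * w ^ 2‖ := by
      have := norm_sub_norm_le 1 ((3 + 2 * w) * w ^ 2)
      rw [norm_one, norm_mul, norm_pow] at this
      linarith only [this, s3]
    have h5 : (1 - 10 * p) * α - 4 * C * p * t ≤ ‖(s + 1) ^ 2 * a'‖ := by
      have h6 := norm_sub_norm_le ((1 + 5 * w + (7 + 3 * w) * w ^ 2) * (s ^ 2 * a))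
        (-((s + 1) ^ 2 * (a' - (1 + 3 * w) * a)))
      rw [sub_neg_eq_add, norm_neg, add_comm _ ((s + 1) ^ 2 * _), ← dA, norm_mul _ (s ^ 2 * a), mA]
        at h6
      have h7 := mul_le_mul_of_nonneg_right h3 hα0
      linarith only [h6, h7, errA]
    have h6 : (1 - 5 * p) * β - 4 * C * p * t ≤ ‖(s + 1) ^ 2 * b'‖ := by
      have h6 := norm_sub_norm_le ((1 - (3 + 2 * w) * w ^ 2) * (s ^ 2 * b))
        (-((s + 1) ^ 2 * (b' - (1 - 2 * w) * b)))
      rw [sub_neg_eq_add, norm_neg, add_comm _ ((s + 1) ^ 2 * _), ← dB, norm_mul _ (s ^ 2 * b), mB]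
        at h6
      have h7 := mul_le_mul_of_nonneg_right h4 hβ0
      linarith only [h6, h7, errB]
    have h8 : (10 + 8 * C) * p ≤ 1 / 2 := by
      rw [hp', mul_one_div, div_le_iff₀ (by positivity)]
      have := le_self_pow₀ (by linarith : 1 ≤ ‖s‖) (two_ne_zero)
      linarith only [this, hs]
    exact le_weighted_sum htαβ hp0 hC ht0 hβp h8 h5 h6

/-- A nonnegative null sequence with `T n ≤ (1 + κ/(n+1)²) T (n+1)` vanishes, because the infinite
product of the factors converges. -/
theorem eq_zero_of_le_mul_succ {T : ℕ → ℝ} {κ : ℝ} (hκ : 0 ≤ κ) (hT : ∀ n, 0 ≤ T n)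
    (h : ∀ n, T n ≤ (1 + κ / ((n : ℝ) + 1) ^ 2) * T (n + 1))
    (h0 : Filter.Tendsto T Filter.atTop (nhds 0)) : T 0 = 0 := by
  have hsum : Summable fun n : ℕ => κ / ((n : ℝ) + 1) ^ 2 := by
    have h1 : Summable fun n : ℕ => 1 / ((n : ℝ)) ^ 2 :=
      Real.summable_one_div_nat_pow.2 (by norm_num)
    have h2 := ((summable_nat_add_iff 1).2 h1).mul_left κ
    refine h2.congr fun n => ?_
    push_cast; ring
  set S := ∑' n : ℕ, κ / ((n : ℝ) + 1) ^ 2 with hS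
  have hind : ∀ n, T 0 ≤ Real.exp (∑ j ∈ Finset.range n, κ / ((j : ℝ) + 1) ^ 2) * T n := by
    intro n
    induction n with
    | zero => simp
    | succ n ih =>
      refine ih.trans ?_
      rw [Finset.sum_range_succ, Real.exp_add, mul_assoc]
      refine mul_le_mul_of_nonneg_left ((h n).trans ?_) (Real.exp_pos _).le
      refine mul_le_mul_of_nonneg_right ?_ (hT _)
      rw [add_comm]; exact Real.add_one_le_exp _
  have hbound : ∀ n, T 0 ≤ Real.exp S * T n := fun n => (hind n).trans
    (mul_le_mul_of_nonneg_right (Real.exp_le_exp.2 (hsum.sum_le_tsum _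
      fun j _ => by positivity)) (hT n))
  have hlim := h0.const_mul (Real.exp S)
  rw [mul_zero] at hlim
  exact le_antisymm (ge_of_tendsto' hlim hbound) (hT 0)

section Uniqueness

variable {A δ : ℝ} {a₂ : ℂ} {ξ₁ η₁ ξ₂ η₂ : ℂ → ℂ}

/-- The unstable separatrix is unique. Along a backward orbit far to the left the weighted
difference of two solutions tends to zero, while its growth in all forward steps together is bounded
by a convergent product; so it vanishes there, and hence on all forward orbits. -/
theorem sepCurve_eq_of_DMinus (hδ : 0 < δ) (hδ' : δ < Real.pi / 2)
    (h₁ : IsDecayingSolution (DMinus A δ) a₂ ξ₁ η₁)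
    (h₂ : IsDecayingSolution (DMinus A δ) a₂ ξ₂ η₂) :
    ∀ τ ∈ DMinus A δ, sepCurve a₂ ξ₁ η₁ τ = sepCurve a₂ ξ₂ η₂ τ := by
  obtain ⟨C, hC, hstep⟩ := h₁.exists_curveDiff_step h₂
  set R := 46 + 16 * C with hR
  have far : ∀ τ ∈ DMinus A δ, τ.re ≤ -R → sepCurve a₂ ξ₁ η₁ τ = sepCurve a₂ ξ₂ η₂ τ := by
    intro τ hτ hτR
    set z : ℕ → ℂ := fun n => τ - (n : ℝ) with hz
    have hzD : ∀ n, z n ∈ DMinus A δ := fun n => sub_mem_DMinus hδ hδ' hτ (Nat.cast_nonneg n)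
    have hzre : ∀ n, (z n).re = τ.re - n := fun n => by simp [hz]
    have hznorm : ∀ n, R + n ≤ ‖z n‖ := fun n => by
      have := (neg_le_abs (z n).re).trans (abs_re_le_norm (z n))
      rw [hzre] at this; linarith
    have hzs : ∀ n, z (n + 1) + 1 = z n := fun n => by simp [hz]; ring
    have hn0 : ∀ n : ℕ, (0 : ℝ) ≤ n := fun n => Nat.cast_nonneg n
    set T : ℕ → ℝ := fun n => ‖z n‖ ^ 2 * modeSize (z n) (curveDiff a₂ ξ₁ η₁ ξ₂ η₂ (z n)) with hT
    have hT0 : T 0 = 0 := by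
      refine eq_zero_of_le_mul_succ (κ := 46 + 16 * C) (by positivity)
        (fun n => mul_nonneg (by positivity) (modeSize_nonneg _ _)) (fun n => ?_) ?_
      · have hb : R ≤ ‖z (n + 1)‖ := by have := hznorm (n + 1); have := hn0 (n + 1); linarith
        obtain ⟨sA, sB⟩ := hstep (z (n + 1)) (hzD _) (by rw [hzs]; exact hzD n) (by linarith)
        rw [hzs] at sA sB
        have := (weighted_modes_step hC hb sA sB).1 (by
          rw [hzre]; have := hn0 (n + 1); linarith)
        rw [hzs] at this
        refine this.trans (mul_le_mul_of_nonneg_right ?_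
          (mul_nonneg (by positivity) (modeSize_nonneg _ _)))
        have h3 := hznorm (n + 1)
        push_cast at h3
        have := hn0 n
        gcongr
        linarith
      · rw [Metric.tendsto_atTop]
        intro ε hε
        obtain ⟨R', -, hR'⟩ := h₁.decay_curveDiff h₂ (half_pos hε)
        obtain ⟨N, hN⟩ := exists_nat_ge R'
        refine ⟨N, fun n hn => ?_⟩
        have hn' : (N : ℝ) ≤ n := by exact_mod_cast hn
        rw [Real.dist_0_eq_abs, abs_of_nonneg (mul_nonneg (by positivity) (modeSize_nonneg _ _))]
        have := hR' (z n) (hzD n) (by linarith [hznorm n])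
        linarith
    have hτ0 : z 0 = τ := by simp [hz]
    have hpos : 0 < ‖τ‖ := by have := hznorm 0; rw [hτ0] at this; norm_num at this; linarith
    have hm : modeSize τ (curveDiff a₂ ξ₁ η₁ ξ₂ η₂ τ) = 0 := by
      simp only [hT, hτ0] at hT0
      exact (mul_eq_zero.1 hT0).resolve_left (by positivity)
    have := eq_zero_of_modeSize_eq_zero (norm_pos_iff.1 hpos) hm
    exact (sub_eq_zero.1 this).symm
  have all : ∀ n : ℕ, ∀ τ ∈ DMinus A δ, τ.re - n ≤ -R →
      sepCurve a₂ ξ₁ η₁ τ = sepCurve a₂ ξ₂ η₂ τ := by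
    intro n
    induction n with
    | zero => intro τ hτ h; exact far τ hτ (by simpa using h)
    | succ n ih =>
      intro τ hτ h
      have hm := sub_one_mem_DMinus hδ hδ' hτ
      have h3 := ih (τ - 1) hm (by
        rw [sub_re, one_re]; push_cast at h; linarith)
      have e1 := h₁.invariant (τ - 1) hm (by rwa [sub_add_cancel])
      have e2 := h₂.invariant (τ - 1) hm (by rwa [sub_add_cancel])
      rw [sub_add_cancel] at e1 e2
      rw [← e1, ← e2, h3]
  intro τ hτ
  obtain ⟨n, hn⟩ := exists_nat_ge (τ.re + R)
  exact all n τ hτ (by linarith)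

/-- The stable separatrix is unique: the argument is that for the unstable one with the direction of
time reversed, and `F0` is injective. -/
theorem sepCurve_eq_of_DPlus (hδ : 0 < δ) (hδ' : δ < Real.pi / 2)
    (h₁ : IsDecayingSolution (DPlus A δ) a₂ ξ₁ η₁)
    (h₂ : IsDecayingSolution (DPlus A δ) a₂ ξ₂ η₂) :
    ∀ τ ∈ DPlus A δ, sepCurve a₂ ξ₁ η₁ τ = sepCurve a₂ ξ₂ η₂ τ := by
  obtain ⟨C, hC, hstep⟩ := h₁.exists_curveDiff_step h₂
  set R := 46 + 16 * C with hR
  have far : ∀ τ ∈ DPlus A δ, R ≤ τ.re → sepCurve a₂ ξ₁ η₁ τ = sepCurve a₂ ξ₂ η₂ τ := by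
    intro τ hτ hτR
    set z : ℕ → ℂ := fun n => τ + (n : ℝ) with hz
    have hzD : ∀ n, z n ∈ DPlus A δ := fun n => add_mem_DPlus hδ hδ' hτ (Nat.cast_nonneg n)
    have hzre : ∀ n, (z n).re = τ.re + n := fun n => by simp [hz]
    have hznorm : ∀ n, R + n ≤ ‖z n‖ := fun n => by
      have := (le_abs_self (z n).re).trans (abs_re_le_norm (z n))
      rw [hzre] at this; linarith
    have hzs : ∀ n, z n + 1 = z (n + 1) := fun n => by simp [hz]; ring
    have hn0 : ∀ n : ℕ, (0 : ℝ) ≤ n := fun n => Nat.cast_nonneg n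
    set T : ℕ → ℝ := fun n => ‖z n‖ ^ 2 * modeSize (z n) (curveDiff a₂ ξ₁ η₁ ξ₂ η₂ (z n)) with hT
    have hT0 : T 0 = 0 := by
      refine eq_zero_of_le_mul_succ (κ := 46 + 16 * C) (by positivity)
        (fun n => mul_nonneg (by positivity) (modeSize_nonneg _ _)) (fun n => ?_) ?_
      · have hb : R ≤ ‖z n‖ := by have := hznorm n; have := hn0 n; linarith
        obtain ⟨sA, sB⟩ := hstep (z n) (hzD _) (by rw [hzs]; exact hzD _) (by linarith)
        rw [hzs] at sA sB
        have := (weighted_modes_step hC hb sA sB).2 (by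
          rw [hzre]; have := hn0 n; linarith)
        rw [hzs] at this
        refine this.trans (mul_le_mul_of_nonneg_right ?_
          (mul_nonneg (by positivity) (modeSize_nonneg _ _)))
        have h3 := hznorm n
        have := hn0 n
        gcongr
        linarith
      · rw [Metric.tendsto_atTop]
        intro ε hε
        obtain ⟨R', -, hR'⟩ := h₁.decay_curveDiff h₂ (half_pos hε)
        obtain ⟨N, hN⟩ := exists_nat_ge R'
        refine ⟨N, fun n hn => ?_⟩
        have hn' : (N : ℝ) ≤ n := by exact_mod_cast hn
        rw [Real.dist_0_eq_abs, abs_of_nonneg (mul_nonneg (by positivity) (modeSize_nonneg _ _))]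
        have := hR' (z n) (hzD n) (by linarith [hznorm n])
        linarith
    have hτ0 : z 0 = τ := by simp [hz]
    have hpos : 0 < ‖τ‖ := by have := hznorm 0; rw [hτ0] at this; norm_num at this; linarith
    have hm : modeSize τ (curveDiff a₂ ξ₁ η₁ ξ₂ η₂ τ) = 0 := by
      simp only [hT, hτ0] at hT0
      exact (mul_eq_zero.1 hT0).resolve_left (by positivity)
    have := eq_zero_of_modeSize_eq_zero (norm_pos_iff.1 hpos) hm
    exact (sub_eq_zero.1 this).symm
  have all : ∀ n : ℕ, ∀ τ ∈ DPlus A δ, R ≤ τ.re + n →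
      sepCurve a₂ ξ₁ η₁ τ = sepCurve a₂ ξ₂ η₂ τ := by
    intro n
    induction n with
    | zero => intro τ hτ h; exact far τ hτ (by simpa using h)
    | succ n ih =>
      intro τ hτ h
      have hm : τ + 1 ∈ DPlus A δ := by simpa using add_mem_DPlus hδ hδ' hτ zero_le_one
      have h3 := ih (τ + 1) hm (by
        rw [add_re, one_re]; push_cast at h; linarith)
      have e1 := h₁.invariant τ hτ hm
      have e2 := h₂.invariant τ hτ hm
      exact F0_injective (by rw [e1, e2, h3])
  intro τ hτ
  obtain ⟨n, hn⟩ := exists_nat_ge (R - τ.re)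
  exact all n τ hτ (by linarith)

end Uniqueness

/-! ### The tangent vector of the unstable separatrix -/

theorem hasDerivWithinAt_F0_comp {γ : ℂ → ℂ × ℂ} {v : ℂ × ℂ} {s : Set ℂ} {τ : ℂ}
    (h : HasDerivWithinAt γ v s τ) :
    HasDerivWithinAt (fun z => F0 (γ z)) (F0deriv (γ τ) v) s τ := by
  have hx : HasDerivWithinAt (fun z => (γ z).1) v.1 s τ :=
    (ContinuousLinearMap.fst ℂ ℂ ℂ).hasFDerivAt.comp_hasDerivWithinAt τ h
  have hy : HasDerivWithinAt (fun z => (γ z).2) v.2 s τ :=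
    (ContinuousLinearMap.snd ℂ ℂ ℂ).hasFDerivAt.comp_hasDerivWithinAt τ h
  refine HasDerivWithinAt.prodMk ?_ ?_
  · refine ((((((((hx.add hy).add ((hx.pow 2).const_mul 2)).sub ((hx.const_mul 2).mul hy)).sub
      ((hy.pow 2).const_mul (1 / 2))).sub ((hx.pow 3).const_mul 8)).sub
      (((hx.pow 2).const_mul 4).mul hy)).sub ((hx.pow 4).const_mul 8))).congr_deriv ?_
    simp only [Pi.pow_apply]
    push_cast
    ring
  · refine (((((hy.sub ((hx.const_mul 4).mul hy)).sub (hy.pow 2)).sub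
      ((hx.pow 3).const_mul 16)).sub (((hx.pow 2).const_mul 8).mul hy)).sub
      ((hx.pow 4).const_mul 16)).congr_deriv ?_
    simp only [Pi.pow_apply]
    push_cast
    ring

/-- The tangent vector of a curve, its derivative within the domain `D`. -/
def tangent (D : Set ℂ) (α : ℂ → ℂ × ℂ) (τ : ℂ) : ℂ × ℂ :=
  (derivWithin (fun s => (α s).1) D τ, derivWithin (fun s => (α s).2) D τ)

theorem normalSplitting_eq_area (D : Set ℂ) (αm αp : ℂ → ℂ × ℂ) (τ : ℂ) :
    normalSplitting D αm αp τ = area (tangent D αm τ) (αp τ - αm τ) := by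
  simp only [normalSplitting, Matrix.det_fin_two_of, area, tangent, Prod.fst_sub, Prod.snd_sub]

theorem tangent_eq_of_hasDerivWithinAt {D : Set ℂ} {α : ℂ → ℂ × ℂ} {τ : ℂ} {v : ℂ × ℂ}
    (hD : UniqueDiffWithinAt ℂ D τ) (h : HasDerivWithinAt α v D τ) : tangent D α τ = v := by
  have hx : HasDerivWithinAt (fun z => (α z).1) v.1 D τ :=
    (ContinuousLinearMap.fst ℂ ℂ ℂ).hasFDerivAt.comp_hasDerivWithinAt τ h
  have hy : HasDerivWithinAt (fun z => (α z).2) v.2 D τ :=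
    (ContinuousLinearMap.snd ℂ ℂ ℂ).hasFDerivAt.comp_hasDerivWithinAt τ h
  rw [tangent, hx.derivWithin hD, hy.derivWithin hD]

section Tangent

variable {A δ : ℝ} {α : ℂ → ℂ × ℂ}

/-- An invariant curve on `D^-` is differentiable up to the boundary, because its value at `τ` is
the image of its value at the interior point `τ - 1`. -/
theorem hasDerivWithinAt_of_invariant (hδ : 0 < δ) (hδ' : δ < Real.pi / 2)
    (hd : DifferentiableOn ℂ α (interior (DMinus A δ)))
    (hinv : ∀ τ ∈ DMinus A δ, τ + 1 ∈ DMinus A δ → F0 (α τ) = α (τ + 1)) {τ : ℂ}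
    (hτ : τ ∈ DMinus A δ) :
    HasDerivWithinAt α (F0deriv (α (τ - 1)) (deriv α (τ - 1))) (DMinus A δ) τ := by
  have h1 : HasDerivAt α (deriv α (τ - 1)) (τ - 1) :=
    (hd.differentiableAt (isOpen_interior.mem_nhds
      (sub_one_mem_interior hδ hδ' hτ))).hasDerivAt
  have h2 : HasDerivWithinAt (fun z => F0 (α (z - 1))) (F0deriv (α (τ - 1)) (deriv α (τ - 1)))
      (DMinus A δ) τ := hasDerivWithinAt_F0_comp (h1.comp_sub_const τ 1).hasDerivWithinAt
  have h3 : ∀ z ∈ DMinus A δ, α z = F0 (α (z - 1)) := fun z hz => by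
    rw [hinv (z - 1) (sub_one_mem_DMinus hδ hδ' hz) (by rwa [sub_add_cancel]), sub_add_cancel]
  exact h2.congr h3 (h3 τ hτ)

theorem tangent_eq (hδ : 0 < δ) (hδ' : δ < Real.pi / 2)
    (hd : DifferentiableOn ℂ α (interior (DMinus A δ)))
    (hinv : ∀ τ ∈ DMinus A δ, τ + 1 ∈ DMinus A δ → F0 (α τ) = α (τ + 1)) {τ : ℂ}
    (hτ : τ ∈ DMinus A δ) :
    tangent (DMinus A δ) α τ = F0deriv (α (τ - 1)) (deriv α (τ - 1)) :=
  tangent_eq_of_hasDerivWithinAt (uniqueDiffWithinAt_DMinus hδ hδ' hτ)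
    (hasDerivWithinAt_of_invariant hδ hδ' hd hinv hτ)

/-- The tangent vectors of an invariant curve are mapped to each other by the derivative. -/
theorem tangent_add_one (hδ : 0 < δ) (hδ' : δ < Real.pi / 2)
    (hd : DifferentiableOn ℂ α (interior (DMinus A δ)))
    (hinv : ∀ τ ∈ DMinus A δ, τ + 1 ∈ DMinus A δ → F0 (α τ) = α (τ + 1)) {τ : ℂ}
    (hτ : τ ∈ DMinus A δ) (hτ1 : τ + 1 ∈ DMinus A δ) :
    tangent (DMinus A δ) α (τ + 1) = F0deriv (α τ) (tangent (DMinus A δ) α τ) := by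
  have hint : τ ∈ interior (DMinus A δ) := by
    have := sub_one_mem_interior hδ hδ' hτ1
    rwa [add_sub_cancel_right] at this
  have h1 : HasDerivAt α (deriv α τ) τ :=
    (hd.differentiableAt (isOpen_interior.mem_nhds hint)).hasDerivAt
  rw [tangent_eq hδ hδ' hd hinv hτ1, add_sub_cancel_right,
    tangent_eq_of_hasDerivWithinAt (uniqueDiffWithinAt_DMinus hδ hδ' hτ) h1.hasDerivWithinAt]

theorem differentiableOn_tangent (hδ : 0 < δ) (hδ' : δ < Real.pi / 2)
    (hd : DifferentiableOn ℂ α (interior (DMinus A δ)))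
    (hinv : ∀ τ ∈ DMinus A δ, τ + 1 ∈ DMinus A δ → F0 (α τ) = α (τ + 1)) :
    DifferentiableOn ℂ (tangent (DMinus A δ) α) (DMinus A δ) := by
  have h1 : ∀ τ ∈ DMinus A δ, DifferentiableAt ℂ (fun z => α (z - 1)) τ := fun τ hτ =>
    (hd.differentiableAt (isOpen_interior.mem_nhds
      (sub_one_mem_interior hδ hδ' hτ))).comp τ (differentiableAt_id.sub_const 1)
  have h2 : ∀ τ ∈ DMinus A δ, DifferentiableAt ℂ (fun z => deriv α (z - 1)) τ := fun τ hτ =>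
    ((hd.deriv isOpen_interior).differentiableAt (isOpen_interior.mem_nhds
      (sub_one_mem_interior hδ hδ' hτ))).comp τ (differentiableAt_id.sub_const 1)
  have h3 : DifferentiableOn ℂ (fun τ => F0deriv (α (τ - 1)) (deriv α (τ - 1))) (DMinus A δ) := by
    intro τ hτ
    have a1 := (h1 τ hτ).fst
    have a2 := (h1 τ hτ).snd
    have a3 := (h2 τ hτ).fst
    have a4 := (h2 τ hτ).snd
    refine DifferentiableAt.differentiableWithinAt ?_
    unfold F0deriv
    exact DifferentiableAt.prodMk (by fun_prop) (by fun_prop)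
  exact h3.congr fun τ hτ => tangent_eq hδ hδ' hd hinv hτ

/-- The tangent vector of a bounded invariant curve on `D^-` is bounded, by Cauchy's estimate at
`τ - 1`. -/
theorem exists_norm_tangent_le (hδ : 0 < δ) (hδ' : δ < Real.pi / 2)
    (hd : DifferentiableOn ℂ α (interior (DMinus A δ)))
    (hinv : ∀ τ ∈ DMinus A δ, τ + 1 ∈ DMinus A δ → F0 (α τ) = α (τ + 1)) {K : ℝ}
    (hK : ∀ τ ∈ DMinus A δ, ‖α τ‖ ≤ K) :
    ∃ K' : ℝ, 0 ≤ K' ∧ ∀ τ ∈ DMinus A δ, ‖tangent (DMinus A δ) α τ‖ ≤ K' := by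
  have hs : 0 < Real.sin δ := Real.sin_pos_of_pos_of_lt_pi hδ (by linarith [Real.pi_pos])
  set r := Real.sin δ / 2 with hr
  have hr0 : 0 < r := by positivity
  have hder : ∀ τ ∈ DMinus A δ, ‖deriv α (τ - 1)‖ ≤ K / r := by
    intro τ hτ
    have hsub : Metric.closedBall (τ - 1) r ⊆ interior (DMinus A δ) :=
      (Metric.closedBall_subset_ball (by rw [hr]; linarith)).trans
        (ball_sub_one_subset hδ hδ' hτ)
    refine norm_deriv_le_of_forall_mem_sphere_norm_le hr0 ?_ fun z hz =>
      hK z (interior_subset (hsub (Metric.sphere_subset_closedBall hz)))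
    exact (hd.mono hsub).diffContOnCl_ball subset_rfl
  have hcont : Continuous fun q : (ℂ × ℂ) × (ℂ × ℂ) => F0deriv q.1 q.2 := by
    unfold F0deriv; fun_prop
  obtain ⟨C, hC⟩ := (isCompact_closedBall (0 : (ℂ × ℂ) × (ℂ × ℂ))
    (max K (K / r))).exists_bound_of_continuousOn hcont.continuousOn
  refine ⟨max C 0, le_max_right _ _, fun τ hτ => ?_⟩
  rw [tangent_eq hδ hδ' hd hinv hτ]
  refine (hC (α (τ - 1), deriv α (τ - 1)) ?_).trans (le_max_left _ _)
  rw [Metric.mem_closedBall, dist_zero_right]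
  exact max_le ((hK _ (sub_one_mem_DMinus hδ hδ' hτ)).trans (le_max_left _ _))
    ((hder τ hτ).trans (le_max_right _ _))

end Tangent

/-! ### Horizontal propagation -/

section Horizontal

variable {A δ : ℝ}

theorem mem_interior_DLower (hδ : 0 < δ) (hδ' : δ < Real.pi / 2) {z : ℂ}
    (h : (|z.re| + A) * Real.sin δ < -z.im * Real.cos δ) (hz : z.im < 0) :
    z ∈ interior (DLower A δ) := by
  have hopen : IsOpen {z : ℂ | (|z.re| + A) * Real.sin δ < -z.im * Real.cos δ ∧ z.im < 0} :=
    (isOpen_lt (by fun_prop) (by fun_prop)).and (isOpen_lt (by fun_prop) (by fun_prop))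
  exact interior_maximal (fun w hw => (mem_DLower_iff hδ hδ').2 ⟨hw.1.le, hw.2⟩) hopen ⟨h, hz⟩

/-- Vertical half strips lie in `D` sufficiently far down. -/
theorem exists_strip_subset_interior_DLower (hδ : 0 < δ) (hδ' : δ < Real.pi / 2) :
    ∃ y₀ : ℝ, 1 ≤ y₀ ∧ ∀ z : ℂ, |z.re| ≤ 1 → z.im ≤ -y₀ → z ∈ interior (DLower A δ) := by
  have hs : 0 < Real.sin δ := Real.sin_pos_of_pos_of_lt_pi hδ (by linarith [Real.pi_pos])
  have hc : 0 < Real.cos δ := Real.cos_pos_of_mem_Ioo ⟨by linarith, hδ'⟩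
  refine ⟨max 1 ((|A| + 2) * Real.sin δ / Real.cos δ), le_max_left _ _, fun z hz hz' => ?_⟩
  have h1 : 1 ≤ -z.im := by linarith [le_max_left 1 ((|A| + 2) * Real.sin δ / Real.cos δ)]
  have h2 : (|A| + 2) * Real.sin δ / Real.cos δ ≤ -z.im := by
    linarith [le_max_right 1 ((|A| + 2) * Real.sin δ / Real.cos δ)]
  rw [div_le_iff₀ hc] at h2
  refine mem_interior_DLower hδ hδ' (lt_of_lt_of_le ?_ h2) (by linarith)
  have := le_abs_self A
  exact mul_lt_mul_of_pos_right (by linarith) hs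

/-- A quantity that is controlled in the central strip and changes by a bounded factor and a bounded
summand under unit horizontal shifts is controlled on the horizontal sections of `D`. -/
theorem horizontal_bound (hδ : 0 < δ) (hδ' : δ < Real.pi / 2) {φ : ℂ → ℝ} {y κ β ψ : ℝ}
    (hκ : 0 ≤ κ) (hβ : 0 ≤ β) (hψ : 0 ≤ ψ)
    (h0 : ∀ τ : ℂ, |τ.re| ≤ 1 / 2 → τ.im = -y → φ τ ≤ ψ)
    (hstep : ∀ τ : ℂ, τ ∈ DLower A δ → τ + 1 ∈ DLower A δ → τ.im = -y →
      φ (τ + 1) ≤ (1 + κ) * φ τ + β ∧ φ τ ≤ (1 + κ) * φ (τ + 1) + β) (n : ℕ) :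
    ∀ τ : ℂ, τ ∈ DLower A δ → τ.im = -y → |τ.re| ≤ n + 1 / 2 →
      φ τ ≤ (1 + κ) ^ n * (ψ + n * β) := by
  have hs : 0 < Real.sin δ := Real.sin_pos_of_pos_of_lt_pi hδ (by linarith [Real.pi_pos])
  have hmem : ∀ τ τ' : ℂ, τ ∈ DLower A δ → τ'.im = τ.im → |τ'.re| ≤ |τ.re| → τ' ∈ DLower A δ := by
    intro τ τ' h h1 h2
    rw [mem_DLower_iff hδ hδ'] at h ⊢
    rw [h1]
    exact ⟨le_trans (by gcongr) h.1, h.2⟩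
  induction n with
  | zero =>
    intro τ _ h1 h2
    simpa using h0 τ (by simpa using h2) h1
  | succ n ih =>
    intro τ hτ h1 h2
    have hn : (0 : ℝ) ≤ n := Nat.cast_nonneg n
    have hp : 1 ≤ (1 + κ) ^ (n + 1) := one_le_pow₀ (by linarith)
    have hfin : ∀ x : ℝ, x ≤ (1 + κ) ^ n * (ψ + n * β) →
        (1 + κ) * x + β ≤ (1 + κ) ^ (n + 1) * (ψ + (n + 1 : ℕ) * β) := by
      intro x hx
      calc (1 + κ) * x + β ≤ (1 + κ) * ((1 + κ) ^ n * (ψ + n * β)) + (1 + κ) ^ (n + 1) * β := by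
            refine add_le_add (by gcongr) (le_mul_of_one_le_left hβ hp)
        _ = _ := by push_cast; ring
    push_cast at h2
    by_cases hc : |τ.re| ≤ 1 / 2
    · calc φ τ ≤ ψ := h0 τ hc h1
        _ ≤ ψ + (n + 1 : ℕ) * β := le_add_of_nonneg_right (by positivity)
        _ ≤ _ := le_mul_of_one_le_left (by positivity) hp
    · rcases le_total 0 τ.re with hr | hr
      · rw [abs_of_nonneg hr] at hc h2
        have e1 : (τ - 1).re = τ.re - 1 := by simp
        have e2 : (τ - 1).im = τ.im := by simp
        have hm : τ - 1 ∈ DLower A δ := by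
          refine hmem τ _ hτ e2 ?_
          rw [e1, abs_of_nonneg hr, abs_le]; constructor <;> linarith
        have h3 := ih (τ - 1) hm (by rw [e2, h1]) (by
          rw [e1, abs_le]; constructor <;> linarith)
        have h4 := (hstep (τ - 1) hm (by rwa [sub_add_cancel]) (by rw [e2, h1])).1
        rw [sub_add_cancel] at h4
        exact h4.trans (hfin _ h3)
      · rw [abs_of_nonpos hr] at hc h2
        have e1 : (τ + 1).re = τ.re + 1 := by simp
        have e2 : (τ + 1).im = τ.im := by simp
        have hm : τ + 1 ∈ DLower A δ := by
          refine hmem τ _ hτ e2 ?_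
          rw [e1, abs_of_nonpos hr, abs_le]; constructor <;> linarith
        have h3 := ih (τ + 1) hm (by rw [e2, h1]) (by
          rw [e1, abs_le]; constructor <;> linarith)
        exact (hstep τ hτ hm h1).2.trans (hfin _ h3)

/-- The number of unit steps from the central strip to a point of `D` is at most proportional to its
depth. -/
theorem ceil_abs_re_le (hA : 0 < A) (hδ : 0 < δ) (hδ' : δ < Real.pi / 2) {τ : ℂ}
    (hτ : τ ∈ DLower A δ) :
    |τ.re| ≤ Real.cos δ / Real.sin δ * -τ.im ∧
      (⌈|τ.re|⌉₊ : ℝ) ≤ Real.cos δ / Real.sin δ * -τ.im + 1 := by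
  have hs : 0 < Real.sin δ := Real.sin_pos_of_pos_of_lt_pi hδ (by linarith [Real.pi_pos])
  have h1 := ((mem_DLower_iff hδ hδ').1 hτ).1
  have h2 : |τ.re| ≤ Real.cos δ / Real.sin δ * -τ.im := by
    rw [div_mul_eq_mul_div, le_div_iff₀ hs]
    nlinarith
  exact ⟨h2, by linarith [Nat.ceil_lt_add_one (abs_nonneg τ.re)]⟩

end Horizontal

/-! ### The splitting of a pair of separatrices -/

section SepCurve

variable {D : Set ℂ} {a₂ : ℂ} {ξ η : ℂ → ℂ}

theorem differentiableOn_sepCurve (h0 : ∀ z ∈ D, z ≠ 0) (hξ : DifferentiableOn ℂ ξ D)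
    (hη : DifferentiableOn ℂ η D) : DifferentiableOn ℂ (sepCurve a₂ ξ η) D := by
  intro z hz
  have h1 := hξ z hz
  have h2 := hη z hz
  have h3 := h0 z hz
  unfold sepCurve
  refine DifferentiableWithinAt.prodMk ?_ ?_
  · exact DifferentiableWithinAt.add (DifferentiableWithinAt.div (by fun_prop) (by fun_prop) h3)
      (DifferentiableWithinAt.div (by fun_prop) (by fun_prop) (pow_ne_zero 2 h3))
  · exact DifferentiableWithinAt.add
      (DifferentiableWithinAt.div (by fun_prop) (by fun_prop) (pow_ne_zero 2 h3))
      (DifferentiableWithinAt.div (by fun_prop) (by fun_prop) (pow_ne_zero 3 h3))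

theorem continuousOn_sepCurve (h0 : ∀ z ∈ D, z ≠ 0) (hξ : ContinuousOn ξ D)
    (hη : ContinuousOn η D) : ContinuousOn (sepCurve a₂ ξ η) D := by
  intro z hz
  have h1 := hξ z hz
  have h2 := hη z hz
  have h3 := h0 z hz
  unfold sepCurve
  refine ContinuousWithinAt.prodMk ?_ ?_
  · exact ContinuousWithinAt.add (ContinuousWithinAt.div (by fun_prop) continuousWithinAt_id h3)
      (ContinuousWithinAt.div (by fun_prop) (by fun_prop) (pow_ne_zero 2 h3))
  · exact ContinuousWithinAt.add
      (ContinuousWithinAt.div (by fun_prop) (by fun_prop) (pow_ne_zero 2 h3))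
      (ContinuousWithinAt.div (by fun_prop) (by fun_prop) (pow_ne_zero 3 h3))

theorem IsDecayingSolution.exists_norm_sepCurve_le (h : IsDecayingSolution D a₂ ξ η) {r : ℝ}
    (hr : 0 < r) (hD : ∀ z ∈ D, r ≤ ‖z‖) : ∃ K : ℝ, ∀ z ∈ D, ‖sepCurve a₂ ξ η z‖ ≤ K := by
  obtain ⟨K, hK⟩ := h.bounded
  set b := (-2 * I - 2) * a₂ + 1 / 2 with hb
  refine ⟨max (‖I / 2‖ / r + (‖a₂‖ + K) / r ^ 2) (‖(1 - I) / 2‖ / r ^ 2 + (‖b‖ + K) / r ^ 3),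
    fun z hz => ?_⟩
  obtain ⟨h1, h2⟩ := hK z hz
  have h3 := hD z hz
  have hK0 : 0 ≤ K := (norm_nonneg _).trans h1
  refine max_le (le_max_of_le_left ?_) (le_max_of_le_right ?_)
  · refine (norm_add_le _ _).trans ?_
    rw [norm_div (I / 2), norm_div (a₂ + ξ z), norm_pow]
    have := norm_add_le a₂ (ξ z)
    gcongr
    linarith
  · refine (norm_add_le _ _).trans ?_
    rw [norm_div ((1 - I) / 2), norm_div (_ + η z), norm_pow, norm_pow, ← hb]
    have := norm_add_le b (η z)
    gcongr
    linarith

end SepCurve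

/-- A pair of separatrices, the unstable one on `D^-` and the stable one on `D^+`, with the
regularity used for the splitting. -/
structure IsSeparatrixPair (A δ : ℝ) (a₂ : ℂ) (ξm ηm ξp ηp : ℂ → ℂ) : Prop where
  A_pos : 0 < A
  δ_pos : 0 < δ
  δ_lt : δ < Real.pi / 2
  unstable : IsDecayingSolution (DMinus A δ) a₂ ξm ηm
  stable : IsDecayingSolution (DPlus A δ) a₂ ξp ηp
  unstable_diff : DifferentiableOn ℂ (sepCurve a₂ ξm ηm) (interior (DMinus A δ))
  stable_diff : DifferentiableOn ℂ (sepCurve a₂ ξp ηp) (interior (DPlus A δ))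
  stable_cont : ContinuousOn (sepCurve a₂ ξp ηp) (DPlus A δ)

theorem IsSeparatrix.isSeparatrixPair {A δ ε : ℝ} {a₂ : ℂ} {ξm ηm ξp ηp : ℂ → ℂ} (hA : 0 < A)
    (hδ : 0 < δ) (hδ' : δ < Real.pi / 2) (hε : ε < 1) (hm : IsSeparatrix (DMinus A δ) ε a₂ ξm ηm)
    (hp : IsSeparatrix (DPlus A δ) ε a₂ ξp ηp) : IsSeparatrixPair A δ a₂ ξm ηm ξp ηp := by
  have hr : 0 < A * Real.sin δ :=
    mul_pos hA (Real.sin_pos_of_pos_of_lt_pi hδ (by linarith [Real.pi_pos]))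
  have hm0 : ∀ z ∈ DMinus A δ, A * Real.sin δ ≤ ‖z‖ := fun z hz => norm_ge_of_mem_DMinus hδ hδ' hz
  have hp0 : ∀ z ∈ DPlus A δ, A * Real.sin δ ≤ ‖z‖ := fun z hz => norm_ge_of_mem_DPlus hδ hδ' hz
  have hm1 : ∀ z ∈ DMinus A δ, z ≠ 0 := fun z hz => norm_pos_iff.1 (hr.trans_le (hm0 z hz))
  have hp1 : ∀ z ∈ DPlus A δ, z ≠ 0 := fun z hz => norm_pos_iff.1 (hr.trans_le (hp0 z hz))
  exact ⟨hA, hδ, hδ', hm.isDecayingSolution hε hr hm0, hp.isDecayingSolution hε hr hp0,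
    differentiableOn_sepCurve (fun z hz => hm1 z (interior_subset hz)) hm.1.2.1 hm.2.1.2.1,
    differentiableOn_sepCurve (fun z hz => hp1 z (interior_subset hz)) hp.1.2.1 hp.2.1.2.1,
    continuousOn_sepCurve hp1 hp.1.1 hp.2.1.1⟩

namespace IsSeparatrixPair

variable {A δ : ℝ} {a₂ : ℂ} {ξm ηm ξp ηp : ℂ → ℂ}

theorem sin_pos (h : IsSeparatrixPair A δ a₂ ξm ηm ξp ηp) : 0 < Real.sin δ :=
  Real.sin_pos_of_pos_of_lt_pi h.δ_pos (by linarith [Real.pi_pos, h.δ_lt])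

theorem exists_norm_le (h : IsSeparatrixPair A δ a₂ ξm ηm ξp ηp) : ∃ K : ℝ,
    (∀ z ∈ DMinus A δ, ‖sepCurve a₂ ξm ηm z‖ ≤ K) ∧
    ∀ z ∈ DPlus A δ, ‖sepCurve a₂ ξp ηp z‖ ≤ K := by
  have hr := mul_pos h.A_pos h.sin_pos
  obtain ⟨K₁, h₁⟩ := h.unstable.exists_norm_sepCurve_le hr
    fun z hz => norm_ge_of_mem_DMinus h.δ_pos h.δ_lt hz
  obtain ⟨K₂, h₂⟩ := h.stable.exists_norm_sepCurve_le hr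
    fun z hz => norm_ge_of_mem_DPlus h.δ_pos h.δ_lt hz
  exact ⟨max K₁ K₂, fun z hz => (h₁ z hz).trans (le_max_left _ _),
    fun z hz => (h₂ z hz).trans (le_max_right _ _)⟩

theorem differentiableOn_curveDiff (h : IsSeparatrixPair A δ a₂ ξm ηm ξp ηp) :
    DifferentiableOn ℂ (curveDiff a₂ ξm ηm ξp ηp) (interior (DLower A δ)) :=
  (h.stable_diff.mono (interior_mono (DLower_subset_DPlus A δ))).sub
    (h.unstable_diff.mono (interior_mono (DLower_subset_DMinus A δ)))

theorem continuousOn_curveDiff (h : IsSeparatrixPair A δ a₂ ξm ηm ξp ηp) :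
    ContinuousOn (curveDiff a₂ ξm ηm ξp ηp) (DLower A δ) := by
  refine (h.stable_cont.mono (DLower_subset_DPlus A δ)).sub fun τ hτ => ?_
  exact (hasDerivWithinAt_of_invariant h.δ_pos h.δ_lt h.unstable_diff h.unstable.invariant
    (DLower_subset_DMinus A δ hτ)).continuousWithinAt.mono (DLower_subset_DMinus A δ)

theorem normalSplitting_eq (τ : ℂ) :
    normalSplitting (DMinus A δ) (sepCurve a₂ ξm ηm) (sepCurve a₂ ξp ηp) τ
      = area (tangent (DMinus A δ) (sepCurve a₂ ξm ηm) τ) (curveDiff a₂ ξm ηm ξp ηp τ) :=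
  normalSplitting_eq_area _ _ _ _

theorem differentiableOn_normalSplitting (h : IsSeparatrixPair A δ a₂ ξm ηm ξp ηp) :
    DifferentiableOn ℂ (normalSplitting (DMinus A δ) (sepCurve a₂ ξm ηm) (sepCurve a₂ ξp ηp))
      (interior (DLower A δ)) := by
  have h1 := (differentiableOn_tangent h.δ_pos h.δ_lt h.unstable_diff h.unstable.invariant).mono
    (interior_subset.trans (DLower_subset_DMinus A δ))
  have h2 := h.differentiableOn_curveDiff
  refine DifferentiableOn.congr ?_ fun τ _ => normalSplitting_eq τ
  have a1 := h1.fst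
  have a2 := h1.snd
  have a3 := h2.fst
  have a4 := h2.snd
  unfold area
  fun_prop

theorem continuousOn_normalSplitting (h : IsSeparatrixPair A δ a₂ ξm ηm ξp ηp) :
    ContinuousOn (normalSplitting (DMinus A δ) (sepCurve a₂ ξm ηm) (sepCurve a₂ ξp ηp))
      (DLower A δ) := by
  have h1 := (differentiableOn_tangent h.δ_pos h.δ_lt h.unstable_diff
    h.unstable.invariant).continuousOn.mono (DLower_subset_DMinus A δ)
  have h2 := h.continuousOn_curveDiff
  refine ContinuousOn.congr ?_ fun τ _ => normalSplitting_eq τ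
  exact (h1.fst.mul h2.snd).sub (h2.fst.mul h1.snd)

theorem exists_norm_normalSplitting_le (h : IsSeparatrixPair A δ a₂ ξm ηm ξp ηp) :
    ∃ C : ℝ, 0 ≤ C ∧ ∀ τ ∈ DLower A δ,
      ‖normalSplitting (DMinus A δ) (sepCurve a₂ ξm ηm) (sepCurve a₂ ξp ηp) τ‖
        ≤ C * ‖curveDiff a₂ ξm ηm ξp ηp τ‖ := by
  obtain ⟨K, hK, -⟩ := h.exists_norm_le
  obtain ⟨T, hT0, hT⟩ := exists_norm_tangent_le h.δ_pos h.δ_lt h.unstable_diff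
    h.unstable.invariant hK
  refine ⟨2 * T, by positivity, fun τ hτ => ?_⟩
  rw [normalSplitting_eq]
  refine (norm_area_le _ _).trans ?_
  have := hT τ (DLower_subset_DMinus A δ hτ)
  gcongr

/-- By area preservation the normal component of the splitting is one-periodic up to an error
quadratic in the splitting. -/
theorem exists_normalSplitting_step (h : IsSeparatrixPair A δ a₂ ξm ηm ξp ηp) :
    ∃ C : ℝ, 0 ≤ C ∧ ∀ τ ∈ DLower A δ, τ + 1 ∈ DLower A δ →
      ‖normalSplitting (DMinus A δ) (sepCurve a₂ ξm ηm) (sepCurve a₂ ξp ηp) (τ + 1)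
        - normalSplitting (DMinus A δ) (sepCurve a₂ ξm ηm) (sepCurve a₂ ξp ηp) τ‖
        ≤ C * ‖curveDiff a₂ ξm ηm ξp ηp τ‖ ^ 2 := by
  obtain ⟨K, hK, hK'⟩ := h.exists_norm_le
  obtain ⟨T, hT0, hT⟩ := exists_norm_tangent_le h.δ_pos h.δ_lt h.unstable_diff
    h.unstable.invariant hK
  obtain ⟨C, hC, hC'⟩ := exists_F0_taylor_bound K
  refine ⟨2 * T * C, by positivity, fun τ hτ hτ1 => ?_⟩
  have m := DLower_subset_DMinus A δ hτ
  have m1 := DLower_subset_DMinus A δ hτ1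
  have p := DLower_subset_DPlus A δ hτ
  have p1 := DLower_subset_DPlus A δ hτ1
  set P := sepCurve a₂ ξm ηm τ with hP
  set Q := sepCurve a₂ ξp ηp τ with hQ
  have e1 : curveDiff a₂ ξm ηm ξp ηp (τ + 1) = F0 Q - F0 P := by
    rw [curveDiff, ← h.stable.invariant τ p p1, ← h.unstable.invariant τ m m1]
  have e2 : curveDiff a₂ ξm ηm ξp ηp τ = Q - P := rfl
  have e3 := tangent_add_one h.δ_pos h.δ_lt h.unstable_diff h.unstable.invariant m m1
  rw [normalSplitting_eq, normalSplitting_eq, e1, e2]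
  rw [← area_F0deriv P (tangent (DMinus A δ) (sepCurve a₂ ξm ηm) τ) (Q - P), ← e3,
    ← area_sub_right]
  refine (norm_area_le _ _).trans ?_
  have h1 := hT (τ + 1) m1
  have h2 := hC' P Q (hK τ m) (hK' τ p)
  calc _ ≤ 2 * T * (C * ‖Q - P‖ ^ 2) := by gcongr
    _ = _ := by ring

/-- The splitting decays exponentially in `D`, with any rate below `2π`. -/
theorem exists_modeSize_curveDiff_le (h : IsSeparatrixPair A δ a₂ ξm ηm ξp ηp) {μ : ℝ}
    (hμ : 0 ≤ μ) (hμ2 : μ < 2 * Real.pi) :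
    ∃ K Y : ℝ, 0 ≤ K ∧ 1 ≤ Y ∧ (∀ τ : ℂ, |τ.re| ≤ 1 → τ.im ≤ -Y → τ ∈ interior (DLower A δ)) ∧
      ∀ τ ∈ DLower A δ, τ.im ≤ -Y →
        modeSize τ (curveDiff a₂ ξm ηm ξp ηp τ) ≤ K * Real.exp (μ * τ.im) := by
  have hm := h.unstable.mono (DLower_subset_DMinus A δ)
  have hp := h.stable.mono (DLower_subset_DPlus A δ)
  obtain ⟨C, hC, hstep⟩ := hm.exists_curveDiff_step hp
  obtain ⟨y₀, hy₀, hstrip⟩ := exists_strip_subset_interior_DLower (A := A) h.δ_pos h.δ_lt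
  have hnorm : ∀ τ : ℂ, τ.im ≤ 0 → -τ.im ≤ ‖τ‖ := fun τ hτ => by
    have := abs_im_le_norm τ
    rwa [abs_of_nonpos hτ] at this
  set a : ℂ → ℂ := fun τ => modeA τ (curveDiff a₂ ξm ηm ξp ηp τ) with ha
  set b : ℂ → ℂ := fun τ => modeB τ (curveDiff a₂ ξm ηm ξp ηp τ) with hb
  have hd := h.differentiableOn_curveDiff
  have d1 := hd.fst
  have d2 := hd.snd
  have da : DifferentiableOn ℂ a (interior (DLower A δ)) := by
    simp only [ha, modeA]
    fun_prop
  have db : DifferentiableOn ℂ b (interior (DLower A δ)) := by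
    simp only [hb, modeB]
    fun_prop
  have hmemstep : ∀ s : ℂ, -1 ≤ s.re → s.re ≤ 0 → s.im ≤ -y₀ →
      s ∈ DLower A δ ∧ s + 1 ∈ DLower A δ ∧ 1 ≤ ‖s‖ := by
    intro s h1 h2 h3
    refine ⟨interior_subset (hstrip s (by rw [abs_le]; constructor <;> linarith) h3),
      interior_subset (hstrip (s + 1) ?_ (by simpa using h3)), ?_⟩
    · rw [add_re, one_re, abs_le]; constructor <;> linarith
    · have := hnorm s (by linarith); linarith
  obtain ⟨K, Y, hKY⟩ := exists_exp_bound_of_mode_equations isOpen_interior da db hC hstrip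
    (fun s h1 h2 h3 => by
      obtain ⟨m1, m2, m3⟩ := hmemstep s h1 h2 h3
      exact (hstep s m1 m2 m3).1)
    (fun s h1 h2 h3 => by
      obtain ⟨m1, m2, m3⟩ := hmemstep s h1 h2 h3
      exact (hstep s m1 m2 m3).2)
    (fun ε hε => by
      obtain ⟨R, hR1, hR⟩ := hm.decay_curveDiff hp hε
      refine ⟨max R y₀, fun s h1 h2 => hR s (interior_subset (hstrip s h1 ?_)) ?_⟩
      · linarith [le_max_right R y₀]
      · have := hnorm s (by linarith [le_max_right R y₀])
        linarith [le_max_left R y₀]) hμ hμ2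
  set Y' := max (max 1 Y) (max y₀ (12 + 8 * C)) with hY'
  have b1 : 1 ≤ Y' := (le_max_left _ _).trans (le_max_left _ _)
  have b2 : Y ≤ Y' := (le_max_right _ _).trans (le_max_left _ _)
  have b3 : y₀ ≤ Y' := (le_max_left _ _).trans (le_max_right _ _)
  have b4 : 12 + 8 * C ≤ Y' := (le_max_right _ _).trans (le_max_right _ _)
  set c := Real.cos δ / Real.sin δ with hc
  have hc0 : 0 ≤ c := div_nonneg (Real.cos_nonneg_of_mem_Icc ⟨by linarith [h.δ_pos, Real.pi_pos],
    h.δ_lt.le⟩) h.sin_pos.le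
  refine ⟨max K 0 * Real.exp (2 * (3 + 2 * C) * (c + 1)), Y', by positivity, b1,
    fun τ h1 h2 => hstrip τ h1 (by linarith), fun τ hτ hτY => ?_⟩
  set y := -τ.im with hy
  have hy1 : 1 ≤ y := by linarith
  have hy0 : 0 < y := by linarith
  set κ := 2 * (3 + 2 * C) / y with hκ
  have hκ0 : 0 ≤ κ := by positivity
  -- A factor `1 + O(1/y)` per step, and `O(y)` steps.
  have hbd := horizontal_bound (A := A) h.δ_pos h.δ_lt
    (φ := fun z => modeSize z (curveDiff a₂ ξm ηm ξp ηp z)) (y := y) (β := 0)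
    (ψ := max K 0 * Real.exp (μ * τ.im)) hκ0 le_rfl (by positivity)
    (fun z hz hz' => by
      have h1 := hKY z hz (by rw [hz', hy]; linarith)
      rw [hz', hy, neg_neg] at h1
      exact h1.trans (by gcongr; exact le_max_left _ _))
    (fun z hz hz1 hz' => by
      have hzn : y ≤ ‖z‖ := by
        have := hnorm z (by rw [hz']; linarith)
        rwa [hz', neg_neg] at this
      obtain ⟨sA, sB⟩ := hstep z hz hz1 (by linarith)
      obtain ⟨-, s1, s2⟩ := modes_shift_le hC (by linarith) sA sB
      have q1 : (3 + 2 * C) / ‖z‖ ≤ κ := by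
        rw [hκ]
        gcongr
        linarith
      have q2 : 2 * (3 + 2 * C) / ‖z‖ ≤ κ := by rw [hκ]; gcongr
      rw [add_zero, add_zero]
      exact ⟨s1.trans (mul_le_mul_of_nonneg_right (by linarith) (modeSize_nonneg _ _)),
        s2.trans (mul_le_mul_of_nonneg_right (by linarith) (modeSize_nonneg _ _))⟩)
    ⌈|τ.re|⌉₊ τ hτ (by rw [hy, neg_neg]) (by linarith [Nat.le_ceil |τ.re|])
  rw [mul_zero, add_zero] at hbd
  refine hbd.trans ?_
  have hn := (ceil_abs_re_le h.A_pos h.δ_pos h.δ_lt hτ).2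
  rw [← hc, ← hy] at hn
  have hpow : (1 + κ) ^ ⌈|τ.re|⌉₊ ≤ Real.exp (2 * (3 + 2 * C) * (c + 1)) := by
    calc (1 + κ) ^ ⌈|τ.re|⌉₊ ≤ Real.exp κ ^ ⌈|τ.re|⌉₊ := by
          gcongr
          rw [add_comm]; exact Real.add_one_le_exp κ
      _ = Real.exp (⌈|τ.re|⌉₊ * κ) := by rw [← Real.exp_nat_mul]
      _ ≤ _ := by
          rw [Real.exp_le_exp]
          calc (⌈|τ.re|⌉₊ : ℝ) * κ ≤ (c * y + y) * κ := by gcongr; linarith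
            _ = 2 * (3 + 2 * C) * (c + 1) := by rw [hκ]; field_simp
  calc _ ≤ Real.exp (2 * (3 + 2 * C) * (c + 1)) * (max K 0 * Real.exp (μ * τ.im)) := by gcongr
    _ = _ := by ring

end IsSeparatrixPair

/-! ### The leading term -/

/-- `N(τ) = c e^{-2πiτ} + O(e^{-λ|Im τ|})` on `D_{A,δ}`, for every rate `λ < 4π`. -/
def HasLeadingTerm (A δ : ℝ) (N : ℂ → ℂ) (c : ℂ) : Prop :=
  ∀ l : ℝ, l < 4 * Real.pi → ∃ K : ℝ, 0 ≤ K ∧ ∀ τ ∈ DLower A δ,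
    ‖N τ - c * exp (-2 * Real.pi * I * τ)‖ ≤ K * Real.exp (l * τ.im)

theorem norm_exp_leading (τ : ℂ) :
    ‖exp (-2 * Real.pi * I * τ)‖ = Real.exp (2 * Real.pi * τ.im) := by
  rw [norm_exp]
  congr 1
  simp [mul_re, mul_im]

theorem norm_exp_leading_inv (τ : ℂ) :
    ‖exp (2 * Real.pi * I * τ)‖ = Real.exp (-(2 * Real.pi * τ.im)) := by
  rw [norm_exp]
  congr 1
  simp [mul_re, mul_im]

theorem eq_of_leadingTerm_bounds {A δ K₁ K₂ : ℝ} {N : ℂ → ℂ} {c₁ c₂ : ℂ} (hδ : 0 < δ)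
    (hδ' : δ < Real.pi / 2)
    (h₁ : ∀ τ ∈ interior (DLower A δ),
      ‖N τ - c₁ * exp (-2 * Real.pi * I * τ)‖ ≤ K₁ * Real.exp (3 * Real.pi * τ.im))
    (h₂ : ∀ τ ∈ interior (DLower A δ),
      ‖N τ - c₂ * exp (-2 * Real.pi * I * τ)‖ ≤ K₂ * Real.exp (3 * Real.pi * τ.im)) :
    c₁ = c₂ := by
  obtain ⟨y₀, -, hy₀⟩ := exists_strip_subset_interior_DLower (A := A) hδ hδ'
  have hlim : Filter.Tendsto (fun y : ℝ => (K₁ + K₂) * Real.exp (-(Real.pi * y))) Filter.atTop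
      (nhds ((K₁ + K₂) * 0)) :=
    (Real.tendsto_exp_neg_atTop_nhds_zero.comp
      (Filter.tendsto_id.const_mul_atTop Real.pi_pos)).const_mul _
  have hle : ∀ᶠ y : ℝ in Filter.atTop, ‖c₁ - c₂‖ ≤ (K₁ + K₂) * Real.exp (-(Real.pi * y)) := by
    filter_upwards [Filter.eventually_ge_atTop y₀] with y hy
    set τ : ℂ := ⟨0, -y⟩ with hτ
    have hτi : τ ∈ interior (DLower A δ) := hy₀ τ (by simp [hτ]) (by simp [hτ]; exact hy)
    have e1 := h₁ τ hτi
    have e2 := h₂ τ hτi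
    have him : τ.im = -y := rfl
    have e3 := norm_sub_le (N τ - c₂ * exp (-2 * Real.pi * I * τ))
      (N τ - c₁ * exp (-2 * Real.pi * I * τ))
    have e4 : N τ - c₂ * exp (-2 * Real.pi * I * τ) - (N τ - c₁ * exp (-2 * Real.pi * I * τ))
        = (c₁ - c₂) * exp (-2 * Real.pi * I * τ) := by ring
    rw [e4, norm_mul, norm_exp_leading, him] at e3
    rw [him] at e1 e2
    have e5 : Real.exp (3 * Real.pi * -y)
        = Real.exp (-(Real.pi * y)) * Real.exp (2 * Real.pi * -y) := by
      rw [← Real.exp_add]; congr 1; ring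
    rw [e5] at e1 e2
    refine le_of_mul_le_mul_right (e3.trans ?_) (Real.exp_pos (2 * Real.pi * -y))
    linarith
  have := ge_of_tendsto hlim hle
  rw [mul_zero] at this
  exact sub_eq_zero.1 (norm_le_zero_iff.1 this)

/-- The leading coefficient is determined by the values far down in any smaller domain. -/
theorem HasLeadingTerm.unique {A δ A₁ δ₁ A₂ δ₂ : ℝ} {N₁ N₂ : ℂ → ℂ} {c₁ c₂ : ℂ} (hδ : 0 < δ)
    (hδ' : δ < Real.pi / 2) (h₁ : HasLeadingTerm A₁ δ₁ N₁ c₁) (h₂ : HasLeadingTerm A₂ δ₂ N₂ c₂)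
    (s₁ : DLower A δ ⊆ DLower A₁ δ₁) (s₂ : DLower A δ ⊆ DLower A₂ δ₂)
    (hN : ∀ τ ∈ interior (DLower A δ), N₁ τ = N₂ τ) : c₁ = c₂ := by
  have hpi := Real.pi_pos
  obtain ⟨K₁, -, hK₁⟩ := h₁ (3 * Real.pi) (by linarith)
  obtain ⟨K₂, -, hK₂⟩ := h₂ (3 * Real.pi) (by linarith)
  exact eq_of_leadingTerm_bounds hδ hδ' (fun τ hτ => hK₁ τ (s₁ (interior_subset hτ)))
    (fun τ hτ => by rw [hN τ hτ]; exact hK₂ τ (s₂ (interior_subset hτ)))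

theorem mul_exp_le {d y : ℝ} (hd : 0 < d) : y * Real.exp (-(d * y)) ≤ 1 / d := by
  rw [le_div_iff₀ hd, Real.exp_neg]
  have h := Real.add_one_le_exp (d * y)
  have hp := Real.exp_pos (d * y)
  rw [show y * (Real.exp (d * y))⁻¹ * d = d * y / Real.exp (d * y) by ring, div_le_one hp]
  linarith

namespace IsSeparatrixPair

variable {A δ : ℝ} {a₂ : ℂ} {ξm ηm ξp ηp : ℂ → ℂ}

/-- For a fixed rate `l` below `4π`. The splitting decays with a rate `μ` above `l / 2`, hence the
normal component is one-periodic up to `O(e^{2μ Im τ})`, a smaller error than `e^{l Im τ}`. -/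
theorem exists_leadingTerm_of_rate (h : IsSeparatrixPair A δ a₂ ξm ηm ξp ηp) {l : ℝ}
    (hl : 2 * Real.pi < l) (hl' : l < 4 * Real.pi) :
    ∃ (c : ℂ) (K : ℝ), 0 ≤ K ∧ ∀ τ ∈ DLower A δ,
      ‖normalSplitting (DMinus A δ) (sepCurve a₂ ξm ηm) (sepCurve a₂ ξp ηp) τ
        - c * exp (-2 * Real.pi * I * τ)‖ ≤ K * Real.exp (l * τ.im) := by
  set N := normalSplitting (DMinus A δ) (sepCurve a₂ ξm ηm) (sepCurve a₂ ξp ηp) with hN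
  have hpi := Real.pi_pos
  -- A rate strictly between `l / 2` and `2π`.
  set μ := l / 4 + Real.pi with hμ
  obtain ⟨K, Y, hK, hY, hstrip, hdecay⟩ := h.exists_modeSize_curveDiff_le (μ := μ)
    (by linarith) (by linarith)
  obtain ⟨C₁, hC₁, hN₁⟩ := h.exists_norm_normalSplitting_le
  obtain ⟨C₂, hC₂, hN₂⟩ := h.exists_normalSplitting_step
  have hu : ∀ τ ∈ DLower A δ, τ.im ≤ -Y →
      ‖curveDiff a₂ ξm ηm ξp ηp τ‖ ≤ 5 * K * Real.exp (μ * τ.im) := by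
    intro τ hτ hτY
    have h1 : 1 ≤ ‖τ‖ := by
      have := abs_im_le_norm τ
      rw [abs_of_nonpos (by linarith)] at this
      linarith
    refine (norm_le_modeSize h1 _).trans ?_
    linarith [hdecay τ hτ hτY]
  set M := C₁ * (5 * K) + C₂ * (5 * K) ^ 2 with hM
  have hM0 : 0 ≤ M := by positivity
  have hNle : ∀ τ ∈ DLower A δ, τ.im ≤ -Y → ‖N τ‖ ≤ M * Real.exp (μ * τ.im) := by
    intro τ hτ hτY
    have h1 : 0 ≤ C₂ * (5 * K) ^ 2 * Real.exp (μ * τ.im) := by positivity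
    calc ‖N τ‖ ≤ C₁ * (5 * K * Real.exp (μ * τ.im)) :=
          (hN₁ τ hτ).trans (mul_le_mul_of_nonneg_left (hu τ hτ hτY) hC₁)
      _ ≤ _ := by rw [hM]; linarith
  have hNstep : ∀ τ ∈ DLower A δ, τ + 1 ∈ DLower A δ → τ.im ≤ -Y →
      ‖N (τ + 1) - N τ‖ ≤ M * Real.exp (2 * μ * τ.im) := by
    intro τ hτ hτ1 hτY
    have h1 : 0 ≤ C₁ * (5 * K) * Real.exp (2 * μ * τ.im) := by positivity
    have h2 : Real.exp (2 * μ * τ.im) = Real.exp (μ * τ.im) ^ 2 := by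
      rw [← Real.exp_nat_mul]; congr 1; push_cast; ring
    calc ‖N (τ + 1) - N τ‖ ≤ C₂ * (5 * K * Real.exp (μ * τ.im)) ^ 2 := by
          refine (hN₂ τ hτ hτ1).trans ?_
          have := hu τ hτ hτY
          gcongr
      _ = C₂ * (5 * K) ^ 2 * Real.exp (2 * μ * τ.im) := by rw [h2]; ring
      _ ≤ _ := by rw [hM]; linarith
  -- The central strip.
  set g : ℂ → ℂ := fun τ => exp (2 * Real.pi * I * τ) * N τ with hg
  have dg : DifferentiableOn ℂ g (interior (DLower A δ)) :=
    DifferentiableOn.mul (by fun_prop) h.differentiableOn_normalSplitting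
  have hexp1 : ∀ s : ℂ, exp (2 * Real.pi * I * (s + 1)) = exp (2 * Real.pi * I * s) := fun s => by
    rw [show 2 * (Real.pi : ℂ) * I * (s + 1) = 2 * Real.pi * I * s + 2 * Real.pi * I by ring,
      exp_periodic]
  obtain ⟨c, K', hcK'⟩ := exists_limit_of_nearly_periodic (y₁ := Y) (K := M)
    (γ := 2 * Real.pi - μ) (ν := l - 2 * Real.pi) (ν' := 2 * μ - 2 * Real.pi) isOpen_interior dg
    (by linarith) (by linarith) (by linarith) (by linarith) (by linarith) hstrip
    (fun s h1 h2 => by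
      have := hNle s (interior_subset (hstrip s h1 h2)) h2
      simp only [hg]
      rw [norm_mul, norm_exp_leading_inv]
      calc _ ≤ Real.exp (-(2 * Real.pi * s.im)) * (M * Real.exp (μ * s.im)) := by gcongr
        _ = M * (Real.exp (-(2 * Real.pi * s.im)) * Real.exp (μ * s.im)) := by ring
        _ = _ := by rw [← Real.exp_add]; congr 2; ring)
    (fun s h1 h2 h3 => by
      have m1 := interior_subset (hstrip s (by rw [abs_le]; constructor <;> linarith) h3)
      have m2 := interior_subset (hstrip (s + 1)
        (by rw [add_re, one_re, abs_le]; constructor <;> linarith) (by simpa using h3))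
      have := hNstep s m1 m2 h3
      simp only [hg]
      rw [hexp1, ← mul_sub, norm_mul, norm_exp_leading_inv]
      calc _ ≤ Real.exp (-(2 * Real.pi * s.im)) * (M * Real.exp (2 * μ * s.im)) := by gcongr
        _ = M * (Real.exp (-(2 * Real.pi * s.im)) * Real.exp (2 * μ * s.im)) := by ring
        _ = _ := by rw [← Real.exp_add]; congr 2; ring)
  set φ : ℂ → ℝ := fun τ => ‖N τ - c * exp (-2 * Real.pi * I * τ)‖ with hφ
  have hcentral : ∀ τ : ℂ, |τ.re| ≤ 1 / 2 → τ.im ≤ -(Y + 1) →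
      φ τ ≤ max K' 0 * Real.exp (l * τ.im) := by
    intro τ h1 h2
    have h3 := hcK' τ h1 h2
    have e1 : N τ - c * exp (-2 * Real.pi * I * τ)
        = exp (-2 * Real.pi * I * τ) * (g τ - c) := by
      have : exp (-2 * Real.pi * I * τ) * exp (2 * Real.pi * I * τ) = 1 := by
        rw [← exp_add]; ring_nf; exact exp_zero
      simp only [hg]
      linear_combination -N τ * this
    simp only [hφ]
    rw [e1, norm_mul, norm_exp_leading]
    calc _ ≤ Real.exp (2 * Real.pi * τ.im)
          * (max K' 0 * Real.exp (-((l - 2 * Real.pi) * -τ.im))) := by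
          gcongr
          exact h3.trans (by gcongr; exact le_max_left _ _)
      _ = max K' 0 * (Real.exp (2 * Real.pi * τ.im)
          * Real.exp (-((l - 2 * Real.pi) * -τ.im))) := by ring
      _ = _ := by rw [← Real.exp_add]; congr 2; ring
  -- The rest of the domain: far down by horizontal propagation, else by boundedness.
  set q := Real.cos δ / Real.sin δ with hq
  have hq0 : 0 ≤ q := div_nonneg (Real.cos_nonneg_of_mem_Icc ⟨by linarith [h.δ_pos],
    h.δ_lt.le⟩) h.sin_pos.le
  have hd : 0 < 2 * μ - l := by linarith
  obtain ⟨B, hBm, hBp⟩ := h.exists_norm_le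
  set L := max K' 0 + (q + 1) * (1 / (2 * μ - l)) * M with hL
  have hL0 : 0 ≤ L := by positivity
  set L' := (C₁ * (2 * |B|) + ‖c‖) * Real.exp (l * (Y + 1)) with hL'
  have hL'0 : 0 ≤ L' := by positivity
  refine ⟨c, L + L', by positivity, fun τ hτ => ?_⟩
  have him : τ.im < 0 := ((mem_DLower_iff h.δ_pos h.δ_lt).1 hτ).2
  rw [add_mul]
  by_cases hτY : τ.im ≤ -(Y + 1)
  · refine le_add_of_le_of_nonneg ?_ (by positivity)
    set y := -τ.im with hy
    have hbd := horizontal_bound (A := A) h.δ_pos h.δ_lt (φ := φ) (y := y) (κ := 0)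
      (β := M * Real.exp (2 * μ * τ.im)) (ψ := max K' 0 * Real.exp (l * τ.im)) le_rfl
      (by positivity) (by positivity)
      (fun z hz hz' => by
        have hzτ : z.im = τ.im := by rw [hz', hy, neg_neg]
        have := hcentral z hz (by rw [hzτ]; exact hτY)
        rwa [hzτ] at this)
      (fun z hz hz1 hz' => by
        have hzτ : z.im = τ.im := by rw [hz', hy, neg_neg]
        have h1 := hNstep z hz hz1 (by rw [hzτ]; linarith)
        rw [hzτ] at h1
        have e0 : exp (-2 * Real.pi * I * (z + 1)) = exp (-2 * Real.pi * I * z) := by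
          have := exp_periodic (-2 * Real.pi * I * (z + 1))
          rw [← this]; congr 1; ring
        have e1 : N (z + 1) - c * exp (-2 * Real.pi * I * (z + 1))
            - (N z - c * exp (-2 * Real.pi * I * z)) = N (z + 1) - N z := by
          rw [e0]; ring
        have n1 := norm_sub_norm_le (N (z + 1) - c * exp (-2 * Real.pi * I * (z + 1)))
          (N z - c * exp (-2 * Real.pi * I * z))
        have n2 := norm_sub_norm_le (N z - c * exp (-2 * Real.pi * I * z))
          (N (z + 1) - c * exp (-2 * Real.pi * I * (z + 1)))
        rw [norm_sub_rev (N z - c * exp (-2 * Real.pi * I * z))] at n2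
        rw [e1] at n1 n2
        simp only [hφ]
        constructor <;> linarith)
      ⌈|τ.re|⌉₊ τ hτ (by rw [hy, neg_neg]) (by linarith [Nat.le_ceil |τ.re|])
    rw [add_zero, one_pow, one_mul] at hbd
    refine hbd.trans ?_
    have hn := (ceil_abs_re_le h.A_pos h.δ_pos h.δ_lt hτ).2
    rw [← hq, ← hy] at hn
    have hy1 : 1 ≤ y := by linarith
    have hny : (⌈|τ.re|⌉₊ : ℝ) ≤ (q + 1) * y := by linarith
    have e2 : Real.exp (2 * μ * τ.im)
        = Real.exp (-((2 * μ - l) * y)) * Real.exp (l * τ.im) := by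
      rw [← Real.exp_add]; congr 1; rw [hy]; ring
    rw [e2]
    calc _ ≤ max K' 0 * Real.exp (l * τ.im) + ((q + 1) * y)
            * (M * (Real.exp (-((2 * μ - l) * y)) * Real.exp (l * τ.im))) := by gcongr
      _ = max K' 0 * Real.exp (l * τ.im) + (q + 1) * (y * Real.exp (-((2 * μ - l) * y)))
            * M * Real.exp (l * τ.im) := by ring
      _ ≤ max K' 0 * Real.exp (l * τ.im) + (q + 1) * (1 / (2 * μ - l))
            * M * Real.exp (l * τ.im) := by
          have := mul_exp_le (y := y) hd
          gcongr
      _ = _ := by rw [hL]; ring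
  · refine le_add_of_nonneg_of_le (by positivity) ?_
    have h1 : ‖N τ‖ ≤ C₁ * (2 * |B|) := by
      refine (hN₁ τ hτ).trans ?_
      gcongr
      refine (norm_sub_le _ _).trans ?_
      have := hBm τ (DLower_subset_DMinus A δ hτ)
      have := hBp τ (DLower_subset_DPlus A δ hτ)
      linarith [le_abs_self B]
    have h2 : ‖c * exp (-2 * Real.pi * I * τ)‖ ≤ ‖c‖ := by
      rw [norm_mul, norm_exp_leading]
      refine mul_le_of_le_one_right (norm_nonneg _) ?_
      rw [Real.exp_le_one_iff]
      nlinarith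
    have h3 : 1 ≤ Real.exp (l * (Y + 1)) * Real.exp (l * τ.im) := by
      rw [← Real.exp_add]
      refine Real.one_le_exp ?_
      rw [← mul_add]
      exact mul_nonneg (by linarith) (by linarith)
    calc _ ≤ C₁ * (2 * |B|) + ‖c‖ := (norm_sub_le _ _).trans (add_le_add h1 h2)
      _ ≤ (C₁ * (2 * |B|) + ‖c‖) * (Real.exp (l * (Y + 1)) * Real.exp (l * τ.im)) :=
          le_mul_of_one_le_right (by positivity) h3
      _ = _ := by rw [hL']; ring

/-- The normal component of the splitting is exponentially small: its leading term is
`c e^{-2πiτ}`, and the remainder decays with any rate below `4π`. -/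
theorem exists_hasLeadingTerm (h : IsSeparatrixPair A δ a₂ ξm ηm ξp ηp) :
    ∃ c : ℂ, HasLeadingTerm A δ
      (normalSplitting (DMinus A δ) (sepCurve a₂ ξm ηm) (sepCurve a₂ ξp ηp)) c := by
  have hpi := Real.pi_pos
  obtain ⟨c, K, hK, hc⟩ := h.exists_leadingTerm_of_rate (l := 3 * Real.pi) (by linarith)
    (by linarith)
  set N := normalSplitting (DMinus A δ) (sepCurve a₂ ξm ηm) (sepCurve a₂ ξp ηp) with hN
  refine ⟨c, fun l hl => ?_⟩
  set l' := max l (3 * Real.pi) with hl'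
  obtain ⟨c', K', hK', hc'⟩ := h.exists_leadingTerm_of_rate (l := l')
    (by linarith [le_max_right l (3 * Real.pi)]) (max_lt hl (by linarith))
  have hmono : ∀ l₁ l₂ : ℝ, l₁ ≤ l₂ → ∀ τ ∈ DLower A δ,
      Real.exp (l₂ * τ.im) ≤ Real.exp (l₁ * τ.im) := by
    intro l₁ l₂ hle τ hτ
    have him : τ.im < 0 := ((mem_DLower_iff h.δ_pos h.δ_lt).1 hτ).2
    rw [Real.exp_le_exp]
    nlinarith
  -- The coefficient does not depend on the rate.
  have hcc : c' = c := eq_of_leadingTerm_bounds h.δ_pos h.δ_lt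
    (fun τ hτ => (hc' τ (interior_subset hτ)).trans (mul_le_mul_of_nonneg_left
      (hmono _ _ (le_max_right _ _) τ (interior_subset hτ)) hK'))
    (fun τ hτ => hc τ (interior_subset hτ))
  refine ⟨K', hK', fun τ hτ => ?_⟩
  rw [← hcc]
  exact (hc' τ hτ).trans (mul_le_mul_of_nonneg_left (hmono _ _ (le_max_left _ _) τ hτ) hK')

end IsSeparatrixPair

/-! ### Independence of the choice of the separatrices -/

namespace IsSeparatrixPair

variable {A δ A₁ δ₁ A₂ δ₂ : ℝ} {a₂ : ℂ}
  {ξm ηm ξp ηp ξm₁ ηm₁ ξp₁ ηp₁ ξm₂ ηm₂ ξp₂ ηp₂ : ℂ → ℂ}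

theorem sepCurve_unstable_eq (h₁ : IsSeparatrixPair A δ a₂ ξm₁ ηm₁ ξp₁ ηp₁)
    (h₂ : IsSeparatrixPair A δ a₂ ξm₂ ηm₂ ξp₂ ηp₂) {τ : ℂ} (hτ : τ ∈ DMinus A δ) :
    sepCurve a₂ ξm₁ ηm₁ τ = sepCurve a₂ ξm₂ ηm₂ τ :=
  sepCurve_eq_of_DMinus h₁.δ_pos h₁.δ_lt h₁.unstable h₂.unstable τ hτ

theorem sepCurve_stable_eq (h₁ : IsSeparatrixPair A δ a₂ ξm₁ ηm₁ ξp₁ ηp₁)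
    (h₂ : IsSeparatrixPair A δ a₂ ξm₂ ηm₂ ξp₂ ηp₂) {τ : ℂ} (hτ : τ ∈ DPlus A δ) :
    sepCurve a₂ ξp₁ ηp₁ τ = sepCurve a₂ ξp₂ ηp₂ τ :=
  sepCurve_eq_of_DPlus h₁.δ_pos h₁.δ_lt h₁.stable h₂.stable τ hτ

theorem curveDiff_eq (h₁ : IsSeparatrixPair A δ a₂ ξm₁ ηm₁ ξp₁ ηp₁)
    (h₂ : IsSeparatrixPair A δ a₂ ξm₂ ηm₂ ξp₂ ηp₂) {τ : ℂ} (hτ : τ ∈ DLower A δ) :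
    curveDiff a₂ ξm₁ ηm₁ ξp₁ ηp₁ τ = curveDiff a₂ ξm₂ ηm₂ ξp₂ ηp₂ τ := by
  rw [curveDiff, curveDiff, h₁.sepCurve_unstable_eq h₂ (DLower_subset_DMinus A δ hτ),
    h₁.sepCurve_stable_eq h₂ (DLower_subset_DPlus A δ hτ)]

theorem normalSplitting_congr (h₁ : IsSeparatrixPair A δ a₂ ξm₁ ηm₁ ξp₁ ηp₁)
    (h₂ : IsSeparatrixPair A δ a₂ ξm₂ ηm₂ ξp₂ ηp₂) {τ : ℂ} (hτ : τ ∈ DLower A δ) :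
    normalSplitting (DMinus A δ) (sepCurve a₂ ξm₁ ηm₁) (sepCurve a₂ ξp₁ ηp₁) τ
      = normalSplitting (DMinus A δ) (sepCurve a₂ ξm₂ ηm₂) (sepCurve a₂ ξp₂ ηp₂) τ := by
  have hm := DLower_subset_DMinus A δ hτ
  have e : ∀ z ∈ DMinus A δ, sepCurve a₂ ξm₁ ηm₁ z = sepCurve a₂ ξm₂ ηm₂ z :=
    fun z hz => h₁.sepCurve_unstable_eq h₂ hz
  rw [normalSplitting_eq, normalSplitting_eq, h₁.curveDiff_eq h₂ hτ, tangent, tangent,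
    derivWithin_congr (fun z hz => congrArg Prod.fst (e z hz)) (congrArg Prod.fst (e τ hm)),
    derivWithin_congr (fun z hz => congrArg Prod.snd (e z hz)) (congrArg Prod.snd (e τ hm))]

/-- In the interior of the domains it does not matter within which domain `D^-` the derivative of
the unstable separatrix is taken. -/
theorem normalSplitting_eq_of_subset (h : IsSeparatrixPair A₁ δ₁ a₂ ξm ηm ξp ηp)
    (hA : A₁ ≤ A) (hδ : δ₁ ≤ δ) (hδ' : δ < Real.pi / 2) {τ : ℂ}
    (hτ : τ ∈ interior (DLower A δ)) :
    normalSplitting (DMinus A₁ δ₁) (sepCurve a₂ ξm ηm) (sepCurve a₂ ξp ηp) τ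
      = normalSplitting (DMinus A δ) (sepCurve a₂ ξm ηm) (sepCurve a₂ ξp ηp) τ := by
  have m : DMinus A δ ∈ nhds τ := Filter.mem_of_superset (isOpen_interior.mem_nhds hτ)
    (interior_subset.trans (DLower_subset_DMinus A δ))
  have m₁ : DMinus A₁ δ₁ ∈ nhds τ :=
    Filter.mem_of_superset m (DMinus_subset hA h.δ_pos hδ hδ')
  simp only [normalSplitting, derivWithin_of_mem_nhds m, derivWithin_of_mem_nhds m₁]

theorem mono (h : IsSeparatrixPair A₁ δ₁ a₂ ξm ηm ξp ηp) (hA : A₁ ≤ A) (hδ : δ₁ ≤ δ)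
    (hδ' : δ < Real.pi / 2) : IsSeparatrixPair A δ a₂ ξm ηm ξp ηp where
  A_pos := h.A_pos.trans_le hA
  δ_pos := h.δ_pos.trans_le hδ
  δ_lt := hδ'
  unstable := h.unstable.mono (DMinus_subset hA h.δ_pos hδ hδ')
  stable := h.stable.mono (DPlus_subset hA h.δ_pos hδ hδ')
  unstable_diff := h.unstable_diff.mono (interior_mono (DMinus_subset hA h.δ_pos hδ hδ'))
  stable_diff := h.stable_diff.mono (interior_mono (DPlus_subset hA h.δ_pos hδ hδ'))
  stable_cont := h.stable_cont.mono (DPlus_subset hA h.δ_pos hδ hδ')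

/-- All pairs of separatrices have the same leading coefficient: on the domain with the larger
parameters, which is contained in both given domains, the pairs coincide. -/
theorem leadingTerm_eq (h₁ : IsSeparatrixPair A₁ δ₁ a₂ ξm₁ ηm₁ ξp₁ ηp₁)
    (h₂ : IsSeparatrixPair A₂ δ₂ a₂ ξm₂ ηm₂ ξp₂ ηp₂) {c₁ c₂ : ℂ}
    (hc₁ : HasLeadingTerm A₁ δ₁
      (normalSplitting (DMinus A₁ δ₁) (sepCurve a₂ ξm₁ ηm₁) (sepCurve a₂ ξp₁ ηp₁)) c₁)
    (hc₂ : HasLeadingTerm A₂ δ₂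
      (normalSplitting (DMinus A₂ δ₂) (sepCurve a₂ ξm₂ ηm₂) (sepCurve a₂ ξp₂ ηp₂)) c₂) :
    c₁ = c₂ := by
  have hδ : max δ₁ δ₂ < Real.pi / 2 := max_lt h₁.δ_lt h₂.δ_lt
  have h₁' := h₁.mono (le_max_left A₁ A₂) (le_max_left δ₁ δ₂) hδ
  have h₂' := h₂.mono (le_max_right A₁ A₂) (le_max_right δ₁ δ₂) hδ
  refine HasLeadingTerm.unique h₁'.δ_pos hδ hc₁ hc₂
    (DLower_subset (le_max_left A₁ A₂) h₁.δ_pos (le_max_left δ₁ δ₂) hδ)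
    (DLower_subset (le_max_right A₁ A₂) h₂.δ_pos (le_max_right δ₁ δ₂) hδ) fun τ hτ => ?_
  rw [h₁.normalSplitting_eq_of_subset (le_max_left _ _) (le_max_left _ _) hδ hτ,
    h₂.normalSplitting_eq_of_subset (le_max_right _ _) (le_max_right _ _) hδ hτ,
    h₁'.normalSplitting_congr h₂' (interior_subset hτ)]

end IsSeparatrixPair

/-- The coefficient of the leading term depends only on the normalization `a₂`. -/
theorem exists_common_leadingTerm (a₂ : ℂ) : ∃ c : ℂ, ∀ (A δ : ℝ) (ξm ηm ξp ηp : ℂ → ℂ),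
    IsSeparatrixPair A δ a₂ ξm ηm ξp ηp → HasLeadingTerm A δ
      (normalSplitting (DMinus A δ) (sepCurve a₂ ξm ηm) (sepCurve a₂ ξp ηp)) c := by
  by_cases hex : ∃ (A δ : ℝ) (ξm ηm ξp ηp : ℂ → ℂ), IsSeparatrixPair A δ a₂ ξm ηm ξp ηp
  · obtain ⟨A, δ, ξm, ηm, ξp, ηp, h⟩ := hex
    obtain ⟨c, hc⟩ := h.exists_hasLeadingTerm
    refine ⟨c, fun A' δ' ξm' ηm' ξp' ηp' h' => ?_⟩
    obtain ⟨c', hc'⟩ := h'.exists_hasLeadingTerm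
    rwa [h.leadingTerm_eq h' hc hc']
  · push Not at hex
    exact ⟨0, fun A δ ξm ηm ξp ηp h => (hex A δ ξm ηm ξp ηp h).elim⟩

/-! ### Weighted bounds for the remainder -/

theorem rpow_mul_exp_neg_le {μ y : ℝ} (hμ : 0 < μ) (hy : 0 ≤ y) :
    y ^ μ * Real.exp (-y) ≤ μ ^ μ := by
  have h1 : y ≤ μ * Real.exp (y / μ) := by
    have := Real.add_one_le_exp (y / μ)
    calc y = μ * (y / μ) := by field_simp
      _ ≤ _ := by gcongr; linarith
  have h2 : y ^ μ ≤ μ ^ μ * Real.exp y := by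
    refine (Real.rpow_le_rpow hy h1 hμ.le).trans_eq ?_
    rw [Real.mul_rpow hμ.le (Real.exp_pos _).le, ← Real.exp_mul, div_mul_cancel₀ _ hμ.ne']
  rw [Real.exp_neg, ← div_eq_mul_inv, div_le_iff₀ (Real.exp_pos y)]
  exact h2

theorem HasLeadingTerm.exists_weighted_bound {A δ : ℝ} {N : ℂ → ℂ} {c : ℂ} (hA : 0 < A)
    (hδ : 0 < δ) (hδ' : δ < Real.pi / 2) (h : HasLeadingTerm A δ N c) {μ : ℝ} (hμ : 0 < μ) :
    ∃ M : ℝ, 0 ≤ M ∧ ∀ τ ∈ DLower A δ,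
      ‖τ‖ ^ μ * ‖N τ - c * exp (-2 * Real.pi * I * τ)‖ ≤ M := by
  obtain ⟨K, hK0, hK⟩ := h 1 (by linarith [Real.pi_gt_three])
  set q := Real.cos δ / Real.sin δ with hq
  have hq0 : 0 ≤ q := div_nonneg
    (Real.cos_nonneg_of_mem_Icc ⟨by linarith, hδ'.le⟩)
    (Real.sin_pos_of_pos_of_lt_pi hδ (by linarith [Real.pi_pos])).le
  refine ⟨(q + 1) ^ μ * K * μ ^ μ, by positivity, fun τ hτ => ?_⟩
  have him : τ.im < 0 := ((mem_DLower_iff hδ hδ').1 hτ).2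
  have hre := (ceil_abs_re_le hA hδ hδ' hτ).1
  have hnorm : ‖τ‖ ≤ (q + 1) * -τ.im := by
    have := norm_le_abs_re_add_abs_im τ
    rw [abs_of_neg him] at this
    rw [← hq] at hre
    linarith
  have h1 : ‖τ‖ ^ μ ≤ (q + 1) ^ μ * (-τ.im) ^ μ := by
    rw [← Real.mul_rpow (by linarith) (by linarith)]
    exact Real.rpow_le_rpow (norm_nonneg _) hnorm hμ.le
  have h2 := hK τ hτ
  rw [one_mul] at h2
  have h3 := rpow_mul_exp_neg_le hμ (y := -τ.im) (by linarith)
  rw [neg_neg] at h3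
  have h4 : 0 ≤ (-τ.im) ^ μ := Real.rpow_nonneg (by linarith) _
  calc _ ≤ (q + 1) ^ μ * (-τ.im) ^ μ * (K * Real.exp τ.im) := by gcongr
    _ = (q + 1) ^ μ * K * ((-τ.im) ^ μ * Real.exp τ.im) := by ring
    _ ≤ _ := by gcongr

theorem IsSeparatrix.bddAbove_curveDiff {A δ ε : ℝ} {a₂ : ℂ} {ξm ηm ξp ηp : ℂ → ℂ} (hA : 0 < A)
    (hδ : 0 < δ) (hδ' : δ < Real.pi / 2) (hm : IsSeparatrix (DMinus A δ) ε a₂ ξm ηm)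
    (hp : IsSeparatrix (DPlus A δ) ε a₂ ξp ηp) :
    BddAbove ((fun τ => ‖τ‖ ^ (2 - ε) * ‖curveDiff a₂ ξm ηm ξp ηp τ‖) '' DLower A δ) := by
  have hr : 0 < A * Real.sin δ :=
    mul_pos hA (Real.sin_pos_of_pos_of_lt_pi hδ (by linarith [Real.pi_pos]))
  set r := A * Real.sin δ with hrdef
  obtain ⟨K₁, h1, hK₁⟩ := hm.1.exists_bound
  obtain ⟨K₂, h2, hK₂⟩ := hm.2.1.exists_bound
  obtain ⟨K₃, h3, hK₃⟩ := hp.1.exists_bound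
  obtain ⟨K₄, h4, hK₄⟩ := hp.2.1.exists_bound
  refine ⟨max ((K₃ + K₁) / r) ((K₄ + K₂) / r ^ 2), ?_⟩
  rintro _ ⟨τ, hτ, rfl⟩
  have m := DLower_subset_DMinus A δ hτ
  have p := DLower_subset_DPlus A δ hτ
  have hrτ : r ≤ ‖τ‖ := norm_ge_of_mem_DMinus hδ hδ' m
  have hτ0 : 0 < ‖τ‖ := hr.trans_le hrτ
  have hne : τ ≠ 0 := norm_pos_iff.1 hτ0
  have hpow : ‖τ‖ ^ (2 - ε) = ‖τ‖ ^ (1 - ε) * ‖τ‖ := by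
    rw [← Real.rpow_add_one hτ0.ne']; congr 1; ring
  have hpos : 0 < ‖τ‖ ^ (1 - ε) := Real.rpow_pos_of_pos hτ0 _
  have b1 : ‖ξp τ - ξm τ‖ ≤ (K₃ + K₁) / ‖τ‖ ^ (1 - ε) := by
    rw [add_div]
    exact (norm_sub_le _ _).trans (add_le_add (hK₃ τ p hne) (hK₁ τ m hne))
  have b2 : ‖ηp τ - ηm τ‖ ≤ (K₄ + K₂) / ‖τ‖ ^ (1 - ε) := by
    rw [add_div]
    exact (norm_sub_le _ _).trans (add_le_add (hK₄ τ p hne) (hK₂ τ m hne))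
  simp only
  rw [Prod.norm_def, mul_max_of_nonneg _ _ (by positivity), curveDiff_fst, curveDiff_snd, norm_div,
    norm_div, norm_pow, norm_pow, hpow]
  refine max_le_max ?_ ?_
  · calc _ ≤ ‖τ‖ ^ (1 - ε) * ‖τ‖ * ((K₃ + K₁) / ‖τ‖ ^ (1 - ε) / ‖τ‖ ^ 2) := by gcongr
      _ = (K₃ + K₁) / ‖τ‖ := by field_simp
      _ ≤ _ := by gcongr
  · calc _ ≤ ‖τ‖ ^ (1 - ε) * ‖τ‖ * ((K₄ + K₂) / ‖τ‖ ^ (1 - ε) / ‖τ‖ ^ 3) := by gcongr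
      _ = (K₄ + K₂) / ‖τ‖ ^ 2 := by field_simp
      _ ≤ _ := by gcongr

/-- The remainder can be compared with the square of the norm `X` of the splitting, uniformly in
the weight `2 - ε`: either the separatrices coincide and the remainder vanishes, or `X` is bounded
below by the value of the splitting at a point. -/
theorem IsSeparatrixPair.exists_norm_remainder_le {A δ : ℝ} {a₂ c : ℂ} {ξm ηm ξp ηp : ℂ → ℂ}
    (h : IsSeparatrixPair A δ a₂ ξm ηm ξp ηp)
    (hc : HasLeadingTerm A δ
      (normalSplitting (DMinus A δ) (sepCurve a₂ ξm ηm) (sepCurve a₂ ξp ηp)) c) :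
    ∃ n : ℝ, 0 ≤ n ∧ ∀ ε : ℝ, 0 < ε → ε < 1 → ∀ X : ℝ,
      (∀ s ∈ DLower A δ, ‖s‖ ^ (2 - ε) * ‖curveDiff a₂ ξm ηm ξp ηp s‖ ≤ X) →
      ∀ τ ∈ DLower A δ,
        ‖normalSplitting (DMinus A δ) (sepCurve a₂ ξm ηm) (sepCurve a₂ ξp ηp) τ
          - c * exp (-2 * Real.pi * I * τ)‖ ≤ n * X ^ 2 *
        ‖normalSplitting (DMinus A δ) (sepCurve a₂ ξm ηm) (sepCurve a₂ ξp ηp) τ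
          - c * exp (-2 * Real.pi * I * τ)‖ := by
  by_cases hex : ∃ s ∈ DLower A δ, curveDiff a₂ ξm ηm ξp ηp s ≠ 0
  · obtain ⟨s, hs, hs0⟩ := hex
    have hr := mul_pos h.A_pos h.sin_pos
    have hsn : 0 < ‖s‖ :=
      hr.trans_le (norm_ge_of_mem_DMinus h.δ_pos h.δ_lt (DLower_subset_DMinus A δ hs))
    have hd : 0 < ‖curveDiff a₂ ξm ηm ξp ηp s‖ := norm_pos_iff.2 hs0
    -- A lower bound of `‖s‖ ^ (2 - ε)` for all `ε` in `(0, 1)`.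
    set m := min ‖s‖ (‖s‖ ^ 2) with hm
    have hm0 : 0 < m := lt_min hsn (by positivity)
    set x := m * ‖curveDiff a₂ ξm ηm ξp ηp s‖ with hx
    have hx0 : 0 < x := by positivity
    refine ⟨1 / x ^ 2, by positivity, fun ε hε hε' X hX τ _ => ?_⟩
    have hms : m ≤ ‖s‖ ^ (2 - ε) := by
      rcases le_total ‖s‖ 1 with h1 | h1
      · calc m ≤ ‖s‖ ^ (2 : ℝ) := by rw [Real.rpow_two]; exact min_le_right _ _
          _ ≤ _ := Real.rpow_le_rpow_of_exponent_ge hsn h1 (by linarith)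
      · calc m ≤ ‖s‖ ^ (1 : ℝ) := by rw [Real.rpow_one]; exact min_le_left _ _
          _ ≤ _ := Real.rpow_le_rpow_of_exponent_le h1 (by linarith)
    have hxX : x ≤ X := (mul_le_mul_of_nonneg_right hms hd.le).trans (hX s hs)
    refine le_mul_of_one_le_left (norm_nonneg _) ?_
    rw [one_div, ← div_eq_inv_mul, one_le_div (by positivity)]
    gcongr
  · push Not at hex
    have hN : ∀ τ ∈ DLower A δ,
        normalSplitting (DMinus A δ) (sepCurve a₂ ξm ηm) (sepCurve a₂ ξp ηp) τ = 0 := by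
      intro τ hτ
      rw [normalSplitting_eq, hex τ hτ]
      simp [area]
    have hc0 : c = 0 := HasLeadingTerm.unique h.δ_pos h.δ_lt hc
      (N₂ := fun _ => 0) (A₂ := A) (δ₂ := δ)
      (fun l _ => ⟨0, le_rfl, fun τ _ => by simp⟩) le_rfl le_rfl
      fun τ hτ => hN τ (interior_subset hτ)
    refine ⟨0, le_rfl, fun ε _ _ X _ τ hτ => ?_⟩
    rw [hN τ hτ, hc0]
    simp

/-! ### The asymptotics of the splitting -/

theorem IsSeparatrixPair.memX_remainder {A δ μ M : ℝ} {a₂ c : ℂ} {ξm ηm ξp ηp : ℂ → ℂ} {D : Set ℂ}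
    (h : IsSeparatrixPair A δ a₂ ξm ηm ξp ηp) (hD : D ⊆ DLower A δ)
    (hM : ∀ τ ∈ D, ‖τ‖ ^ μ *
      ‖normalSplitting (DMinus A δ) (sepCurve a₂ ξm ηm) (sepCurve a₂ ξp ηp) τ
        - c * exp (-2 * Real.pi * I * τ)‖ ≤ M) :
    MemX D μ fun τ => normalSplitting (DMinus A δ) (sepCurve a₂ ξm ηm) (sepCurve a₂ ξp ηp) τ
        - c * exp (-2 * Real.pi * I * τ) := by
  refine ⟨(h.continuousOn_normalSplitting.mono hD).sub (Continuous.continuousOn (by fun_prop)),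
    (h.differentiableOn_normalSplitting.mono (interior_mono hD)).sub
      (Differentiable.differentiableOn (by fun_prop)), M, ?_⟩
  rintro _ ⟨τ, hτ, rfl⟩
  exact hM τ hτ

end HenonSplitting

end

theorem mainTheorem4 (a₂ : ℂ) :
    ∃ Θ₁ : ℂ, ∀ A δ B δ' : ℝ, 0 < A → 0 < δ → δ < Real.pi / 2 →
      0 < δ' → δ' < Real.pi / 2 → 4 * Real.tan δ' < B →
      HenonSplitting.DTrunc B δ' ⊆ HenonSplitting.DLower A δ →
      ∃ (K' : ℝ → ℝ → ℝ) (K'' : ℝ → ℝ → ℝ → ℝ),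
        ∀ ε : ℝ, 0 < ε → ε < 1 → ∀ ξm ηm ξp ηp : ℂ → ℂ,
          HenonSplitting.IsSeparatrix (HenonSplitting.DMinus A δ) ε a₂ ξm ηm →
          HenonSplitting.IsSeparatrix (HenonSplitting.DPlus A δ) ε a₂ ξp ηp →
          ∃ Θp : ℂ → ℂ,
            (∃ C : ℝ, ∀ τ ∈ HenonSplitting.DTrunc B δ',
              ‖HenonSplitting.normalSplitting (HenonSplitting.DMinus A δ)
                  (HenonSplitting.sepCurve a₂ ξm ηm) (HenonSplitting.sepCurve a₂ ξp ηp) τ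
                - (Θ₁ * Complex.exp (-2 * Real.pi * Complex.I * τ) + Θp τ)‖
                ≤ C * Real.exp (-4 * Real.pi * |τ.im|)) ∧
            ∀ μ ρ : ℝ, 0 < μ → 0 < ρ →
              HenonSplitting.MemX (HenonSplitting.DTrunc B δ') μ Θp ∧
              HenonSplitting.normX (HenonSplitting.DTrunc B δ') μ Θp ≤
                K' μ ρ * HenonSplitting.normX (HenonSplitting.DLower A δ) (2 - ε)
                  (fun τ => HenonSplitting.sepCurve a₂ ξp ηp τ
                    - HenonSplitting.sepCurve a₂ ξm ηm τ) ^ 2 ∧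
              ∀ κ : ℝ, 0 < κ → ∀ τ ∈ HenonSplitting.DTrunc B δ',
                ‖Θp τ‖ ≤ K'' μ ρ κ * ‖τ‖ ^ (1 / 2 + ρ + ε) *
                  HenonSplitting.normX (HenonSplitting.DLower A δ) (2 - ε)
                    (fun τ => HenonSplitting.sepCurve a₂ ξp ηp τ
                      - HenonSplitting.sepCurve a₂ ξm ηm τ) ^ 2 *
                  Real.exp (4 * Real.pi * (A - (1 - κ) * |τ.im|)) := by
  open HenonSplitting in
  obtain ⟨c, hc⟩ := exists_common_leadingTerm a₂
  refine ⟨c, fun A δ B δ' hA hδ hδ2 hδ' hδ'2 hB hsub => ?_⟩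
  have hpi := Real.pi_pos
  by_cases hex : ∃ ξm ηm ξp ηp : ℂ → ℂ, IsSeparatrixPair A δ a₂ ξm ηm ξp ηp
  · obtain ⟨ξr, ηr, ξs, ηs, hr⟩ := hex
    have hlead := hc A δ ξr ηr ξs ηs hr
    -- The constants are those of one pair of separatrices; all other pairs have the same splitting.
    set R : ℂ → ℂ := fun τ =>
      normalSplitting (DMinus A δ) (sepCurve a₂ ξr ηr) (sepCurve a₂ ξs ηs) τ
        - c * Complex.exp (-2 * Real.pi * Complex.I * τ) with hR
    have hM : ∀ μ : ℝ, ∃ M : ℝ, 0 ≤ M ∧ (0 < μ → ∀ τ ∈ DLower A δ, ‖τ‖ ^ μ * ‖R τ‖ ≤ M) := by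
      intro μ
      by_cases hμ : 0 < μ
      · obtain ⟨M, h0, h1⟩ := hlead.exists_weighted_bound hA hδ hδ2 hμ
        exact ⟨M, h0, fun _ => h1⟩
      · exact ⟨0, le_rfl, fun h => absurd h hμ⟩
    have hL : ∀ κ : ℝ, ∃ L : ℝ, 0 ≤ L ∧ (0 < κ → ∀ τ ∈ DLower A δ,
        ‖R τ‖ ≤ L * Real.exp (4 * Real.pi * (1 - κ) * τ.im)) := by
      intro κ
      by_cases hκ : 0 < κ
      · obtain ⟨L, h0, h1⟩ := hlead (4 * Real.pi * (1 - κ)) (by nlinarith)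
        exact ⟨L, h0, fun _ => h1⟩
      · exact ⟨0, le_rfl, fun h => absurd h hκ⟩
    choose M hM0 hM using hM
    choose L hL0 hL using hL
    obtain ⟨n, hn0, hn⟩ := hr.exists_norm_remainder_le hlead
    have hB0 : 0 < B := by
      have := Real.tan_pos_of_pos_of_lt_pi_div_two hδ' hδ'2
      linarith
    have hb0 : 0 < min 1 B := lt_min one_pos hB0
    refine ⟨fun μ _ => n * M μ, fun _ ρ κ => n * L κ / min 1 B ^ (3 / 2 + ρ),
      fun ε hε hε1 ξm ηm ξp ηp hm hp => ?_⟩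
    have h := hm.isSeparatrixPair hA hδ hδ2 hε1 hp
    set X := normX (DLower A δ) (2 - ε) fun τ => sepCurve a₂ ξp ηp τ - sepCurve a₂ ξm ηm τ with hX
    have hXle : ∀ s ∈ DLower A δ, ‖s‖ ^ (2 - ε) * ‖curveDiff a₂ ξr ηr ξs ηs s‖ ≤ X := by
      intro s hs
      rw [hr.curveDiff_eq h hs]
      exact le_csSup (hm.bddAbove_curveDiff hA hδ hδ2 hp) ⟨s, hs, rfl⟩
    set Θp : ℂ → ℂ := fun τ =>
      normalSplitting (DMinus A δ) (sepCurve a₂ ξm ηm) (sepCurve a₂ ξp ηp) τ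
        - c * Complex.exp (-2 * Real.pi * Complex.I * τ) with hΘp
    have hΘR : ∀ τ ∈ DTrunc B δ', Θp τ = R τ := fun τ hτ => by
      simp only [hΘp, hR, h.normalSplitting_congr hr (hsub hτ)]
    have hRn : ∀ τ ∈ DTrunc B δ', ‖R τ‖ ≤ n * X ^ 2 * ‖R τ‖ := fun τ hτ =>
      hn ε hε hε1 X hXle τ (hsub hτ)
    refine ⟨Θp, ⟨0, fun τ _ => ?_⟩, fun μ ρ hμ hρ => ⟨?_, ?_, fun κ hκ τ hτ => ?_⟩⟩
    · rw [zero_mul, hΘp, add_sub_cancel, sub_self, norm_zero]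
    · refine h.memX_remainder hsub (M := M μ) fun τ hτ => ?_
      have := hM μ hμ τ (hsub hτ)
      rwa [← hΘR τ hτ] at this
    · refine Real.sSup_le ?_ (mul_nonneg (mul_nonneg hn0 (hM0 μ)) (sq_nonneg X))
      rintro _ ⟨τ, hτ, rfl⟩
      simp only
      rw [hΘR τ hτ]
      calc ‖τ‖ ^ μ * ‖R τ‖ ≤ ‖τ‖ ^ μ * (n * X ^ 2 * ‖R τ‖) := by gcongr; exact hRn τ hτ
        _ = n * X ^ 2 * (‖τ‖ ^ μ * ‖R τ‖) := by ring
        _ ≤ n * X ^ 2 * M μ := by gcongr; exact hM μ hμ τ (hsub hτ)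
        _ = n * M μ * X ^ 2 := by ring
    · have him : τ.im ≤ -B := hτ.2.2
      have habs : |τ.im| = -τ.im := abs_of_neg (by linarith)
      have hbτ : min 1 B ≤ ‖τ‖ := by
        have := Complex.abs_im_le_norm τ
        rw [habs] at this
        exact (min_le_right 1 B).trans (by linarith)
      have hpow : min 1 B ^ (3 / 2 + ρ) ≤ ‖τ‖ ^ (1 / 2 + ρ + ε) :=
        (Real.rpow_le_rpow_of_exponent_ge hb0 (min_le_left 1 B) (by linarith)).trans
          (Real.rpow_le_rpow hb0.le hbτ (by linarith))
      have hpos : 0 < min 1 B ^ (3 / 2 + ρ) := Real.rpow_pos_of_pos hb0 _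
      have hratio : 1 ≤ ‖τ‖ ^ (1 / 2 + ρ + ε) / min 1 B ^ (3 / 2 + ρ) := (one_le_div hpos).2 hpow
      have hexp : Real.exp (4 * Real.pi * (1 - κ) * τ.im)
          ≤ Real.exp (4 * Real.pi * (A - (1 - κ) * |τ.im|)) := by
        rw [Real.exp_le_exp, habs]
        have := mul_pos hpi hA
        linarith
      rw [hΘR τ hτ]
      calc ‖R τ‖ ≤ n * X ^ 2 * ‖R τ‖ := hRn τ hτ
        _ ≤ n * X ^ 2 * (L κ * Real.exp (4 * Real.pi * (A - (1 - κ) * |τ.im|))) := by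
          gcongr
          exact (hL κ hκ τ (hsub hτ)).trans (mul_le_mul_of_nonneg_left hexp (hL0 κ))
        _ = n * L κ * X ^ 2 * Real.exp (4 * Real.pi * (A - (1 - κ) * |τ.im|)) * 1 := by ring
        _ ≤ n * L κ * X ^ 2 * Real.exp (4 * Real.pi * (A - (1 - κ) * |τ.im|))
            * (‖τ‖ ^ (1 / 2 + ρ + ε) / min 1 B ^ (3 / 2 + ρ)) := by
          have := hL0 κ
          gcongr
        _ = _ := by ring
  · refine ⟨0, 0, fun ε _ hε1 ξm ηm ξp ηp hm hp => ?_⟩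
    exact (hex ⟨ξm, ηm, ξp, ηp, hm.isSeparatrixPair hA hδ hδ2 hε1 hp⟩).elim
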